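/- Let $G_N=N^{-1/2}G$, where $G$ is an $N\times N$ matrix of i.i.d. standard complex normal random variables (density $\pi^{-1}e^{-|z|^2}$ on $\mathbb C$). Let $k_2$ be a non-negative integer and let $\gamma\ge k_2$ be real. For $u_2\in\mathbb C$ put $z_2=u_2/\sqrt N$. Then for every $N\ge 1$ and every $u_2\in\mathbb C$ the random variable $|\det G_N|^{2\gamma}|\det(G_N-z_2)|^{2k_2}$ is integrable and, uniformly for $u_2$ in compact subsets of $\mathbb C$, as $N\to\infty$, $$\mathbb E\left(|\det G_N|^{2\gamma}\,|\det(G_N-z_2)|^{2k_2}\right)=e^{-\gamma N+k_2N(|z_2|^2-1)+\frac{\gamma^2}{2}\log N+\frac{k_2^2}{2}\log N}\;e^{-2\gamma k_2\log|z_2|}\;\frac{(2\pi)^{(\gamma+k_2)/2}}{G(1+\gamma)\,G(1+k_2)}\;F_{\gamma,k_2}\!\left(N|z_2|^2\right)\,(1+o(1)).$$ Here $G(\cdot)$ is the Barnes $G$-function, and $F_{\gamma,k}(x)=\mathbb P(\lambda_{\max}<x)$ is the distribution function of the largest eigenvalue of the Laguerre unitary ensemble of size $k$ with real parameter $\gamma-k$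 (that is, with $\gamma$ degrees of freedom), whose $k$ eigenvalues have joint density on $[0,\infty)^{k}$ proportional to $\prod_{j=1}^{k}t_j^{\gamma-k}e^{-t_j}\prod_{1\le i<j\le k}(t_j-t_i)^2$; for $k=0$, $F_{\gamma,0}=1$. For each $N\ge1$ the right-hand side without the factor $1+o(1)$, defined for $u_2\ne0$, extends to a continuous function of $u_2\in\mathbb C$, and at $u_2=0$ it is understood as the value of this extension. -/

import Mathlib

open Real Filter MeasureTheory
open scoped Topology

/-- The standard complex normal distribution `𝒩_ℂ(0, 1)` (mean `0`, `𝔼|g|² = 1`), with density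
`π⁻¹ exp(-|z|²)` with respect to Lebesgue measure on `ℂ`. -/
noncomputable def stdComplexNormal : Measure ℂ :=
  volume.withDensity fun z => ENNReal.ofReal (π⁻¹ * Real.exp (-‖z‖ ^ 2))

/-- The law of the complex Ginibre matrix `G_N = N^{-1/2} G`, where `G` is an `N × N` matrix with
i.i.d. standard complex normal entries; a matrix is represented by the array of its entries. -/
noncomputable def ginibre (N : ℕ) : Measure (Fin N → Fin N → ℂ) :=
  (Measure.pi fun _ : Fin N => Measure.pi fun _ : Fin N => stdComplexNormal).map
    fun X => (((√(N : ℝ))⁻¹ : ℝ) : ℂ) • X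

/-- The random variable `|det(G - z₁)|^{2 k₁} |det(G - z₂)|^{2 k₂}`, with real `k₁` and
integer `k₂`, of the matrix `G` with the given array of entries. -/
noncomputable def charPolyProduct {N : ℕ} (k₁ : ℝ) (k₂ : ℕ) (z₁ z₂ : ℂ)
    (G : Fin N → Fin N → ℂ) : ℝ :=
  ‖(Matrix.of G - z₁ • (1 : Matrix (Fin N) (Fin N) ℂ)).det‖ ^ (2 * k₁) *
    ‖(Matrix.of G - z₂ • (1 : Matrix (Fin N) (Fin N) ℂ)).det‖ ^ (2 * k₂)

/-- `𝔼(|det(G_N - z₁)|^{2 k₁} |det(G_N - z₂)|^{2 k₂})` for a complex Ginibre matrix `G_N`. -/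
noncomputable def twoChargeCorrelator (N : ℕ) (k₁ : ℝ) (k₂ : ℕ) (z₁ z₂ : ℂ) : ℝ :=
  ∫ G, charPolyProduct k₁ k₂ z₁ z₂ G ∂(ginibre N)

/-- The unnormalised eigenvalue density `∏ t_j^α e^{-t_j} ∏_{i<j} (t_j - t_i)²` of the Laguerre
unitary ensemble of size `k` with real parameter `α`. -/
noncomputable def lueWeight (k : ℕ) (α : ℝ) (t : Fin k → ℝ) : ℝ :=
  (∏ i, t i ^ α * Real.exp (-t i)) * (∏ i, ∏ j ∈ Finset.Ioi i, (t j - t i)) ^ 2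

/-- The unnormalised eigenvalue measure of the Laguerre unitary ensemble on `[0, ∞)^k`. -/
noncomputable def lueMeasure (k : ℕ) (α : ℝ) : Measure (Fin k → ℝ) :=
  (volume.restrict {t | ∀ i, 0 ≤ t i}).withDensity fun t => ENNReal.ofReal (lueWeight k α t)

/-- The joint law of the eigenvalues of the Laguerre unitary ensemble `LUE_{k,p}` of size `k` with
`p` degrees of freedom, that is, with parameter `α = p - k`; here `p` may be any real number with
`p > k - 1`. -/
noncomputable def lueLaw (k : ℕ) (p : ℝ) : Measure (Fin k → ℝ) :=
  (lueMeasure k (p - k) Set.univ)⁻¹ • lueMeasure k (p - k)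

/-- `F_{p,k}(x) = ℙ(λ_max < x)`, the distribution function of the largest eigenvalue
of `LUE_{k,p}`. -/
noncomputable def lueMaxCDF (p : ℝ) (k : ℕ) (x : ℝ) : ℝ :=
  (lueLaw k p).real {t | ∀ i, t i < x}

/-- The Barnes `G`-function on the real line, by its Weierstrass product
`G(1 + z) = (2π)^{z/2} e^{-z(z+1)/2 - γ z²/2} ∏_{k ≥ 1} (1 + z/k)^k e^{-z + z²/(2k)}`,
where `γ` is the Euler–Mascheroni constant. -/
noncomputable def barnesG (x : ℝ) : ℝ :=
  (2 * π) ^ ((x - 1) / 2) *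
    Real.exp (-((x - 1) * x) / 2 - Real.eulerMascheroniConstant * (x - 1) ^ 2 / 2) *
    ∏' k : ℕ, ((1 + (x - 1) / (k + 1 : ℝ)) ^ (k + 1) *
      Real.exp (-(x - 1) + (x - 1) ^ 2 / (2 * (k + 1 : ℝ))))

/-- The leading asymptotic expression for the correlator of two charges at distinct points
`z₁ ≠ z₂`. -/
noncomputable def twoChargeAsymptotic (N : ℕ) (k₁ : ℝ) (k₂ : ℕ) (z₁ z₂ : ℂ) : ℝ :=
  Real.exp (k₁ * N * (‖z₁‖ ^ 2 - 1) + k₂ * N * (‖z₂‖ ^ 2 - 1) +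
      k₁ ^ 2 / 2 * Real.log N + (k₂ : ℝ) ^ 2 / 2 * Real.log N) *
    Real.exp (-2 * k₁ * k₂ * Real.log ‖z₂ - z₁‖) *
    ((2 * π) ^ ((k₁ + k₂) / 2) / (barnesG (1 + k₁) * barnesG (1 + k₂))) *
    lueMaxCDF k₁ k₂ (N * ‖z₂ - z₁‖ ^ 2)

/-!
For generic `λ`, the bordered matrix `bordered a r b D` has the eigenvalue `λ` exactly when its
corner `a` is the ratio of the characteristic polynomials of `bordered 0 r b D` and `D` at `λ`.
Changing variables from `a` to `λ` and rotating the eigenvector to the first basis vector, which the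
Gaussian weight does not see, splits off one eigenvalue; repeating this gives the eigenvalue
density `∏ exp (-|xᵢ|²) ∏ |xᵢ - xⱼ|²` of the Ginibre ensemble. The correlator is therefore the
integral of `∏ |xᵢ - u|^(2 * k)` against a determinantal density with one-particle weight
`|x|^(2 * γ) exp (-|x|²)`. By Andréief's identity it is the Gram determinant of `(x - u)^(k + a)`,
`a < N`, and Jacobi's identity for complementary minors reduces it to `∏ Γ(γ + j + 1)` times a
`k × k` determinant of truncated power series in `|u|²`.

Multiplying by the unitriangular Toeplitz matrix of `(1 + T)^γ` makes the entries of this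
determinant converge, locally uniformly in `u`, to the integrals over `(0, 1)` of
`(1 - s)^(γ - a - 1)` against `s^b exp (|u|² s)`. Andréief's identity, read backwards, together with
`s = 1 - t / |u|²`, identifies the limit with the distribution function of the largest eigenvalue of
the Laguerre ensemble. The determinant is continuous and positive at `u = 0` as well, so it provides
the continuous extension. The Gamma factors give the Barnes function through its Weierstrass product
and Stirling's formula.
-/

open scoped ENNReal

section AreaFormula

lemma exists_measurable_partition_injOn {X Y : Type*} [TopologicalSpace X]
    [SecondCountableTopology X] [MeasurableSpace X] [OpensMeasurableSpace X] {f : X → Y}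
    {S : Set X} (hS : MeasurableSet S) (hf : ∀ x ∈ S, ∃ U ∈ 𝓝 x, Set.InjOn f U) :
    ∃ A : ℕ → Set X, (∀ i, MeasurableSet (A i)) ∧ Pairwise (Function.onFun Disjoint A) ∧
      (⋃ i, A i) = S ∧ ∀ i, Set.InjOn f (A i) := by
  have exists_open : ∀ x, ∃ U, IsOpen U ∧ (x ∈ S → x ∈ U) ∧ Set.InjOn f U := by
    intro x
    by_cases hx : x ∈ S
    · obtain ⟨U, hU, hfU⟩ := hf x hx
      obtain ⟨V, hVU, hV, hxV⟩ := mem_nhds_iff.1 hU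
      exact ⟨V, hV, fun _ => hxV, hfU.mono hVU⟩
    · exact ⟨∅, isOpen_empty, fun h => (hx h).elim, Set.injOn_empty f⟩
  choose U hU_open hU_mem hU_inj using exists_open
  obtain ⟨t, -, ht_countable, ht_cover⟩ := TopologicalSpace.countable_cover_nhdsWithin (f := U)
    fun x hx => mem_nhdsWithin_of_mem_nhds ((hU_open x).mem_nhds (hU_mem x hx))
  obtain ⟨V, hSV, hV_open, hV_inj⟩ :
      ∃ V : ℕ → Set X, S ⊆ ⋃ i, V i ∧ (∀ i, IsOpen (V i)) ∧ ∀ i, Set.InjOn f (V i) := by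
    rcases t.eq_empty_or_nonempty with rfl | ht
    · exact ⟨fun _ => ∅, by simpa using ht_cover, fun _ => isOpen_empty,
        fun _ => Set.injOn_empty f⟩
    · obtain ⟨u, rfl⟩ := ht_countable.exists_eq_range ht
      exact ⟨fun i => U (u i), by simpa using ht_cover, fun i => hU_open _, fun i => hU_inj _⟩
  refine ⟨fun i => disjointed V i ∩ S, fun i => ?_, fun i j hij => ?_, ?_, fun i => ?_⟩
  · exact (MeasurableSet.disjointed (fun i => (hV_open i).measurableSet) i).inter hS
  · exact (disjoint_disjointed V hij).mono Set.inter_subset_left Set.inter_subset_left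
  · rw [← Set.iUnion_inter, iUnion_disjointed, Set.inter_eq_right.2 hSV]
  · exact (hV_inj i).mono (Set.inter_subset_left.trans (disjointed_subset V i))

lemma tsum_indicator_image_eq_encard_mul {X Y : Type*} {f : X → Y} {A : ℕ → Set X}
    (hA : Pairwise (Function.onFun Disjoint A)) (hf : ∀ i, Set.InjOn f (A i)) (g : Y → ℝ≥0∞)
    (y : Y) :
    ∑' i, (f '' A i).indicator g y = (((⋃ i, A i) ∩ f ⁻¹' {y}).encard : ℝ≥0∞) * g y := by
  let _ : MeasurableSpace X := ⊤
  have indicator_eq (i : ℕ) :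
      (f '' A i).indicator g y = Measure.count (A i ∩ f ⁻¹' {y}) * g y := by
    by_cases hy : y ∈ f '' A i
    · obtain ⟨x, hx, rfl⟩ := hy
      have hfib : A i ∩ f ⁻¹' {f x} = {x} :=
        Set.eq_singleton_iff_unique_mem.2 ⟨⟨hx, rfl⟩, fun z hz => hf i hz.1 hx hz.2⟩
      rw [Set.indicator_of_mem (Set.mem_image_of_mem f hx), hfib, Measure.count_singleton, one_mul]
    · have hfib : A i ∩ f ⁻¹' {y} = ∅ :=
        Set.eq_empty_of_forall_notMem fun x hx => hy ⟨x, hx.1, hx.2⟩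
      rw [Set.indicator_of_notMem hy, hfib, measure_empty, zero_mul]
  simp_rw [indicator_eq]
  rw [ENNReal.tsum_mul_right, Set.iUnion_inter, ← Measure.count_apply .of_discrete,
    measure_iUnion (fun i j hij => (hA hij).mono Set.inter_subset_left Set.inter_subset_left)
      fun _ => .of_discrete]

theorem lintegral_abs_det_fderiv_mul_comp {E : Type*} [NormedAddCommGroup E] [NormedSpace ℝ E]
    [FiniteDimensional ℝ E] [MeasurableSpace E] [BorelSpace E] (μ : Measure E) [μ.IsAddHaarMeasure]
    {f : E → E} {f' : E → E →L[ℝ] E} {S : Set E} (hS : MeasurableSet S)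
    (hf : ∀ x ∈ S, HasStrictFDerivAt f (f' x) x) (hf' : ∀ x ∈ S, (f' x).det ≠ 0)
    {g : E → ℝ≥0∞} (hg : Measurable g) :
    ∫⁻ x in S, ENNReal.ofReal |(f' x).det| * g (f x) ∂μ
      = ∫⁻ y, ((S ∩ f ⁻¹' {y}).encard : ℝ≥0∞) * g y ∂μ := by
  have := FiniteDimensional.complete ℝ E
  have locally_injOn : ∀ x ∈ S, ∃ U ∈ 𝓝 x, Set.InjOn f U := by
    intro x hx
    have h : HasStrictFDerivAt f
        ((f' x).toContinuousLinearEquivOfDetNeZero (hf' x hx) : E →L[ℝ] E) x := by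
      simpa using hf x hx
    exact ⟨_, h.toOpenPartialHomeomorph.open_source.mem_nhds
      h.mem_toOpenPartialHomeomorph_source, h.toOpenPartialHomeomorph.injOn⟩
  obtain ⟨A, hA, hA_disj, rfl, hA_inj⟩ := exists_measurable_partition_injOn hS locally_injOn
  have hderiv (i : ℕ) : ∀ x ∈ A i, HasFDerivWithinAt f (f' x) (A i) x := fun x hx =>
    (hf x (Set.mem_iUnion_of_mem i hx)).hasFDerivAt.hasFDerivWithinAt
  have himage (i : ℕ) : MeasurableSet (f '' A i) :=
    measurable_image_of_fderivWithin (hA i) (hderiv i) (hA_inj i)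
  calc ∫⁻ x in ⋃ i, A i, ENNReal.ofReal |(f' x).det| * g (f x) ∂μ
      = ∑' i, ∫⁻ x in A i, ENNReal.ofReal |(f' x).det| * g (f x) ∂μ :=
        lintegral_iUnion hA hA_disj _
    _ = ∑' i, ∫⁻ y, (f '' A i).indicator g y ∂μ := by
        congr! 2 with i
        rw [← lintegral_image_eq_lintegral_abs_det_fderiv_mul μ (hA i) (hderiv i) (hA_inj i),
          lintegral_indicator (himage i)]
    _ = ∫⁻ y, (((⋃ i, A i) ∩ f ⁻¹' {y}).encard : ℝ≥0∞) * g y ∂μ := by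
        rw [← lintegral_tsum fun i => (hg.indicator (himage i)).aemeasurable]
        simp_rw [tsum_indicator_image_eq_encard_mul hA_disj hA_inj g]

lemma det_restrictScalars_toSpanSingleton (c : ℂ) :
    ((ContinuousLinearMap.toSpanSingleton ℂ c).restrictScalars ℝ).det = ‖c‖ ^ 2 := by
  have hdet : LinearMap.det (ContinuousLinearMap.toSpanSingleton ℂ c).toLinearMap = c := by
    rw [LinearMap.det_ring]; simp
  rw [← Complex.normSq_eq_norm_sq, ← Algebra.norm_complex_apply]
  nth_rw 2 [← hdet]
  exact LinearMap.det_restrictScalars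

lemma lintegral_enorm_deriv_sq_mul_comp {f f' : ℂ → ℂ} {S : Set ℂ} (hS : MeasurableSet S)
    (hf : ∀ x ∈ S, HasStrictDerivAt f (f' x) x) (hf' : ∀ x ∈ S, f' x ≠ 0)
    {g : ℂ → ℝ≥0∞} (hg : Measurable g) :
    ∫⁻ x in S, ‖f' x‖ₑ ^ 2 * g (f x) = ∫⁻ y, ((S ∩ f ⁻¹' {y}).encard : ℝ≥0∞) * g y := by
  rw [← lintegral_abs_det_fderiv_mul_comp volume
    (f' := fun x => (ContinuousLinearMap.toSpanSingleton ℂ (f' x)).restrictScalars ℝ) hS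
    (fun x hx => (hf x hx).hasStrictFDerivAt.restrictScalars ℝ)
    (fun x hx => by
      rw [det_restrictScalars_toSpanSingleton]
      exact pow_ne_zero 2 (norm_ne_zero_iff.2 (hf' x hx))) hg]
  simp_rw [det_restrictScalars_toSpanSingleton, abs_pow, abs_norm,
    ENNReal.ofReal_pow (norm_nonneg _), ofReal_norm]

end AreaFormula

section RationalMap

open Polynomial

variable {K : Type*} [Field K] {P Q : K[X]}

lemma eval_ne_zero_of_isCoprime (h : IsCoprime P Q) {a x : K} (hx : (P - C a * Q).eval x = 0) :
    Q.eval x ≠ 0 := by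
  intro hQ
  have hP : P.eval x = 0 := by simpa [hQ] using hx
  obtain ⟨u, v, huv⟩ := h
  simpa [hP, hQ] using congrArg (eval x) huv

lemma eval_div_eval_eq_iff {a x : K} (hQ : Q.eval x ≠ 0) :
    P.eval x / Q.eval x = a ↔ (P - C a * Q).eval x = 0 := by
  rw [div_eq_iff hQ, eval_sub, eval_mul, eval_C, sub_eq_zero]

lemma eval_derivative_mul_eval_eq_eval_wronskian {a x : K} (hx : (P - C a * Q).eval x = 0) :
    (derivative (P - C a * Q)).eval x * Q.eval x = (wronskian Q P).eval x := by
  have hP : P.eval x = a * Q.eval x := by simpa [sub_eq_zero] using hx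
  simp only [wronskian, derivative_sub, derivative_mul, derivative_C, eval_sub, eval_mul, eval_C,
    hP, zero_mul, zero_add]
  ring

lemma wronskian_ne_zero_of_natDegree_eq_succ [CharZero K] (hP : P.natDegree = Q.natDegree + 1)
    (h : IsCoprime P Q) : wronskian Q P ≠ 0 := fun hW =>
  Nat.succ_ne_zero _ (hP ▸ derivative_eq_zero.1
    (h.symm.wronskian_eq_zero_iff.1 hW).2)

lemma exists_finset_forall_separable_sub_C_mul [IsAlgClosed K] [CharZero K]
    (hP : P.natDegree = Q.natDegree + 1) (h : IsCoprime P Q) :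
    ∃ E : Finset K, ∀ a ∉ E, (P - C a * Q).Separable := by
  classical
  refine ⟨(wronskian Q P).roots.toFinset.image fun x => P.eval x / Q.eval x, fun a ha => ?_⟩
  rw [separable_def, isCoprime_iff_aeval_ne_zero_of_isAlgClosed K K]
  intro x
  simp only [coe_aeval_eq_eval]
  by_contra! hx
  refine ha (Finset.mem_image.2
    ⟨x, ?_, (eval_div_eval_eq_iff (eval_ne_zero_of_isCoprime h hx.1)).2 hx.1⟩)
  rw [Multiset.mem_toFinset, mem_roots (wronskian_ne_zero_of_natDegree_eq_succ hP h), IsRoot,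
    ← eval_derivative_mul_eval_eq_eval_wronskian hx.1, hx.2, zero_mul]

lemma natDegree_sub_C_mul_of_natDegree_eq_succ (hP : P.natDegree = Q.natDegree + 1) (a : K) :
    (P - C a * Q).natDegree = P.natDegree :=
  natDegree_sub_eq_left_of_natDegree_lt ((natDegree_C_mul_le a Q).trans_lt (by lia))

lemma encard_fiber_eval_div_eval [IsAlgClosed K] (hP : P.natDegree = Q.natDegree + 1)
    (h : IsCoprime P Q) {a : K} (ha : (P - C a * Q).Separable) :
    ({x | Q.eval x ≠ 0 ∧ (wronskian Q P).eval x ≠ 0} ∩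
      (fun x => P.eval x / Q.eval x) ⁻¹' {a}).encard = P.natDegree := by
  classical
  have fiber_eq : {x | Q.eval x ≠ 0 ∧ (wronskian Q P).eval x ≠ 0} ∩
      (fun x => P.eval x / Q.eval x) ⁻¹' {a} = (P - C a * Q).roots.toFinset := by
    ext x
    simp only [Set.mem_inter_iff, Set.mem_ofPred_eq, Set.mem_preimage, Set.mem_singleton_iff,
      Finset.mem_coe, Multiset.mem_toFinset, mem_roots ha.ne_zero, IsRoot]
    refine ⟨fun hx => (eval_div_eval_eq_iff hx.1.1).1 hx.2, fun hx => ?_⟩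
    have hQ := eval_ne_zero_of_isCoprime h hx
    refine ⟨⟨hQ, ?_⟩, (eval_div_eval_eq_iff hQ).2 hx⟩
    rw [← eval_derivative_mul_eval_eq_eval_wronskian hx]
    exact mul_ne_zero (ha.eval₂_derivative_ne_zero (RingHom.id K) hx) hQ
  rw [fiber_eq, Set.encard_coe_eq_coe_finsetCard, Multiset.toFinset_card_of_nodup (nodup_roots ha),
    ← (IsAlgClosed.splits _).natDegree_eq_card_roots,
    natDegree_sub_C_mul_of_natDegree_eq_succ hP]

theorem lintegral_comp_eval_div_eval {P Q : ℂ[X]} (hP : P.natDegree = Q.natDegree + 1)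
    (h : IsCoprime P Q) {g : ℂ → ℝ≥0∞} (hg : Measurable g) :
    ∫⁻ x, ‖(wronskian Q P).eval x / Q.eval x ^ 2‖ₑ ^ 2 * g (P.eval x / Q.eval x)
      = P.natDegree * ∫⁻ a, g a := by
  set S : Set ℂ := {x | Q.eval x ≠ 0 ∧ (wronskian Q P).eval x ≠ 0}
  have hS_meas : MeasurableSet S := ((isOpen_compl_singleton.preimage Q.continuous).inter
    (isOpen_compl_singleton.preimage (wronskian Q P).continuous)).measurableSet
  have hderiv : ∀ x ∈ S, HasStrictDerivAt (fun x => P.eval x / Q.eval x)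
      ((wronskian Q P).eval x / Q.eval x ^ 2) x := by
    intro x hx
    convert! (P.hasStrictDerivAt x).fun_div (Q.hasStrictDerivAt x) hx.1 using 2
    simp only [wronskian, eval_sub, eval_mul]
    ring
  have hsupport : (Function.support fun x => ‖(wronskian Q P).eval x / Q.eval x ^ 2‖ₑ ^ 2 *
      g (P.eval x / Q.eval x)) ⊆ S := by
    refine fun x hx => not_not.1 fun hxS => hx ?_
    have hzero : (wronskian Q P).eval x / Q.eval x ^ 2 = 0 := by
      by_cases hQ : Q.eval x = 0
      · simp [hQ]
      · simp [not_not.1 (not_and.1 hxS hQ)]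
    simp [hzero]
  obtain ⟨E, hE⟩ := exists_finset_forall_separable_sub_C_mul hP h
  rw [← setLIntegral_eq_of_support_subset hsupport, lintegral_enorm_deriv_sq_mul_comp hS_meas hderiv
    (fun x hx => div_ne_zero hx.2 (pow_ne_zero 2 hx.1)) hg, ← lintegral_const_mul _ hg]
  refine lintegral_congr_ae ?_
  filter_upwards [E.countable_toSet.ae_notMem volume] with a ha
  rw [encard_fiber_eval_div_eval hP h (hE a ha), ENat.toENNReal_coe]

end RationalMap

section BorderedMatrix

open Matrix Polynomial

/-- The array with corner `a`, first row `r`, first column `b` and remaining block `D`. Arrays, and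
not matrices, carry the product measures below. -/
def borderedArray {R : Type*} {n : ℕ} (a : R) (r b : Fin n → R) (D : Fin n → Fin n → R) :
    Fin (n + 1) → Fin (n + 1) → R :=
  Fin.cons (Fin.cons a r) fun i => Fin.cons (b i) (D i)

/-- The matrix with corner `a`, first row `r`, first column `b` and remaining block `D`. -/
def bordered {R : Type*} {n : ℕ} (a : R) (r b : Fin n → R) (D : Matrix (Fin n) (Fin n) R) :
    Matrix (Fin (n + 1)) (Fin (n + 1)) R :=
  of (borderedArray a r b (of.symm D))

lemma of_borderedArray {R : Type*} {n : ℕ} (a : R) (r b : Fin n → R) (D : Fin n → Fin n → R) :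
    of (borderedArray a r b D) = bordered a r b (of D) := rfl

variable {R : Type*} [CommRing R] {n : ℕ}

lemma det_bordered_eq_det_fromBlocks (a : R) (r b : Fin n → R) (D : Matrix (Fin n) (Fin n) R) :
    (bordered a r b D).det =
      (fromBlocks D (replicateCol Unit b) (replicateRow Unit r) (of fun _ _ => a)).det := by
  rw [← det_reindex_self ((finSuccEquiv n).trans (Equiv.optionEquivSumPUnit.{0} (Fin n)))]
  congr 1
  ext (i | i) (j | j) <;> simp [bordered, borderedArray]

lemma det_bordered_of_isRegular (a : R) (r b : Fin n → R) {D : Matrix (Fin n) (Fin n) R}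
    (hD : IsRegular D.det) : (bordered a r b D).det = a * D.det - r ⬝ᵥ D.adjugate *ᵥ b := by
  refine hD.right ?_
  have hblocks : fromBlocks D (replicateCol Unit b) (replicateRow Unit r) (of fun _ _ => a) *
        fromBlocks 1 (-(D.adjugate * replicateCol Unit b)) 0 (of fun (_ : Unit) _ => D.det) =
      fromBlocks D 0 (replicateRow Unit r) (of fun _ _ => a * D.det - r ⬝ᵥ D.adjugate *ᵥ b) := by
    rw [fromBlocks_multiply, Matrix.mul_neg, Matrix.mul_neg, ← Matrix.mul_assoc D, mul_adjugate]
    congr 1 <;> ext i j <;>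
      simp [Matrix.mul_apply, dotProduct, mulVec, mul_comm, sub_eq_neg_add]
  calc (bordered a r b D).det * D.det
      = (fromBlocks D (replicateCol Unit b) (replicateRow Unit r) (of fun _ _ => a) *
          fromBlocks 1 (-(D.adjugate * replicateCol Unit b)) 0
            (of fun (_ : Unit) _ => D.det)).det := by
        rw [det_mul, det_fromBlocks_zero₂₁, det_bordered_eq_det_fromBlocks]
        simp
    _ = (a * D.det - r ⬝ᵥ D.adjugate *ᵥ b) * D.det := by
        rw [hblocks, det_fromBlocks_zero₁₂]
        simp [mul_comm]

lemma charmatrix_bordered (a : R) (r b : Fin n → R) (D : Matrix (Fin n) (Fin n) R) :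
    charmatrix (bordered a r b D) =
      bordered (X - C a) (-fun i => C (r i)) (-fun i => C (b i)) (charmatrix D) := by
  refine Matrix.ext fun i j => ?_
  cases i using Fin.cases <;> cases j using Fin.cases <;>
    simp [bordered, borderedArray, charmatrix_apply, diagonal_apply, Fin.succ_ne_zero,
      (Fin.succ_ne_zero _).symm]

lemma charpoly_bordered (a : R) (r b : Fin n → R) (D : Matrix (Fin n) (Fin n) R) :
    (bordered a r b D).charpoly = (X - C a) * D.charpoly -
      (fun i => C (r i)) ⬝ᵥ (charmatrix D).adjugate *ᵥ (fun i => C (b i)) := by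
  rw [Matrix.charpoly, charmatrix_bordered,
    det_bordered_of_isRegular _ _ _ D.charpoly_monic.isRegular, mulVec_neg, neg_dotProduct_neg,
    ← Matrix.charpoly]

lemma charpoly_bordered_eq_sub (a : R) (r b : Fin n → R) (D : Matrix (Fin n) (Fin n) R) :
    (bordered a r b D).charpoly = (bordered 0 r b D).charpoly - C a * D.charpoly := by
  rw [charpoly_bordered, charpoly_bordered, C_0, sub_zero, sub_mul]
  ring

lemma map_eval_charmatrix {m : Type*} [Fintype m] [DecidableEq m] (D : Matrix m m R) (l : R) :
    (charmatrix D).map (eval l) = scalar m l - D := by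
  ext i j
  by_cases h : i = j <;> simp [h]

lemma map_eval_adjugate_charmatrix {m : Type*} [Fintype m] [DecidableEq m] (D : Matrix m m R)
    (l : R) : (charmatrix D).adjugate.map (eval l) = (scalar m l - D).adjugate := by
  rw [← map_eval_charmatrix]
  exact (evalRingHom l).map_adjugate (charmatrix D)

lemma eval_charpoly_bordered (a : R) (r b : Fin n → R) (D : Matrix (Fin n) (Fin n) R) (l : R) :
    (bordered a r b D).charpoly.eval l = (l - a) * D.charpoly.eval l -
      r ⬝ᵥ (scalar (Fin n) l - D).adjugate *ᵥ b := by
  rw [charpoly_bordered, ← map_eval_adjugate_charmatrix]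
  simp [dotProduct, mulVec, eval_finsetSum]

lemma map_eval_mul_map_eval_derivative_adjugate {m : Type*} [Fintype m] [DecidableEq m]
    {M : Matrix m m R[X]} {l : R} (h : M.adjugate.map (eval l) = 0) :
    M.map (eval l) * M.adjugate.map (fun p => (derivative p).eval l) =
      (derivative M.det).eval l • (1 : Matrix m m R) := by
  ext i j
  have hadj (k : m) : (M.adjugate k j).eval l = 0 := congrFun₂ h k j
  have hprod : ∑ k, M i k * M.adjugate k j = M.det * (1 : Matrix m m R[X]) i j := by
    rw [← Matrix.mul_apply, mul_adjugate, Matrix.smul_apply, smul_eq_mul]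
  have hderiv := congrArg (fun p => (derivative p).eval l) hprod
  simp only [derivative_sum, derivative_mul, eval_finsetSum, eval_add, eval_mul, hadj, mul_zero,
    zero_add] at hderiv
  rw [Matrix.mul_apply, Matrix.smul_apply, smul_eq_mul]
  refine hderiv.trans ?_
  rcases eq_or_ne i j with rfl | hij
  · simp
  · simp [Matrix.one_apply_ne hij]

lemma adjugate_ne_zero_of_separable_charpoly {K m : Type*} [Field K] [Fintype m] [DecidableEq m]
    {D : Matrix m m K} (hD : D.charpoly.Separable) {l : K} (hl : D.charpoly.eval l = 0) :
    (scalar m l - D).adjugate ≠ 0 := by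
  intro h
  have : Nonempty m := by
    by_contra! hm
    simp [charpoly_isEmpty] at hl
  have hdet := congrArg det (map_eval_mul_map_eval_derivative_adjugate
    ((map_eval_adjugate_charmatrix D l).trans h))
  rw [map_eval_charmatrix, det_mul, ← eval_charpoly, hl, zero_mul, det_smul, det_one, mul_one]
    at hdet
  exact hD.eval₂_derivative_ne_zero (RingHom.id K) hl
    (eq_zero_of_pow_eq_zero hdet.symm)

end BorderedMatrix

section GenericMatrix

open Matrix Polynomial

lemma measurePreserving_finCons {E : Type*} [MeasurableSpace E] (μ : Measure E) [SigmaFinite μ]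
    (n : ℕ) :
    MeasurePreserving (fun p : E × (Fin n → E) => (Fin.cons p.1 p.2 : Fin (n + 1) → E))
      (μ.prod (Measure.pi fun _ => μ)) (Measure.pi fun _ => μ) := by
  have h := (measurePreserving_piFinSuccAbove (fun _ : Fin (n + 1) => μ) 0).symm
  simpa only [MeasurableEquiv.piFinSuccAbove_symm_apply, Fin.insertNthEquiv_zero] using! h

lemma measurePreserving_borderedArray {E : Type*} [MeasureSpace E]
    [SigmaFinite (volume : Measure E)] (n : ℕ) :
    MeasurePreserving (β := Fin (n + 1) → Fin (n + 1) → E)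
      (fun p : ((Fin n → Fin n → E) × (Fin n → E)) × ((Fin n → E) × E) =>
        borderedArray p.2.2 p.2.1 p.1.2 p.1.1) volume volume := by
  have hrow : MeasurePreserving (β := Fin (n + 1) → E)
      (fun p : (Fin n → E) × E => Fin.cons p.2 p.1) volume volume :=
    (measurePreserving_finCons volume n).comp Measure.measurePreserving_swap
  have hrows : MeasurePreserving (β := Fin n → Fin (n + 1) → E)
      (fun p : (Fin n → Fin n → E) × (Fin n → E) => fun i => Fin.cons (p.2 i) (p.1 i))
      volume volume :=
    ((measurePreserving_pi _ _ fun _ => measurePreserving_finCons volume n).comp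
      (volume_measurePreserving_arrowProdEquivProdArrow E (Fin n → E) (Fin n)).symm).comp
      Measure.measurePreserving_swap
  exact ((measurePreserving_finCons volume n).comp (hrow.prod hrows)).comp
    Measure.measurePreserving_swap

variable {E : Type*} [MeasureSpace E] [SigmaFinite (volume : Measure E)] {n : ℕ}

lemma lintegral_matrix_succ {f : (Fin (n + 1) → Fin (n + 1) → E) → ℝ≥0∞} (hf : Measurable f) :
    ∫⁻ M, f M = ∫⁻ D : Fin n → Fin n → E, ∫⁻ b : Fin n → E, ∫⁻ r : Fin n → E, ∫⁻ a : E,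
      f (borderedArray a r b D) := by
  have hmp := measurePreserving_borderedArray (E := E) n
  have hf' := hf.comp hmp.measurable
  simp only [Measure.volume_eq_prod] at hmp
  rw [← hmp.lintegral_comp hf]
  refine (lintegral_prod _ hf'.aemeasurable).trans ?_
  rw [lintegral_prod _ hf'.lintegral_prod_right'.aemeasurable]
  exact lintegral_congr fun D => lintegral_congr fun b =>
    lintegral_prod _ (hf'.comp measurable_prodMk_left).aemeasurable

lemma ae_matrix_of_ae_borderedArray {p : (Fin (n + 1) → Fin (n + 1) → E) → Prop}
    (hp : MeasurableSet {M | p M})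
    (h : ∀ᵐ D : Fin n → Fin n → E, ∀ᵐ b : Fin n → E, ∀ᵐ r : Fin n → E, ∀ᵐ a : E,
      p (borderedArray a r b D)) : ∀ᵐ M, p M := by
  change volume {M | p M}ᶜ = 0
  rw [← lintegral_indicator_one hp.compl, lintegral_matrix_succ (measurable_one.indicator hp.compl)]
  refine lintegral_eq_zero_of_ae_eq_zero ?_
  filter_upwards [h] with D hD
  refine lintegral_eq_zero_of_ae_eq_zero ?_
  filter_upwards [hD] with b hb
  refine lintegral_eq_zero_of_ae_eq_zero ?_
  filter_upwards [hb] with r hr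
  refine lintegral_eq_zero_of_ae_eq_zero ?_
  filter_upwards [hr] with a ha
  exact Set.indicator_of_notMem (not_not_intro ha) _

section Continuity

variable {R : Type*} [CommRing R] [TopologicalSpace R] [IsTopologicalRing R]

lemma continuous_coeff_charpoly {m : Type*} [Fintype m] [DecidableEq m] (i : ℕ) :
    Continuous fun M : Matrix m m R => M.charpoly.coeff i := by
  have hcoeff (M : Matrix m m R) : M.charpoly.coeff i =
      MvPolynomial.eval (fun p : m × m => M p.1 p.2) ((charpoly.univ R m).coeff i) :=
    (charpoly.univ_coeff_eval₂Hom m (RingHom.id R) (fun p : m × m => M p.1 p.2) i).symm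
  simp_rw [hcoeff]
  exact (MvPolynomial.continuous_eval _).comp (by fun_prop)

lemma continuous_eval_charpoly {m : Type*} [Fintype m] [DecidableEq m] :
    Continuous fun p : Matrix m m R × R => p.1.charpoly.eval p.2 := by
  simp_rw [eval_charpoly, scalar_apply]
  exact ((Continuous.matrix_diagonal (by fun_prop)).sub continuous_fst).matrix_det

lemma continuous_eval_derivative_charpoly {m : Type*} [Fintype m] [DecidableEq m] :
    Continuous fun p : Matrix m m R × R => (derivative p.1.charpoly).eval p.2 := by
  nontriviality R
  have heval (p : Matrix m m R × R) : (derivative p.1.charpoly).eval p.2 =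
      ∑ i ∈ Finset.range (Fintype.card m + 1), p.1.charpoly.coeff (i + 1) * (i + 1) * p.2 ^ i := by
    rw [eval_eq_sum_range' (n := Fintype.card m + 1)]
    · simp [coeff_derivative]
    · exact (natDegree_derivative_le _).trans_lt (by rw [charpoly_natDegree_eq_dim]; lia)
  simp_rw [heval]
  exact continuous_finsetSum _ fun i _ =>
    (((continuous_coeff_charpoly (i + 1)).comp continuous_fst).mul continuous_const).mul
      (continuous_snd.pow i)

lemma isOpen_setOf_separable_charpoly {K m : Type*} [Field K] [CharZero K] [TopologicalSpace K]
    [IsTopologicalRing K] [T1Space K] [Fintype m] [DecidableEq m] :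
    IsOpen {M : Matrix m m K | M.charpoly.Separable} := by
  have separable_iff (M : Matrix m m K) : M.charpoly.Separable ↔
      resultant M.charpoly (derivative M.charpoly) (Fintype.card m) (Fintype.card m - 1) ≠ 0 := by
    rw [← isUnit_iff_ne_zero, ← charpoly_natDegree_eq_dim M, ← natDegree_derivative,
      isUnit_resultant_iff_isCoprime M.charpoly_monic, separable_def]
  simp_rw [separable_iff]
  refine isOpen_ne.preimage (Continuous.matrix_det (continuous_matrix fun i j => ?_))
  simp only [sylvester, of_apply, coeff_derivative]
  induction j using Fin.addCases <;> simp only [Fin.addCases_left, Fin.addCases_right] <;>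
    split_ifs <;> first | exact continuous_const | skip
  · exact (continuous_coeff_charpoly _).mul continuous_const
  · exact continuous_coeff_charpoly _

end Continuity

section AlmostEverywhere

variable {m : Type*} [Fintype m]

lemma ae_dotProduct_ne_zero {v : m → ℂ} (hv : v ≠ 0) : ∀ᵐ r : m → ℂ, r ⬝ᵥ v ≠ 0 := by
  classical
  have hker : LinearMap.ker (((dotProductBilin ℂ ℂ).flip v).restrictScalars ℝ) ≠ ⊤ := by
    refine fun htop => hv (funext fun i => ?_)
    have hi : Pi.single i 1 ∈ LinearMap.ker (((dotProductBilin ℂ ℂ).flip v).restrictScalars ℝ) :=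
      htop ▸ Submodule.mem_top
    simpa using hi
  rw [ae_iff]
  simp only [ne_eq, not_not]
  exact Measure.addHaar_submodule volume _ hker

lemma ae_mulVec_ne_zero {l : Type*} {A : Matrix l m ℂ} (hA : A ≠ 0) : ∀ᵐ b : m → ℂ, A *ᵥ b ≠ 0 := by
  obtain ⟨i, hi⟩ : ∃ i, A i ≠ 0 := by
    by_contra! h
    exact hA (funext h)
  filter_upwards [ae_dotProduct_ne_zero hi] with b hb h
  exact hb (dotProduct_comm b (A i) ▸ congrFun h i)

lemma ae_isCoprime_charpoly_bordered {D : Matrix (Fin n) (Fin n) ℂ} (hD : D.charpoly.Separable) :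
    ∀ᵐ b : Fin n → ℂ, ∀ᵐ r : Fin n → ℂ, IsCoprime (bordered 0 r b D).charpoly D.charpoly := by
  have hroots : D.charpoly.rootSet ℂ = {l | D.charpoly.eval l = 0} := by
    ext l
    simp [mem_rootSet, D.charpoly_monic.ne_zero]
  have hroots_countable : {l | D.charpoly.eval l = 0}.Countable :=
    hroots ▸ (rootSet_finite D.charpoly ℂ).countable
  have hb : ∀ᵐ b : Fin n → ℂ, ∀ l ∈ {l | D.charpoly.eval l = 0},
      (scalar (Fin n) l - D).adjugate *ᵥ b ≠ 0 :=
    (ae_ball_iff hroots_countable).2 fun l hl =>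
      ae_mulVec_ne_zero (adjugate_ne_zero_of_separable_charpoly hD hl)
  filter_upwards [hb] with b hb
  have hr : ∀ᵐ r : Fin n → ℂ, ∀ l ∈ {l | D.charpoly.eval l = 0},
      r ⬝ᵥ (scalar (Fin n) l - D).adjugate *ᵥ b ≠ 0 :=
    (ae_ball_iff hroots_countable).2 fun l hl => ae_dotProduct_ne_zero (hb l hl)
  filter_upwards [hr] with r hr
  rw [isCoprime_iff_aeval_ne_zero_of_isAlgClosed ℂ ℂ]
  intro l
  simp only [coe_aeval_eq_eval]
  by_contra! h
  refine hr l h.2 ?_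
  simpa [eval_charpoly_bordered, h.2] using h.1

lemma ae_separable_charpoly : ∀ n : ℕ, ∀ᵐ M : Fin n → Fin n → ℂ, (of M).charpoly.Separable
  | 0 => Eventually.of_forall fun M => by
    rw [charpoly_isEmpty]
    exact separable_one
  | n + 1 => by
    have hopen : IsOpen {M : Fin (n + 1) → Fin (n + 1) → ℂ | (of M).charpoly.Separable} :=
      isOpen_setOf_separable_charpoly (K := ℂ) (m := Fin (n + 1))
    refine ae_matrix_of_ae_borderedArray hopen.measurableSet ?_
    filter_upwards [ae_separable_charpoly n] with D hD
    filter_upwards [ae_isCoprime_charpoly_bordered hD] with b hb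
    filter_upwards [hb] with r hr
    obtain ⟨E, hE⟩ := exists_finset_forall_separable_sub_C_mul
      (P := (bordered 0 r b (of D)).charpoly) (Q := (of D).charpoly) (by simp) hr
    filter_upwards [E.countable_toSet.ae_notMem volume] with a ha
    rw [of_borderedArray, charpoly_bordered_eq_sub]
    exact hE a ha

end AlmostEverywhere

end GenericMatrix

section Deflation

open Matrix Polynomial

variable {n : ℕ}

section Algebra

variable {R : Type*} [CommRing R]

lemma bordered_mul (a a' : R) (r b r' b' : Fin n → R) (D D' : Matrix (Fin n) (Fin n) R) :
    bordered a r b D * bordered a' r' b' D' =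
      bordered (a * a' + r ⬝ᵥ b') (a • r' + r ᵥ* D') (a' • b + D *ᵥ b')
        (vecMulVec b r' + D * D') := by
  refine Matrix.ext fun i j => ?_
  cases i using Fin.cases <;> cases j using Fin.cases <;>
    simp [bordered, borderedArray, Matrix.mul_apply, dotProduct, mulVec, vecMul, vecMulVec_apply,
      Fin.sum_univ_succ, mul_comm]

lemma bordered_one : bordered (1 : R) 0 0 (1 : Matrix (Fin n) (Fin n) R) = 1 := by
  refine Matrix.ext fun i j => ?_
  cases i using Fin.cases <;> cases j using Fin.cases <;>
    simp [bordered, borderedArray, Matrix.one_apply, Fin.succ_ne_zero, (Fin.succ_ne_zero _).symm]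

lemma det_bordered_zero (a : R) (r : Fin n → R) (D : Matrix (Fin n) (Fin n) R) :
    (bordered a r 0 D).det = a * D.det := by
  rw [det_bordered_eq_det_fromBlocks, show replicateCol Unit (0 : Fin n → R) = 0 from rfl,
    det_fromBlocks_zero₁₂]
  simp [mul_comm]

lemma charpoly_bordered_zero (l : R) (r : Fin n → R) (D : Matrix (Fin n) (Fin n) R) :
    (bordered l r 0 D).charpoly = (X - C l) * D.charpoly := by
  have hzero : (fun i => C ((0 : Fin n → R) i)) = (0 : Fin n → R[X]) := by
    ext
    simp
  rw [charpoly_bordered, hzero, mulVec_zero, dotProduct_zero, sub_zero]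

/-- The unipotent matrix whose first column is `(1, v)`; conjugation by it deflates an eigenvector
normalised to have first entry `1`. -/
def unipotentUnit (v : Fin n → R) : (Matrix (Fin (n + 1)) (Fin (n + 1)) R)ˣ where
  val := bordered 1 0 v 1
  inv := bordered 1 0 (-v) 1
  val_inv := by rw [bordered_mul, ← bordered_one]; simp
  inv_val := by rw [bordered_mul, ← bordered_one]; simp

lemma unipotentUnit_conj_bordered (l : R) (r v : Fin n → R) (D : Matrix (Fin n) (Fin n) R) :
    (unipotentUnit v).val * bordered l r 0 (D - vecMulVec v r) * (unipotentUnit v)⁻¹.val =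
      bordered (l - r ⬝ᵥ v) r ((scalar (Fin n) l - D) *ᵥ v) D := by
  change bordered 1 0 v 1 * bordered l r 0 (D - vecMulVec v r) * bordered 1 0 (-v) 1 = _
  rw [bordered_mul, bordered_mul]
  congr 1
  · simp [sub_eq_add_neg]
  · simp
  · ext i
    simp [sub_mulVec, mulVec_neg, scalar_apply]
    ring
  · simp

end Algebra

section Field

variable {K : Type*} [Field K]

lemma eval_charpoly_bordered_div_eval (l : K) (r v : Fin n → K) {D : Matrix (Fin n) (Fin n) K}
    (hl : D.charpoly.eval l ≠ 0) :
    (bordered 0 r ((scalar (Fin n) l - D) *ᵥ v) D).charpoly.eval l / D.charpoly.eval l =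
      l - r ⬝ᵥ v := by
  rw [eval_charpoly_bordered, mulVec_mulVec, adjugate_mul, ← eval_charpoly, smul_mulVec,
    one_mulVec, dotProduct_smul, div_eq_iff hl, smul_eq_mul]
  ring

lemma eval_wronskian_charpoly_bordered (l : K) (r v : Fin n → K) {D : Matrix (Fin n) (Fin n) K}
    (hl : D.charpoly.eval l ≠ 0) :
    (wronskian D.charpoly (bordered 0 r ((scalar (Fin n) l - D) *ᵥ v) D).charpoly).eval l =
      D.charpoly.eval l * (D - vecMulVec v r).charpoly.eval l := by
  set b := (scalar (Fin n) l - D) *ᵥ v with hb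
  have hfactor : (bordered 0 r b D).charpoly - C (l - r ⬝ᵥ v) * D.charpoly =
      (X - C l) * (D - vecMulVec v r).charpoly := by
    rw [← charpoly_bordered_eq_sub, hb, ← unipotentUnit_conj_bordered, coe_units_inv,
      charpoly_units_conj, charpoly_bordered_zero]
  have hderiv := congrArg (fun p => (derivative p).eval l) hfactor
  simp only [derivative_sub, derivative_mul, eval_sub, eval_mul, eval_add, eval_C, derivative_C,
    derivative_X, eval_X, sub_self, zero_mul, add_zero, zero_add, one_mul, sub_zero] at hderiv
  have hvalue := (div_eq_iff hl).1 (eval_charpoly_bordered_div_eval l r v hl)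
  rw [wronskian, eval_sub, eval_mul, eval_mul, ← hderiv, hb, hvalue]
  ring

end Field

section ChangeOfVariables

lemma lintegral_comp_mulVec {m : Type*} [Fintype m] [DecidableEq m] {A : Matrix m m ℂ}
    (hA : A.det ≠ 0) {g : (m → ℂ) → ℝ≥0∞} (hg : Measurable g) :
    ∫⁻ b, g b = ‖A.det‖ₑ ^ 2 * ∫⁻ v, g (A *ᵥ v) := by
  let f : (m → ℂ) →ₗ[ℝ] (m → ℂ) := (Matrix.toLin' A).restrictScalars ℝ
  have hdet : LinearMap.det f = ‖A.det‖ ^ 2 := by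
    rw [LinearMap.det_restrictScalars, LinearMap.det_toLin', Algebra.norm_complex_apply,
      Complex.normSq_eq_norm_sq]
  have hdet_ne : LinearMap.det f ≠ 0 := hdet ▸ by positivity
  calc ∫⁻ b, g b
      = ENNReal.ofReal (‖A.det‖ ^ 2) * ∫⁻ b, g b ∂(volume.map f) := by
        rw [Measure.map_linearMap_addHaar_eq_smul_addHaar _ hdet_ne, lintegral_smul_measure,
          hdet, smul_eq_mul, ← mul_assoc, ← ENNReal.ofReal_mul (by positivity),
          abs_of_nonneg (by positivity), mul_inv_cancel₀ (by positivity), ENNReal.ofReal_one,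
          one_mul]
    _ = ‖A.det‖ₑ ^ 2 * ∫⁻ v, g (A *ᵥ v) := by
        rw [lintegral_map hg f.continuous_of_finiteDimensional.measurable,
          ENNReal.ofReal_pow (norm_nonneg _), ofReal_norm]
        rfl

variable {α β γ δ : Type*} [MeasurableSpace α] [MeasurableSpace β] [MeasurableSpace γ]
  [MeasurableSpace δ] {μ : Measure α} {ν : Measure β} {ξ : Measure γ} {ζ : Measure δ} [SFinite μ]
  [SFinite ν] [SFinite ξ] [SFinite ζ]

lemma lintegral_rotate_three {f : α → β → γ → ℝ≥0∞}
    (hf : Measurable fun p : α × β × γ => f p.1 p.2.1 p.2.2) :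
    ∫⁻ a, ∫⁻ b, ∫⁻ c, f a b c ∂ξ ∂ν ∂μ = ∫⁻ b, ∫⁻ c, ∫⁻ a, f a b c ∂μ ∂ξ ∂ν := by
  have hinner : Measurable fun p : α × β => ∫⁻ c, f p.1 p.2 c ∂ξ :=
    Measurable.lintegral_prod_right' (hf.comp (f := fun q : (α × β) × γ => (q.1.1, q.1.2, q.2))
      (by fun_prop))
  rw [lintegral_lintegral_swap hinner.aemeasurable]
  exact lintegral_congr fun b => lintegral_lintegral_swap
    (hf.comp (f := fun p : α × γ => (p.1, b, p.2)) (by fun_prop)).aemeasurable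

lemma lintegral_rotate_four {f : α → β → γ → δ → ℝ≥0∞}
    (hf : Measurable fun p : α × β × γ × δ => f p.1 p.2.1 p.2.2.1 p.2.2.2) :
    ∫⁻ a, ∫⁻ b, ∫⁻ c, ∫⁻ d, f a b c d ∂ζ ∂ξ ∂ν ∂μ =
      ∫⁻ b, ∫⁻ c, ∫⁻ d, ∫⁻ a, f a b c d ∂μ ∂ζ ∂ξ ∂ν := by
  have hlast : Measurable fun p : (α × β) × γ => ∫⁻ d, f p.1.1 p.1.2 p.2 d ∂ζ :=
    Measurable.lintegral_prod_right' (hf.comp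
      (f := fun q : ((α × β) × γ) × δ => (q.1.1.1, q.1.1.2, q.1.2, q.2)) (by fun_prop))
  have hinner : Measurable fun p : α × β => ∫⁻ c, ∫⁻ d, f p.1 p.2 c d ∂ζ ∂ξ :=
    Measurable.lintegral_prod_right' hlast
  rw [lintegral_lintegral_swap hinner.aemeasurable]
  exact lintegral_congr fun b => lintegral_rotate_three
    (hf.comp (f := fun p : α × γ × δ => (p.1, b, p.2.1, p.2.2)) (by fun_prop))

end ChangeOfVariables

section Measurability

variable {α : Type*} [MeasurableSpace α]

lemma measurable_borderedArray {E : Type*} [MeasurableSpace E] {a : α → E} {r b : α → Fin n → E}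
    {D : α → Fin n → Fin n → E} (ha : Measurable a) (hr : Measurable r) (hb : Measurable b)
    (hD : Measurable D) : Measurable fun x => borderedArray (a x) (r x) (b x) (D x) := by
  refine measurable_pi_iff.2 fun i => measurable_pi_iff.2 fun j => ?_
  cases i using Fin.cases <;> cases j using Fin.cases <;> simp only [borderedArray, Fin.cons_zero,
    Fin.cons_succ] <;> fun_prop

lemma measurable_eval_charpoly {M : α → Fin n → Fin n → ℂ} {l : α → ℂ} (hM : Measurable M)
    (hl : Measurable l) : Measurable fun x => (of (M x)).charpoly.eval (l x) := by
  have heval : Continuous fun p : (Fin n → Fin n → ℂ) × ℂ => (of p.1).charpoly.eval p.2 :=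
    continuous_eval_charpoly
  exact heval.measurable.comp (hM.prodMk hl)

lemma measurable_eval_derivative_charpoly {M : α → Fin n → Fin n → ℂ} {l : α → ℂ}
    (hM : Measurable M) (hl : Measurable l) :
    Measurable fun x => (derivative (of (M x)).charpoly).eval (l x) := by
  have heval : Continuous fun p : (Fin n → Fin n → ℂ) × ℂ =>
      (derivative (of p.1).charpoly).eval p.2 := continuous_eval_derivative_charpoly
  exact heval.measurable.comp (hM.prodMk hl)

lemma measurable_unipotentUnit_conj_bordered {F : Matrix (Fin (n + 1)) (Fin (n + 1)) ℂ → ℝ≥0∞}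
    (hF : Measurable fun M : Fin (n + 1) → Fin (n + 1) → ℂ => F (of M)) {l : α → ℂ}
    {v r : α → Fin n → ℂ} {M : α → Fin n → Fin n → ℂ} (hl : Measurable l) (hv : Measurable v)
    (hr : Measurable r) (hM : Measurable M) :
    Measurable fun x => F ((unipotentUnit (v x)).val * bordered (l x) (r x) 0 (of (M x)) *
      (unipotentUnit (v x))⁻¹.val) := by
  have hconj (x : α) : (unipotentUnit (v x)).val * bordered (l x) (r x) 0 (of (M x)) *
      (unipotentUnit (v x))⁻¹.val = of (borderedArray (l x - ∑ i, r x i * v x i) (r x)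
        (fun i => l x * v x i - ∑ j, (M x i j + v x i * r x j) * v x j)
        (fun i j => M x i j + v x i * r x j)) := by
    have h := unipotentUnit_conj_bordered (l x) (r x) (v x) (of (M x) + vecMulVec (v x) (r x))
    rw [add_sub_cancel_right] at h
    rw [h, of_borderedArray]
    congr 1
    ext i
    rw [sub_mulVec, scalar_apply, Pi.sub_apply, mulVec_diagonal]
    rfl
  simp_rw [hconj]
  exact hF.comp (measurable_borderedArray (by fun_prop) hr (by fun_prop) (by fun_prop))

end Measurability

section Corner

variable {F : Matrix (Fin (n + 1)) (Fin (n + 1)) ℂ → ℝ≥0∞}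

/-- The integrand which replaces `F (bordered a r b D)` when the corner `a` of a bordered matrix is
expressed through an eigenvalue `l` of that matrix, as the value at `l` of the ratio of the
characteristic polynomials of `bordered 0 r b D` and `D`. -/
noncomputable def eigenvalueIntegrand (F : Matrix (Fin (n + 1)) (Fin (n + 1)) ℂ → ℝ≥0∞)
    (D : Matrix (Fin n) (Fin n) ℂ) (b r : Fin n → ℂ) (l : ℂ) : ℝ≥0∞ :=
  ‖(wronskian D.charpoly (bordered 0 r b D).charpoly).eval l / D.charpoly.eval l ^ 2‖ₑ ^ 2 *
    F (bordered ((bordered 0 r b D).charpoly.eval l / D.charpoly.eval l) r b D)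

lemma natCast_mul_lintegral_borderedArray
    (hF : Measurable fun M : Fin (n + 1) → Fin (n + 1) → ℂ => F (of M)) {D : Fin n → Fin n → ℂ}
    {b r : Fin n → ℂ} (h : IsCoprime (bordered 0 r b (of D)).charpoly (of D).charpoly) :
    (n + 1 : ℕ) * ∫⁻ a, F (of (borderedArray a r b D)) =
      ∫⁻ l, eigenvalueIntegrand F (of D) b r l := by
  have hcorner : Measurable fun a => F (of (borderedArray a r b D)) :=
    hF.comp (measurable_borderedArray measurable_id measurable_const measurable_const
      measurable_const)
  have harea := lintegral_comp_eval_div_eval (by simp) h hcorner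
  rw [charpoly_natDegree_eq_dim, Fintype.card_fin] at harea
  exact harea.symm

lemma measurable_eigenvalueIntegrand {Ω : Type*} [MeasurableSpace Ω]
    (hF : Measurable fun M : Fin (n + 1) → Fin (n + 1) → ℂ => F (of M)) (D : Fin n → Fin n → ℂ)
    {b r : Ω → Fin n → ℂ} {l : Ω → ℂ} (hb : Measurable b) (hr : Measurable r)
    (hl : Measurable l) :
    Measurable fun ω => eigenvalueIntegrand F (of D) (b ω) (r ω) (l ω) := by
  have hA : Measurable fun ω => borderedArray 0 (r ω) (b ω) D :=
    measurable_borderedArray measurable_const hr hb measurable_const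
  have hD : Measurable fun _ : Ω => D := measurable_const
  have hP := measurable_eval_charpoly hA hl
  have hQ := measurable_eval_charpoly hD hl
  have hP' := measurable_eval_derivative_charpoly hA hl
  have hQ' := measurable_eval_derivative_charpoly hD hl
  simp only [eigenvalueIntegrand, wronskian, eval_sub, eval_mul]
  exact ((((hQ.mul hP').sub (hQ'.mul hP)).div (hQ.pow_const 2)).enorm.pow_const 2).mul
    (hF.comp (measurable_borderedArray (hP.div hQ) hr hb hD))

lemma eigenvalueIntegrand_mulVec {D : Matrix (Fin n) (Fin n) ℂ} {l : ℂ}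
    (hl : D.charpoly.eval l ≠ 0) (v r : Fin n → ℂ) :
    ‖D.charpoly.eval l‖ₑ ^ 2 * eigenvalueIntegrand F D ((scalar (Fin n) l - D) *ᵥ v) r l =
      ‖(D - vecMulVec v r).charpoly.eval l‖ₑ ^ 2 * F ((unipotentUnit v).val *
        bordered l r 0 (D - vecMulVec v r) * (unipotentUnit v)⁻¹.val) := by
  rw [eigenvalueIntegrand, eval_wronskian_charpoly_bordered l r v hl,
    eval_charpoly_bordered_div_eval l r v hl, unipotentUnit_conj_bordered, ← mul_assoc, ← mul_pow,
    ← enorm_mul, pow_two (D.charpoly.eval l), mul_div_mul_left _ _ hl, mul_div_cancel₀ _ hl]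

lemma lintegral_eigenvalueIntegrand
    (hF : Measurable fun M : Fin (n + 1) → Fin (n + 1) → ℂ => F (of M)) {D : Fin n → Fin n → ℂ}
    {l : ℂ} (hl : (of D).charpoly.eval l ≠ 0) :
    ∫⁻ b, ∫⁻ r, eigenvalueIntegrand F (of D) b r l =
      ∫⁻ v : Fin n → ℂ, ∫⁻ r : Fin n → ℂ, ‖(of D - vecMulVec v r).charpoly.eval l‖ₑ ^ 2 *
        F ((unipotentUnit v).val * bordered l r 0 (of D - vecMulVec v r) *
          (unipotentUnit v)⁻¹.val) := by
  have hdet : (scalar (Fin n) l - of D).det ≠ 0 := by rwa [← eval_charpoly]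
  have hmeas : Measurable fun b => ∫⁻ r, eigenvalueIntegrand F (of D) b r l :=
    (measurable_eigenvalueIntegrand hF D measurable_fst measurable_snd
      measurable_const).lintegral_prod_right'
  rw [lintegral_comp_mulVec hdet hmeas, ← eval_charpoly,
    ← lintegral_const_mul' _ _ (ENNReal.pow_ne_top enorm_ne_top)]
  refine lintegral_congr fun v => ?_
  rw [← lintegral_const_mul' _ _ (ENNReal.pow_ne_top enorm_ne_top)]
  exact lintegral_congr fun r => eigenvalueIntegrand_mulVec hl v r

lemma ae_eval_charpoly_ne_zero {m : Type*} [Fintype m] [DecidableEq m] (M : Matrix m m ℂ) :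
    ∀ᵐ l : ℂ, M.charpoly.eval l ≠ 0 := by
  filter_upwards [(rootSet_finite M.charpoly ℂ).countable.ae_notMem volume] with l hl h
  exact hl (by simpa [mem_rootSet, M.charpoly_monic.ne_zero] using h)

lemma lintegral_deflation (hF : Measurable fun M : Fin (n + 1) → Fin (n + 1) → ℂ => F (of M)) :
    (n + 1 : ℕ) * ∫⁻ M : Fin (n + 1) → Fin (n + 1) → ℂ, F (of M) =
      ∫⁻ l : ℂ, ∫⁻ v : Fin n → ℂ, ∫⁻ r : Fin n → ℂ, ∫⁻ M : Fin n → Fin n → ℂ,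
        ‖(of M).charpoly.eval l‖ₑ ^ 2 * F ((unipotentUnit v).val * bordered l r 0 (of M) *
          (unipotentUnit v)⁻¹.val) := by
  let H (l : ℂ) (v r : Fin n → ℂ) (M : Fin n → Fin n → ℂ) : ℝ≥0∞ :=
    ‖(of M).charpoly.eval l‖ₑ ^ 2 *
      F ((unipotentUnit v).val * bordered l r 0 (of M) * (unipotentUnit v)⁻¹.val)
  have hH : Measurable fun p : (Fin n → Fin n → ℂ) × ℂ × (Fin n → ℂ) × (Fin n → ℂ) =>
      H p.2.1 p.2.2.1 p.2.2.2 (p.1 - fun i j => p.2.2.1 i * p.2.2.2 j) := by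
    have hM : Measurable fun p : (Fin n → Fin n → ℂ) × ℂ × (Fin n → ℂ) × (Fin n → ℂ) =>
        p.1 - fun i j => p.2.2.1 i * p.2.2.2 j := by fun_prop
    exact ((measurable_eval_charpoly hM (by fun_prop)).enorm.pow_const 2).mul
      (measurable_unipotentUnit_conj_bordered hF (by fun_prop) (by fun_prop) (by fun_prop) hM)
  calc (n + 1 : ℕ) * ∫⁻ M : Fin (n + 1) → Fin (n + 1) → ℂ, F (of M)
      = ∫⁻ D, ∫⁻ b, ∫⁻ r, ∫⁻ l, eigenvalueIntegrand F (of D) b r l := by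
        rw [lintegral_matrix_succ hF, ← lintegral_const_mul' _ _ (ENNReal.natCast_ne_top _)]
        refine lintegral_congr_ae ?_
        filter_upwards [ae_separable_charpoly n] with D hD
        rw [← lintegral_const_mul' _ _ (ENNReal.natCast_ne_top _)]
        refine lintegral_congr_ae ?_
        filter_upwards [ae_isCoprime_charpoly_bordered hD] with b hb
        rw [← lintegral_const_mul' _ _ (ENNReal.natCast_ne_top _)]
        refine lintegral_congr_ae ?_
        filter_upwards [hb] with r hr
        exact natCast_mul_lintegral_borderedArray hF hr
    _ = ∫⁻ D, ∫⁻ l, ∫⁻ b, ∫⁻ r, eigenvalueIntegrand F (of D) b r l :=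
        lintegral_congr fun D => (lintegral_rotate_three
          (f := fun l b r => eigenvalueIntegrand F (of D) b r l)
          (measurable_eigenvalueIntegrand hF D (by fun_prop) (by fun_prop) measurable_fst)).symm
    _ = ∫⁻ D, ∫⁻ l, ∫⁻ v, ∫⁻ r, H l v r (D - fun i j => v i * r j) := by
        refine lintegral_congr fun D => lintegral_congr_ae ?_
        filter_upwards [ae_eval_charpoly_ne_zero (of D)] with l hl
        exact lintegral_eigenvalueIntegrand hF hl
    _ = ∫⁻ l, ∫⁻ v, ∫⁻ r, ∫⁻ D, H l v r (D - fun i j => v i * r j) := lintegral_rotate_four hH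
    _ = ∫⁻ l, ∫⁻ v, ∫⁻ r, ∫⁻ M, H l v r M :=
        lintegral_congr fun l => lintegral_congr fun v => lintegral_congr fun r =>
          lintegral_sub_right_eq_self _ _

end Corner

end Deflation

section UnitaryInvariance

open Matrix Polynomial

section Frobenius

variable {m : Type*} [Fintype m]

/-- The squared Frobenius norm, kept as an explicit sum since matrices carry no global norm. -/
noncomputable def frobeniusSq (M : Matrix m m ℂ) : ℝ := ∑ i, ∑ j, ‖M i j‖ ^ 2

/-- The Gaussian density on matrices without its normalising factor. -/
noncomputable def gaussianWeight (M : Matrix m m ℂ) : ℝ≥0∞ :=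
  ENNReal.ofReal (rexp (-frobeniusSq M))

lemma frobeniusSq_eq_trace (M : Matrix m m ℂ) : (frobeniusSq M : ℂ) = (Mᴴ * M).trace := by
  simp only [frobeniusSq, trace, diag_apply, Matrix.mul_apply, conjTranspose_apply,
    RCLike.star_def, Complex.conj_mul', Complex.ofReal_sum, Complex.ofReal_pow]
  exact Finset.sum_comm

lemma frobeniusSq_unitary_conj [DecidableEq m] {U : Matrix m m ℂ} (hU : U ∈ unitaryGroup m ℂ)
    (M : Matrix m m ℂ) : frobeniusSq (U * M * Uᴴ) = frobeniusSq M := by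
  have hUU : Uᴴ * U = 1 := mem_unitaryGroup_iff'.1 hU
  refine Complex.ofReal_injective ?_
  calc (frobeniusSq (U * M * Uᴴ) : ℂ)
      = (U * (Mᴴ * (Uᴴ * U) * M * Uᴴ)).trace := by
        rw [frobeniusSq_eq_trace, conjTranspose_mul, conjTranspose_mul, conjTranspose_conjTranspose]
        simp only [Matrix.mul_assoc]
    _ = (Mᴴ * M * (Uᴴ * U)).trace := by
        rw [hUU, trace_mul_comm, Matrix.mul_one, Matrix.mul_assoc, hUU]
    _ = frobeniusSq M := by rw [hUU, Matrix.mul_one, frobeniusSq_eq_trace]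

lemma measurable_gaussianWeight : Measurable fun M : m → m → ℂ => gaussianWeight (of M) := by
  simp only [gaussianWeight, frobeniusSq, of_apply]
  fun_prop

lemma gaussianWeight_unitary_conj [DecidableEq m] {U : Matrix m m ℂ} (hU : U ∈ unitaryGroup m ℂ)
    (M : Matrix m m ℂ) : gaussianWeight (U * M * Uᴴ) = gaussianWeight M := by
  rw [gaussianWeight, frobeniusSq_unitary_conj hU, gaussianWeight]

lemma gaussianWeight_bordered {n : ℕ} (l : ℂ) (r : Fin n → ℂ) (M : Matrix (Fin n) (Fin n) ℂ) :
    gaussianWeight (bordered l r 0 M) = ENNReal.ofReal (rexp (-‖l‖ ^ 2)) *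
      (ENNReal.ofReal (rexp (-∑ i, ‖r i‖ ^ 2)) * gaussianWeight M) := by
  have hsum : frobeniusSq (bordered l r 0 M) = ‖l‖ ^ 2 + ∑ i, ‖r i‖ ^ 2 + frobeniusSq M := by
    simp [frobeniusSq, Fin.sum_univ_succ, bordered, borderedArray]
  rw [gaussianWeight, gaussianWeight, hsum, ← ENNReal.ofReal_mul (by positivity),
    ← ENNReal.ofReal_mul (by positivity), ← Real.exp_add, ← Real.exp_add]
  ring_nf

end Frobenius

section Triangularisation

variable {n : ℕ}

lemma exists_unitary_col_eq {m : Type*} [Fintype m] [DecidableEq m] (i₀ : m) {x : m → ℂ}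
    (hx : ∑ i, ‖x i‖ ^ 2 = 1) : ∃ U ∈ unitaryGroup m ℂ, U.col i₀ = x := by
  have hnorm : ‖WithLp.toLp 2 x‖ = 1 := by
    rw [EuclideanSpace.norm_eq, Real.sqrt_eq_one]
    exact hx
  have hortho : Orthonormal ℂ (({i₀} : Set m).domRestrict
      fun _ => (WithLp.toLp 2 x : EuclideanSpace ℂ m)) :=
    ⟨fun _ => hnorm, fun i j hij => (hij (Subsingleton.elim _ _)).elim⟩
  obtain ⟨b, hb⟩ := hortho.exists_orthonormalBasis_extension_of_card_eq (by simp)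
  refine ⟨(EuclideanSpace.basisFun m ℂ).toBasis.toMatrix b,
    OrthonormalBasis.toMatrix_orthonormalBasis_mem_unitary _ _, ?_⟩
  ext i
  simp [Module.Basis.toMatrix_apply, hb i₀ rfl]

lemma exists_eq_bordered_of_col_eq_single {R : Type*} [CommRing R] {ρ : R}
    {A : Matrix (Fin (n + 1)) (Fin (n + 1)) R} (hA : A.col 0 = Pi.single 0 ρ) :
    ∃ s T, A = bordered ρ s 0 T := by
  have hA' (i) : A i 0 = Pi.single (M := fun _ => R) 0 ρ i := congrFun hA i
  refine ⟨fun j => A 0 j.succ, of fun i j => A i.succ j.succ, Matrix.ext fun i j => ?_⟩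
  cases i using Fin.cases <;> cases j using Fin.cases <;> simp [bordered, borderedArray, hA']

lemma exists_unitary_mul_bordered {A : Matrix (Fin (n + 1)) (Fin (n + 1)) ℂ} {ρ : ℝ} (hρ : 0 < ρ)
    (hA : ∑ i, ‖A i 0‖ ^ 2 = ρ ^ 2) :
    ∃ U ∈ unitaryGroup (Fin (n + 1)) ℂ, ∃ s T, A = U * bordered (ρ : ℂ) s 0 T := by
  have hρ' : (ρ : ℂ) ≠ 0 := by exact_mod_cast hρ.ne'
  have hunit : ∑ i, ‖((ρ : ℂ)⁻¹ • A.col 0) i‖ ^ 2 = 1 := by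
    simp_rw [Pi.smul_apply, col_apply, norm_smul, mul_pow]
    rw [← Finset.mul_sum, hA, norm_inv, Complex.norm_real, Real.norm_of_nonneg hρ.le, ← mul_pow,
      inv_mul_cancel₀ hρ.ne', one_pow]
  obtain ⟨U, hU, hcol⟩ := exists_unitary_col_eq 0 hunit
  have hUU : Uᴴ * U = 1 := mem_unitaryGroup_iff'.1 hU
  have hfirst : (Uᴴ * A).col 0 = Pi.single 0 (ρ : ℂ) := by
    rw [← mulVec_single_one, ← mulVec_mulVec, mulVec_single_one, ← smul_inv_smul₀ hρ' (A.col 0),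
      ← hcol, mulVec_smul, ← mulVec_single_one U, mulVec_mulVec, hUU, one_mulVec, ← Pi.single_smul,
      smul_eq_mul, mul_one]
  obtain ⟨s, T, hR⟩ := exists_eq_bordered_of_col_eq_single hfirst
  refine ⟨U, hU, s, T, ?_⟩
  rw [← hR, ← Matrix.mul_assoc, show U * Uᴴ = 1 from mem_unitaryGroup_iff.1 hU, Matrix.one_mul]

lemma exists_unipotentUnit_eq_unitary_mul_bordered (v : Fin n → ℂ) :
    ∃ U ∈ unitaryGroup (Fin (n + 1)) ℂ, ∃ s T,
      (unipotentUnit v).val = U * bordered ((√(1 + ∑ i, ‖v i‖ ^ 2) : ℝ) : ℂ) s 0 T ∧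
      √(1 + ∑ i, ‖v i‖ ^ 2) * ‖T.det‖ = 1 := by
  have hpos : 0 < 1 + ∑ i, ‖v i‖ ^ 2 := by positivity
  have hcol : ∑ i, ‖(unipotentUnit v).val i 0‖ ^ 2 = 1 + ∑ i, ‖v i‖ ^ 2 := by
    change ∑ i, ‖bordered 1 0 v 1 i 0‖ ^ 2 = _
    rw [Fin.sum_univ_succ]
    simp [bordered, borderedArray]
  obtain ⟨U, hU, s, T, hfactor⟩ := exists_unitary_mul_bordered (A := (unipotentUnit v).val)
    (Real.sqrt_pos.2 hpos) (hcol.trans (Real.sq_sqrt hpos.le).symm)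
  refine ⟨U, hU, s, T, hfactor, ?_⟩
  have hdet : (unipotentUnit v).val.det = 1 := by
    change (bordered 1 0 v 1).det = 1
    rw [det_bordered_of_isRegular 1 0 v (by rw [det_one]; exact isRegular_one)]
    simp
  have hU_norm : ‖U.det‖ = 1 := CStarRing.norm_of_mem_unitary (det_of_mem_unitary hU)
  rw [hfactor, det_mul, det_bordered_zero] at hdet
  have hnorm : ‖U.det * ((√(1 + ∑ i, ‖v i‖ ^ 2) : ℝ) * T.det)‖ = 1 := by rw [hdet, norm_one]
  rwa [norm_mul, hU_norm, one_mul, norm_mul, Complex.norm_real,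
    Real.norm_of_nonneg (Real.sqrt_nonneg _)] at hnorm

end Triangularisation

section ConjugationInvariance

variable {m : Type*} [Fintype m] [DecidableEq m]

/-- Right multiplication by a matrix as an endomorphism of the space of arrays. -/
def mulRightArray (B : Matrix m m ℂ) : (m → m → ℂ) →ₗ[ℂ] (m → m → ℂ) :=
  LinearMap.pi fun i => (toLin' Bᵀ).comp (LinearMap.proj i)

lemma mulRightArray_apply (B : Matrix m m ℂ) (M : m → m → ℂ) :
    mulRightArray B M = of.symm (of M * B) := by
  ext i j
  simp [mulRightArray, Matrix.mul_apply, mulVec, dotProduct, mul_comm]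

lemma det_mulRightArray (B : Matrix m m ℂ) :
    LinearMap.det (mulRightArray B) = B.det ^ Fintype.card m := by
  rw [mulRightArray, LinearMap.det_pi]
  simp

/-- Transposition as an automorphism of the space of arrays; it turns right multiplications into
left multiplications. -/
def transposeArray (m : Type*) : (m → m → ℂ) ≃ₗ[ℂ] (m → m → ℂ) where
  toFun M i j := M j i
  invFun M i j := M j i
  map_add' _ _ := rfl
  map_smul' _ _ := rfl

lemma lintegral_comp_conj {T S : Matrix m m ℂ} (hTS : T * S = 1)
    {g : (m → m → ℂ) → ℝ≥0∞} (hg : Measurable g) :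
    ∫⁻ M, g (of.symm (T * of M * S)) = ∫⁻ M, g M := by
  let L : (m → m → ℂ) →ₗ[ℂ] (m → m → ℂ) :=
    ((transposeArray m).toLinearMap ∘ₗ mulRightArray Tᵀ ∘ₗ (transposeArray m).symm.toLinearMap) ∘ₗ
      mulRightArray S
  have hL (M) : L M = of.symm (T * of M * S) := by
    rw [Matrix.mul_assoc]
    ext i j
    simp only [L, LinearMap.comp_apply, mulRightArray_apply]
    simp [transposeArray, Matrix.mul_apply, mul_comm]
  have hdet : LinearMap.det (L.restrictScalars ℝ) = 1 := by
    rw [LinearMap.det_restrictScalars, LinearMap.det_comp, LinearMap.det_conj, det_mulRightArray,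
      det_mulRightArray, det_transpose, ← mul_pow, ← det_mul, hTS, det_one, one_pow, map_one]
  have : (volume : Measure (m → m → ℂ)).IsAddHaarMeasure :=
    Measure.pi.isAddHaarMeasure fun _ => (volume : Measure (m → ℂ))
  have hmap := Measure.map_linearMap_addHaar_eq_smul_addHaar (volume : Measure (m → m → ℂ))
    (f := L.restrictScalars ℝ) (hdet ▸ one_ne_zero)
  rw [hdet, inv_one, abs_one, ENNReal.ofReal_one, one_smul] at hmap
  simp_rw [← hL]
  conv_rhs => rw [← hmap]
  rw [lintegral_map hg (L.restrictScalars ℝ).continuous_of_finiteDimensional.measurable]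
  rfl

lemma lintegral_comp_affine {A : Matrix m m ℂ} (hA : A.det ≠ 0) {g : (m → ℂ) → ℝ≥0∞}
    (hg : Measurable g) (c : m → ℂ) : ∫⁻ r, g (A *ᵥ r + c) = (‖A.det‖ₑ ^ 2)⁻¹ * ∫⁻ r, g r := by
  have hchange := lintegral_comp_mulVec hA (g := fun r => g (r + c)) (by fun_prop)
  rw [lintegral_add_right_eq_self g c] at hchange
  rw [hchange, ← mul_assoc, ENNReal.inv_mul_cancel (pow_ne_zero _ (enorm_ne_zero.2 hA))
    (ENNReal.pow_ne_top enorm_ne_top), one_mul]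

lemma lintegral_lintegral_comp_affine_conj {Φ : (m → ℂ) → (m → m → ℂ) → ℝ≥0∞}
    (hΦ : Measurable fun p : (m → ℂ) × (m → m → ℂ) => Φ p.1 p.2) {A T S : Matrix m m ℂ}
    (hA : A.det ≠ 0) (hTS : T * S = 1) {c : (m → m → ℂ) → m → ℂ} (hc : Measurable c) :
    ∫⁻ r, ∫⁻ M, Φ (A *ᵥ r + c M) (of.symm (T * of M * S)) =
      (‖A.det‖ₑ ^ 2)⁻¹ * ∫⁻ M, ∫⁻ r, Φ r M := by
  have hconj : Continuous fun M : m → m → ℂ => of.symm (T * of M * S) := by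
    have hof : Continuous fun M : m → m → ℂ => of M := continuous_id
    exact (continuous_const.matrix_mul hof).matrix_mul continuous_const
  have hmulVec : Continuous fun r : m → ℂ => A *ᵥ r := continuous_const.matrix_mulVec continuous_id
  have hjoint : Measurable fun p : (m → ℂ) × (m → m → ℂ) =>
      Φ (A *ᵥ p.1 + c p.2) (of.symm (T * of p.2 * S)) :=
    hΦ.comp (f := fun p : (m → ℂ) × (m → m → ℂ) =>
        (A *ᵥ p.1 + c p.2, of.symm (T * of p.2 * S)))
      (((hmulVec.measurable.comp measurable_fst).add (hc.comp measurable_snd)).prodMk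
        (hconj.measurable.comp measurable_snd))
  have hslice (M : m → m → ℂ) : Measurable fun r => Φ r M :=
    hΦ.comp (f := fun r : m → ℂ => (r, M)) (by fun_prop)
  rw [lintegral_lintegral_swap hjoint.aemeasurable]
  simp_rw [lintegral_comp_affine hA (hslice _)]
  rw [lintegral_const_mul' _ _ (ENNReal.inv_ne_top.2 (pow_ne_zero _ (enorm_ne_zero.2 hA))),
    lintegral_comp_conj hTS (g := fun M => ∫⁻ r, Φ r M) (Measurable.lintegral_prod_left' hΦ)]

end ConjugationInvariance

section UnitaryDeflation

variable {n : ℕ}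

lemma bordered_mul_bordered_zero {K : Type*} [Field K] (ρ l : K) (s r : Fin n → K)
    {T : Matrix (Fin n) (Fin n) K} (hT : IsUnit T.det) (M : Matrix (Fin n) (Fin n) K) :
    bordered ρ s 0 T * bordered l r 0 M =
      bordered l ((ρ • (T⁻¹)ᵀ) *ᵥ r + (s ᵥ* M - l • s) ᵥ* T⁻¹) 0 (T * M * T⁻¹) *
        bordered ρ s 0 T := by
  have hinv : T⁻¹ * T = 1 := nonsing_inv_mul T hT
  rw [bordered_mul, bordered_mul]
  congr 1
  · simp [mul_comm]
  · rw [smul_mulVec, mulVec_transpose, add_vecMul, smul_vecMul, vecMul_vecMul, vecMul_vecMul,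
      hinv, vecMul_one, vecMul_one]
    abel
  · simp
  · simp [Matrix.mul_assoc, hinv]

lemma units_conj_eq_unitary_conj {m : Type*} [Fintype m] [DecidableEq m] {V : (Matrix m m ℂ)ˣ}
    {U R X Y : Matrix m m ℂ} (hU : U ∈ unitaryGroup m ℂ) (hV : V.val = U * R)
    (hRX : R * X = Y * R) : V.val * X * V⁻¹.val = U * Y * Uᴴ := by
  have hUU : Uᴴ * U = 1 := mem_unitaryGroup_iff'.1 hU
  rw [Units.mul_inv_eq_iff_eq_mul, hV, Matrix.mul_assoc, hRX]
  calc U * (Y * R) = U * Y * (Uᴴ * U) * R := by rw [hUU, Matrix.mul_one, Matrix.mul_assoc]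
    _ = U * Y * Uᴴ * (U * R) := by simp only [Matrix.mul_assoc]

lemma enorm_det_smul_inv_transpose_sq {ρ : ℝ} (hρ : 0 ≤ ρ) {T : Matrix (Fin n) (Fin n) ℂ}
    (hT : ρ * ‖T.det‖ = 1) :
    ‖((ρ : ℂ) • (T⁻¹)ᵀ).det‖ₑ ^ 2 = ENNReal.ofReal (ρ ^ 2) ^ (n + 1) := by
  have hnorm : ‖((ρ : ℂ) • (T⁻¹)ᵀ).det‖ = ρ ^ (n + 1) := by
    rw [det_smul, det_transpose, det_nonsing_inv, Ring.inverse_eq_inv', norm_mul, norm_pow,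
      Complex.norm_real, Real.norm_of_nonneg hρ, norm_inv, Fintype.card_fin,
      ← eq_inv_of_mul_eq_one_left hT, pow_succ]
  rw [← ofReal_norm, hnorm, ← ENNReal.ofReal_pow (by positivity),
    ← ENNReal.ofReal_pow (by positivity), ← pow_mul, ← pow_mul, mul_comm]

variable {F : Matrix (Fin (n + 1)) (Fin (n + 1)) ℂ → ℝ≥0∞}

lemma measurable_enorm_eval_charpoly_sq_mul
    (hF : Measurable fun M : Fin (n + 1) → Fin (n + 1) → ℂ => F (of M)) {Ω : Type*}
    [MeasurableSpace Ω] {l : Ω → ℂ} {r : Ω → Fin n → ℂ} {M : Ω → Fin n → Fin n → ℂ}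
    (hl : Measurable l) (hr : Measurable r) (hM : Measurable M) :
    Measurable fun ω =>
      ‖(of (M ω)).charpoly.eval (l ω)‖ₑ ^ 2 * F (bordered (l ω) (r ω) 0 (of (M ω))) :=
  ((measurable_eval_charpoly hM hl).enorm.pow_const 2).mul
    (hF.comp (measurable_borderedArray hl hr measurable_const hM))

lemma lintegral_unipotentUnit_conj
    (hF : Measurable fun M : Fin (n + 1) → Fin (n + 1) → ℂ => F (of M))
    (hinv : ∀ U ∈ unitaryGroup (Fin (n + 1)) ℂ, ∀ M, F (U * M * Uᴴ) = F M) (l : ℂ)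
    (v : Fin n → ℂ) :
    ∫⁻ r : Fin n → ℂ, ∫⁻ M : Fin n → Fin n → ℂ, ‖(of M).charpoly.eval l‖ₑ ^ 2 *
        F ((unipotentUnit v).val * bordered l r 0 (of M) * (unipotentUnit v)⁻¹.val) =
      (ENNReal.ofReal (1 + ∑ i, ‖v i‖ ^ 2) ^ (n + 1))⁻¹ *
        ∫⁻ M : Fin n → Fin n → ℂ, ∫⁻ r : Fin n → ℂ,
          ‖(of M).charpoly.eval l‖ₑ ^ 2 * F (bordered l r 0 (of M)) := by
  obtain ⟨U, hU, s, T, hfactor, hdet⟩ := exists_unipotentUnit_eq_unitary_mul_bordered v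
  set ρ : ℝ := √(1 + ∑ i, ‖v i‖ ^ 2)
  have hρ_sq : ρ ^ 2 = 1 + ∑ i, ‖v i‖ ^ 2 := Real.sq_sqrt (by positivity)
  have hT : IsUnit T.det := isUnit_iff_ne_zero.2 fun h => by simp [h] at hdet
  let Φ (r : Fin n → ℂ) (M : Fin n → Fin n → ℂ) : ℝ≥0∞ :=
    ‖(of M).charpoly.eval l‖ₑ ^ 2 * F (bordered l r 0 (of M))
  have hintegrand (r : Fin n → ℂ) (M : Fin n → Fin n → ℂ) :
      ‖(of M).charpoly.eval l‖ₑ ^ 2 *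
          F ((unipotentUnit v).val * bordered l r 0 (of M) * (unipotentUnit v)⁻¹.val) =
        Φ (((ρ : ℂ) • (T⁻¹)ᵀ) *ᵥ r + (s ᵥ* of M - l • s) ᵥ* T⁻¹)
          (of.symm (T * of M * T⁻¹)) := by
    have hcharpoly : (T * of M * T⁻¹).charpoly = (of M).charpoly :=
      charpoly_units_conj (nonsingInvUnit T hT) (of M)
    rw [units_conj_eq_unitary_conj hU hfactor (bordered_mul_bordered_zero _ l s r hT _),
      hinv U hU, ← hcharpoly]
    rfl
  have hshift : Continuous fun M : Fin n → Fin n → ℂ => (s ᵥ* of M - l • s) ᵥ* T⁻¹ := by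
    have hof : Continuous fun M : Fin n → Fin n → ℂ => of M := continuous_id
    exact ((continuous_const.matrix_vecMul hof).sub continuous_const).matrix_vecMul continuous_const
  have hscale := enorm_det_smul_inv_transpose_sq (Real.sqrt_nonneg _) hdet
  rw [hρ_sq] at hscale
  have hscale_ne : ((ρ : ℂ) • (T⁻¹)ᵀ).det ≠ 0 := fun h => by
    rw [h, enorm_zero, zero_pow two_ne_zero, eq_comm] at hscale
    exact pow_ne_zero _ (ENNReal.ofReal_pos.2 (by positivity)).ne' hscale
  simp_rw [hintegrand]
  rw [lintegral_lintegral_comp_affine_conj (Φ := Φ) (measurable_enorm_eval_charpoly_sq_mul hF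
    measurable_const measurable_fst measurable_snd) hscale_ne (mul_nonsing_inv T hT)
    hshift.measurable, hscale]

theorem lintegral_deflation_of_unitary_invariant
    (hF : Measurable fun M : Fin (n + 1) → Fin (n + 1) → ℂ => F (of M))
    (hinv : ∀ U ∈ unitaryGroup (Fin (n + 1)) ℂ, ∀ M, F (U * M * Uᴴ) = F M) :
    (n + 1 : ℕ) * ∫⁻ M : Fin (n + 1) → Fin (n + 1) → ℂ, F (of M) =
      (∫⁻ v : Fin n → ℂ, (ENNReal.ofReal (1 + ∑ i, ‖v i‖ ^ 2) ^ (n + 1))⁻¹) *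
        ∫⁻ l : ℂ, ∫⁻ M : Fin n → Fin n → ℂ, ∫⁻ r : Fin n → ℂ,
          ‖(of M).charpoly.eval l‖ₑ ^ 2 * F (bordered l r 0 (of M)) := by
  have hκ : Measurable fun v : Fin n → ℂ => (ENNReal.ofReal (1 + ∑ i, ‖v i‖ ^ 2) ^ (n + 1))⁻¹ := by
    fun_prop
  have hinner : Measurable fun p : ℂ × (Fin n → Fin n → ℂ) => ∫⁻ r : Fin n → ℂ,
      ‖(of p.2).charpoly.eval p.1‖ₑ ^ 2 * F (bordered p.1 r 0 (of p.2)) :=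
    Measurable.lintegral_prod_right' (f := fun q : (ℂ × (Fin n → Fin n → ℂ)) × (Fin n → ℂ) =>
      ‖(of q.1.2).charpoly.eval q.1.1‖ₑ ^ 2 * F (bordered q.1.1 q.2 0 (of q.1.2)))
      (measurable_enorm_eval_charpoly_sq_mul hF (by fun_prop) (by fun_prop) (by fun_prop))
  have houter := Measurable.lintegral_prod_right' (ν := volume) hinner
  rw [lintegral_deflation hF]
  simp_rw [lintegral_unipotentUnit_conj hF hinv]
  rw [← lintegral_const_mul _ houter]
  exact lintegral_congr fun l => lintegral_mul_const _ hκ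

end UnitaryDeflation

end UnitaryInvariance

section SpectralProduct

open Matrix Polynomial

variable {m : Type*} [Fintype m] [DecidableEq m]

/-- The product of the values of `h` at the eigenvalues of `M`, with algebraic multiplicities. -/
noncomputable def spectralProduct (h : ℂ → ℝ≥0∞) (M : Matrix m m ℂ) : ℝ≥0∞ :=
  (M.charpoly.roots.map h).prod

lemma spectralProduct_one (M : Matrix m m ℂ) : spectralProduct (fun _ => 1) M = 1 := by
  simp [spectralProduct]

lemma spectralProduct_of_isEmpty [IsEmpty m] (h : ℂ → ℝ≥0∞) (M : Matrix m m ℂ) :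
    spectralProduct h M = 1 := by
  simp [spectralProduct, charpoly_isEmpty]

lemma spectralProduct_mul (h k : ℂ → ℝ≥0∞) (M : Matrix m m ℂ) :
    spectralProduct (fun x => h x * k x) M = spectralProduct h M * spectralProduct k M :=
  Multiset.prod_map_mul

lemma spectralProduct_unitary_conj (h : ℂ → ℝ≥0∞) {U : Matrix m m ℂ} (hU : U ∈ unitaryGroup m ℂ)
    (M : Matrix m m ℂ) : spectralProduct h (U * M * Uᴴ) = spectralProduct h M := by
  rw [spectralProduct, charpoly_mul_comm, ← Matrix.mul_assoc, ← star_eq_conjTranspose,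
    mem_unitaryGroup_iff'.1 hU, Matrix.one_mul, spectralProduct]

lemma spectralProduct_bordered_zero {n : ℕ} (h : ℂ → ℝ≥0∞) (l : ℂ) (r : Fin n → ℂ)
    (M : Matrix (Fin n) (Fin n) ℂ) :
    spectralProduct h (bordered l r 0 M) = h l * spectralProduct h M := by
  have hne : (X - C l) * M.charpoly ≠ 0 := mul_ne_zero (X_sub_C_ne_zero l) M.charpoly_monic.ne_zero
  simp [spectralProduct, charpoly_bordered_zero, roots_mul hne]

lemma spectralProduct_comp_sub {ψ : ℂ → ℝ≥0∞} (hone : ψ 1 = 1)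
    (hmul : ∀ a b, ψ (a * b) = ψ a * ψ b) (z : ℂ) (M : Matrix m m ℂ) :
    spectralProduct (fun x => ψ (z - x)) M = ψ (M.charpoly.eval z) := by
  rw [(IsAlgClosed.splits M.charpoly).eval_eq_prod_roots_of_monic M.charpoly_monic]
  have hprod := map_multiset_prod (⟨⟨ψ, hone⟩, hmul⟩ : ℂ →* ℝ≥0∞)
    (M.charpoly.roots.map fun x => z - x)
  rw [Multiset.map_map] at hprod
  exact hprod.symm

lemma enorm_det_vandermonde_cons_sq {n : ℕ} (l : ℂ) (y : Fin n → ℂ) :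
    ‖(vandermonde (Fin.cons l y : Fin (n + 1) → ℂ)).det‖ₑ ^ 2 =
      (∏ i, ‖l - y i‖ₑ ^ 2) * ‖(vandermonde y).det‖ₑ ^ 2 := by
  have hprod : ∀ s : Finset (Fin n), ∀ f : Fin n → ℂ, ‖∏ i ∈ s, f i‖ₑ = ∏ i ∈ s, ‖f i‖ₑ :=
    fun s f => by simp only [← ofReal_norm, norm_prod, ENNReal.ofReal_prod_of_nonneg, norm_nonneg,
      implies_true]
  simp only [det_vandermonde, Fin.prod_univ_succ, Fin.prod_Ioi_zero, Fin.prod_Ioi_succ,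
    Fin.cons_zero, Fin.cons_succ, enorm_mul, hprod, mul_pow, Finset.prod_pow, enorm_sub_rev l]

section EigenvalueDensity

lemma measurable_of_measurable_spectralProduct {h : ℂ → ℝ≥0∞}
    (hm : Measurable fun M : Fin 1 → Fin 1 → ℂ => spectralProduct h (of M)) : Measurable h := by
  have hconst : Measurable fun l : ℂ => fun _ _ : Fin 1 => l := by fun_prop
  have heq : ∀ l : ℂ, spectralProduct h (of fun _ _ : Fin 1 => l) = h l := fun l => by
    simp [spectralProduct, charpoly, charmatrix]
  simpa only [Function.comp_def, heq] using hm.comp hconst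

lemma measurable_spectralProduct_comp_sub {ψ : ℂ → ℝ≥0∞} (hψ : Measurable ψ) (hone : ψ 1 = 1)
    (hmul : ∀ a b, ψ (a * b) = ψ a * ψ b) (z : ℂ) (n : ℕ) :
    Measurable fun M : Fin n → Fin n → ℂ => spectralProduct (fun x => ψ (z - x)) (of M) := by
  simp_rw [spectralProduct_comp_sub hone hmul]
  exact hψ.comp (measurable_eval_charpoly measurable_id measurable_const)

lemma spectralProduct_enorm_sub_sq_mul (h : ℂ → ℝ≥0∞) (z : ℂ) {n : ℕ}
    (M : Matrix (Fin n) (Fin n) ℂ) :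
    spectralProduct (fun x => ‖z - x‖ₑ ^ 2 * h x) M =
      ‖M.charpoly.eval z‖ₑ ^ 2 * spectralProduct h M := by
  rw [spectralProduct_mul, spectralProduct_comp_sub (ψ := fun x => ‖x‖ₑ ^ 2) (by simp)
    fun a b => by rw [enorm_mul, mul_pow]]

variable {h : ℂ → ℝ≥0∞} {n : ℕ}

@[fun_prop]
lemma measurable_det_vandermonde {α : Type*} [MeasurableSpace α] {x : α → Fin n → ℂ}
    (hx : Measurable x) : Measurable fun a => (vandermonde (x a)).det := by
  simp only [det_vandermonde]
  fun_prop

lemma lintegral_lintegral_lintegral_mul {α β γ : Type*} [MeasurableSpace α] [MeasurableSpace β]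
    [MeasurableSpace γ] {μ : Measure α} {ν : Measure β} {ρ : Measure γ} [SFinite ν] {a : α → ℝ≥0∞}
    {A : α → β → ℝ≥0∞} {e : γ → ℝ≥0∞} (ha : Measurable a)
    (hA : Measurable fun p : α × β => A p.1 p.2) (he : Measurable e) :
    ∫⁻ x, ∫⁻ y, ∫⁻ z, a x * (A x y * e z) ∂ρ ∂ν ∂μ =
      (∫⁻ z, e z ∂ρ) * ∫⁻ x, a x * ∫⁻ y, A x y ∂ν ∂μ := by
  have hAx : ∀ x, Measurable (A x) := fun x => hA.comp measurable_prodMk_left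
  refine Eq.trans (lintegral_congr fun x => ?_)
    (lintegral_const_mul (∫⁻ z, e z ∂ρ) (ha.mul hA.lintegral_prod_right'))
  rw [← lintegral_const_mul _ (hAx x), ← lintegral_const_mul _ ((hAx x).const_mul _)]
  refine lintegral_congr fun y => ?_
  simp only [← mul_assoc]
  rw [lintegral_const_mul _ he, mul_comm, mul_assoc]

lemma lintegral_spectralProduct_mul_gaussianWeight_succ
    (hm : ∀ m, Measurable fun M : Fin m → Fin m → ℂ => spectralProduct h (of M)) :
    (n + 1 : ℕ) * ∫⁻ M : Fin (n + 1) → Fin (n + 1) → ℂ,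
        spectralProduct h (of M) * gaussianWeight (of M) =
      (∫⁻ v : Fin n → ℂ, (ENNReal.ofReal (1 + ∑ i, ‖v i‖ ^ 2) ^ (n + 1))⁻¹) *
        (∫⁻ r : Fin n → ℂ, ENNReal.ofReal (rexp (-∑ i, ‖r i‖ ^ 2))) *
        ∫⁻ l, ENNReal.ofReal (rexp (-‖l‖ ^ 2)) * h l * ∫⁻ M : Fin n → Fin n → ℂ,
          spectralProduct (fun x => ‖l - x‖ₑ ^ 2 * h x) (of M) * gaussianWeight (of M) := by
  rw [lintegral_deflation_of_unitary_invariant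
    (F := fun M => spectralProduct h M * gaussianWeight M)
    ((hm (n + 1)).mul measurable_gaussianWeight) fun U hU M => by
      rw [spectralProduct_unitary_conj h hU, gaussianWeight_unitary_conj hU], mul_assoc]
  simp only [spectralProduct_bordered_zero, gaussianWeight_bordered,
    spectralProduct_enorm_sub_sq_mul]
  congr 1
  have hA : Measurable fun p : ℂ × (Fin n → Fin n → ℂ) => ‖(of p.2).charpoly.eval p.1‖ₑ ^ 2 *
      (spectralProduct h (of p.2) * gaussianWeight (of p.2)) :=
    ((measurable_eval_charpoly measurable_snd measurable_fst).enorm.pow_const 2).mul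
      (((hm n).mul measurable_gaussianWeight).comp measurable_snd)
  have hh : Measurable h := measurable_of_measurable_spectralProduct (hm 1)
  have hsplit := lintegral_lintegral_lintegral_mul (μ := volume) (ν := volume) (ρ := volume)
    (a := fun l : ℂ => ENNReal.ofReal (rexp (-‖l‖ ^ 2)) * h l)
    (A := fun l (M : Fin n → Fin n → ℂ) => ‖(of M).charpoly.eval l‖ₑ ^ 2 *
      (spectralProduct h (of M) * gaussianWeight (of M)))
    (e := fun r : Fin n → ℂ => ENNReal.ofReal (rexp (-∑ i, ‖r i‖ ^ 2))) (by fun_prop) hA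
    (by fun_prop)
  simp only [mul_assoc] at hsplit ⊢
  rw [← hsplit]
  refine lintegral_congr fun l => lintegral_congr fun M => lintegral_congr fun r => ?_
  ring

lemma lintegral_prod_mul_enorm_det_vandermonde_sq_succ {μ : Measure ℂ} [SigmaFinite μ]
    (hh : Measurable h) :
    ∫⁻ x : Fin (n + 1) → ℂ, (∏ i, h (x i)) * ‖(vandermonde x).det‖ₑ ^ 2
        ∂(Measure.pi fun _ => μ) =
      ∫⁻ l, h l * ∫⁻ y : Fin n → ℂ, (∏ i, ‖l - y i‖ₑ ^ 2 * h (y i)) *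
        ‖(vandermonde y).det‖ₑ ^ 2 ∂(Measure.pi fun _ => μ) ∂μ := by
  have hF : Measurable fun x : Fin (n + 1) → ℂ =>
      (∏ i, h (x i)) * ‖(vandermonde x).det‖ₑ ^ 2 := by fun_prop
  have hcons := measurePreserving_finCons μ n
  rw [← hcons.lintegral_comp hF]
  refine (lintegral_prod _ (hF.comp hcons.measurable).aemeasurable).trans ?_
  refine lintegral_congr fun l => ?_
  rw [← lintegral_const_mul _ (by fun_prop)]
  refine lintegral_congr fun y => ?_
  simp only [Function.comp_apply, Fin.prod_univ_succ, Fin.cons_zero, Fin.cons_succ,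
    enorm_det_vandermonde_cons_sq, Finset.prod_mul_distrib]
  ring

theorem exists_lintegral_spectralProduct_mul_gaussianWeight (n : ℕ) :
    ∃ c : ℝ≥0∞, ∀ h : ℂ → ℝ≥0∞,
      (∀ m, Measurable fun M : Fin m → Fin m → ℂ => spectralProduct h (of M)) →
      ∫⁻ M : Fin n → Fin n → ℂ, spectralProduct h (of M) * gaussianWeight (of M) =
        c * ∫⁻ x : Fin n → ℂ, (∏ i, ENNReal.ofReal (rexp (-‖x i‖ ^ 2)) * h (x i)) *
          ‖(vandermonde x).det‖ₑ ^ 2 := by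
  induction n with
  | zero =>
    refine ⟨1, fun h _ => ?_⟩
    simp [spectralProduct_of_isEmpty, gaussianWeight, frobeniusSq, volume_pi]
  | succ n ih =>
    obtain ⟨c, hc⟩ := ih
    let d : ℝ≥0∞ := (∫⁻ v : Fin n → ℂ, (ENNReal.ofReal (1 + ∑ i, ‖v i‖ ^ 2) ^ (n + 1))⁻¹) *
      ∫⁻ r : Fin n → ℂ, ENNReal.ofReal (rexp (-∑ i, ‖r i‖ ^ 2))
    refine ⟨((n + 1 : ℕ) : ℝ≥0∞)⁻¹ * (d * c), fun h hm => ?_⟩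
    have hh : Measurable h := measurable_of_measurable_spectralProduct (hm 1)
    have hm_sub : ∀ l : ℂ, ∀ m, Measurable fun M : Fin m → Fin m → ℂ =>
        spectralProduct (fun x => ‖l - x‖ₑ ^ 2 * h x) (of M) := fun l m => by
      simp_rw [spectralProduct_enorm_sub_sq_mul]
      exact ((measurable_eval_charpoly measurable_id measurable_const).enorm.pow_const 2).mul (hm m)
    have hstep := lintegral_spectralProduct_mul_gaussianWeight_succ (n := n) hm
    have hvand := lintegral_prod_mul_enorm_det_vandermonde_sq_succ (n := n) (μ := volume)
      (h := fun x => ENNReal.ofReal (rexp (-‖x‖ ^ 2)) * h x) (by fun_prop)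
    have hcomm : ∀ l : ℂ, ∫⁻ M : Fin n → Fin n → ℂ,
        spectralProduct (fun x => ‖l - x‖ₑ ^ 2 * h x) (of M) * gaussianWeight (of M) =
        c * ∫⁻ y : Fin n → ℂ, (∏ i, ‖l - y i‖ₑ ^ 2 *
          (ENNReal.ofReal (rexp (-‖y i‖ ^ 2)) * h (y i))) * ‖(vandermonde y).det‖ₑ ^ 2 :=
      fun l => by simp only [hc _ (hm_sub l), mul_left_comm (ENNReal.ofReal _)]
    have hmeas : Measurable fun l : ℂ => ENNReal.ofReal (rexp (-‖l‖ ^ 2)) * h l *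
        ∫⁻ y : Fin n → ℂ, (∏ i, ‖l - y i‖ₑ ^ 2 *
          (ENNReal.ofReal (rexp (-‖y i‖ ^ 2)) * h (y i))) * ‖(vandermonde y).det‖ₑ ^ 2 :=
      Measurable.fun_mul (by fun_prop) (Measurable.lintegral_prod_right (by fun_prop))
    simp only [hcomm, mul_left_comm _ c] at hstep
    rw [lintegral_const_mul c hmeas] at hstep
    simp only [← volume_pi] at hvand
    rw [mul_assoc, mul_assoc, hvand, ← hstep, ← mul_assoc, ENNReal.inv_mul_cancel
      (by exact_mod_cast n.succ_ne_zero) (ENNReal.natCast_ne_top _), one_mul]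

end EigenvalueDensity

section StandardNormal

lemma pi_withDensity {E : Type*} [MeasurableSpace E] {μ : Measure E} [SigmaFinite μ]
    {f : E → ℝ≥0∞} [SigmaFinite (μ.withDensity f)] (hf : Measurable f) (n : ℕ) :
    (Measure.pi fun _ : Fin n => μ.withDensity f) =
      (Measure.pi fun _ => μ).withDensity fun x => ∏ i, f (x i) := by
  induction n with
  | zero =>
    simp only [Finset.univ_eq_empty, Finset.prod_empty]
    rw [Measure.pi_of_empty _ Fin.elim0, Measure.pi_of_empty _ Fin.elim0]
    exact withDensity_one.symm
  | succ n ih =>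
    refine Measure.ext_of_lintegral _ fun G hG => ?_
    have hcons := measurePreserving_finCons μ n
    have hprod : Measurable fun x : Fin (n + 1) → E => ∏ i, f (x i) := by fun_prop
    rw [← (measurePreserving_finCons (μ.withDensity f) n).lintegral_comp hG, ih,
      prod_withDensity hf (by fun_prop), lintegral_withDensity_eq_lintegral_mul _ hprod hG,
      ← hcons.lintegral_comp (hprod.mul hG)]
    refine (lintegral_withDensity_eq_lintegral_mul _ (by fun_prop)
      (hG.comp hcons.measurable)).trans (lintegral_congr fun p => ?_)
    simp only [Pi.mul_apply, Function.comp_apply, Fin.prod_univ_succ, Fin.cons_zero, Fin.cons_succ]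

lemma lintegral_pi_withDensity {E : Type*} [MeasurableSpace E] {μ : Measure E} [SigmaFinite μ]
    {f : E → ℝ≥0∞} [SigmaFinite (μ.withDensity f)] (hf : Measurable f) {n : ℕ}
    {G : (Fin n → E) → ℝ≥0∞} (hG : Measurable G) :
    ∫⁻ x, G x ∂(Measure.pi fun _ => μ.withDensity f) =
      ∫⁻ x, (∏ i, f (x i)) * G x ∂(Measure.pi fun _ => μ) := by
  rw [pi_withDensity hf, lintegral_withDensity_eq_lintegral_mul _ (by fun_prop) hG]
  rfl

lemma integral_exp_neg_norm_sq_complex : ∫ z : ℂ, rexp (-‖z‖ ^ 2) = π := by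
  simpa using Complex.integral_rpow_mul_exp_neg_rpow (p := 2) (q := 0) (by norm_num) (by norm_num)

lemma integrable_exp_neg_norm_sq_complex : Integrable fun z : ℂ => rexp (-‖z‖ ^ 2) :=
  Integrable.of_integral_ne_zero (integral_exp_neg_norm_sq_complex.trans_ne pi_ne_zero)

instance isProbabilityMeasure_stdComplexNormal : IsProbabilityMeasure stdComplexNormal := by
  constructor
  rw [stdComplexNormal, withDensity_apply _ MeasurableSet.univ, Measure.restrict_univ,
    ← ofReal_integral_eq_lintegral_ofReal (integrable_exp_neg_norm_sq_complex.const_mul _)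
      (ae_of_all _ fun z => by positivity), integral_const_mul, integral_exp_neg_norm_sq_complex,
    inv_mul_cancel₀ pi_ne_zero, ENNReal.ofReal_one]

lemma pi_stdComplexNormal (n : ℕ) :
    (Measure.pi fun _ : Fin n => stdComplexNormal) =
      volume.withDensity fun x =>
        ENNReal.ofReal π⁻¹ ^ n * ∏ i, ENNReal.ofReal (rexp (-‖x i‖ ^ 2)) := by
  have hprob := isProbabilityMeasure_stdComplexNormal
  unfold stdComplexNormal at hprob ⊢
  rw [pi_withDensity (by fun_prop), ← volume_pi]
  simp only [ENNReal.ofReal_mul (inv_nonneg.2 pi_nonneg), Finset.prod_mul_distrib,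
    Finset.prod_const, Finset.card_univ, Fintype.card_fin]

lemma gaussianWeight_eq_prod {n : ℕ} (M : Matrix (Fin n) (Fin n) ℂ) :
    gaussianWeight M = ∏ i, ∏ j, ENNReal.ofReal (rexp (-‖M i j‖ ^ 2)) := by
  simp only [gaussianWeight, frobeniusSq, ← Finset.sum_neg_distrib, Real.exp_sum]
  rw [ENNReal.ofReal_prod_of_nonneg fun _ _ => Finset.prod_nonneg fun _ _ => (exp_pos _).le]
  exact Finset.prod_congr rfl fun _ _ => ENNReal.ofReal_prod_of_nonneg fun _ _ => (exp_pos _).le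

lemma lintegral_pi_stdComplexNormal {n : ℕ} {G : (Fin n → ℂ) → ℝ≥0∞} (hG : Measurable G) :
    ∫⁻ x, G x ∂(Measure.pi fun _ => stdComplexNormal) =
      ENNReal.ofReal π⁻¹ ^ n * ∫⁻ x, (∏ i, ENNReal.ofReal (rexp (-‖x i‖ ^ 2))) * G x := by
  rw [pi_stdComplexNormal, lintegral_withDensity_eq_lintegral_mul _ (by fun_prop) hG,
    ← lintegral_const_mul _ (by fun_prop)]
  exact lintegral_congr fun x => by simp only [Pi.mul_apply, mul_assoc]

lemma lintegral_pi_pi_stdComplexNormal {n : ℕ} {G : (Fin n → Fin n → ℂ) → ℝ≥0∞}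
    (hG : Measurable G) :
    ∫⁻ M, G M ∂(Measure.pi fun _ => Measure.pi fun _ => stdComplexNormal) =
      ENNReal.ofReal π⁻¹ ^ (n * n) * ∫⁻ M, G M * gaussianWeight (of M) := by
  have hprob : IsProbabilityMeasure (Measure.pi fun _ : Fin n => stdComplexNormal) := inferInstance
  have hweight : Measurable fun M : Fin n → Fin n → ℂ => G M * gaussianWeight (of M) :=
    hG.mul measurable_gaussianWeight
  rw [pi_stdComplexNormal] at hprob ⊢
  rw [lintegral_pi_withDensity (by fun_prop) hG, ← volume_pi, ← lintegral_const_mul _ hweight]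
  refine lintegral_congr fun M => ?_
  simp only [gaussianWeight_eq_prod, of_apply, Finset.prod_mul_distrib, Finset.prod_const,
    Finset.card_univ, Fintype.card_fin, pow_mul]
  ring

/-- The partition function `∫ ∏_{i<j} |x_i - x_j|² dν(x_1) ⋯ dν(x_n)` of the complex Ginibre
ensemble, with `ν` the standard complex normal law. -/
noncomputable def ginibrePartition (n : ℕ) : ℝ≥0∞ :=
  ∫⁻ x : Fin n → ℂ, ‖(vandermonde x).det‖ₑ ^ 2 ∂(Measure.pi fun _ => stdComplexNormal)

theorem lintegral_spectralProduct_stdComplexNormal {h : ℂ → ℝ≥0∞}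
    (hm : ∀ m, Measurable fun M : Fin m → Fin m → ℂ => spectralProduct h (of M)) (n : ℕ) :
    ∫⁻ M : Fin n → Fin n → ℂ, spectralProduct h (of M)
        ∂(Measure.pi fun _ => Measure.pi fun _ => stdComplexNormal) =
      (ginibrePartition n)⁻¹ * ∫⁻ x : Fin n → ℂ,
        (∏ i, h (x i)) * ‖(vandermonde x).det‖ₑ ^ 2 ∂(Measure.pi fun _ => stdComplexNormal) := by
  obtain ⟨c, hc⟩ := exists_lintegral_spectralProduct_mul_gaussianWeight n
  set p := ENNReal.ofReal π⁻¹
  have hp : p ^ n ≠ 0 := pow_ne_zero _ (ENNReal.ofReal_pos.2 (by positivity)).ne'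
  have hp_top : p ^ n ≠ ⊤ := ENNReal.pow_ne_top ENNReal.ofReal_ne_top
  have density : ∀ k : ℂ → ℝ≥0∞,
      (∀ m, Measurable fun M : Fin m → Fin m → ℂ => spectralProduct k (of M)) →
      ∫⁻ M : Fin n → Fin n → ℂ, spectralProduct k (of M)
        ∂(Measure.pi fun _ => Measure.pi fun _ => stdComplexNormal) =
      p ^ (n * n) * c * (p ^ n)⁻¹ * ∫⁻ x : Fin n → ℂ,
        (∏ i, k (x i)) * ‖(vandermonde x).det‖ₑ ^ 2 ∂(Measure.pi fun _ => stdComplexNormal) := by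
    intro k hk
    have hk' : Measurable k := measurable_of_measurable_spectralProduct (hk 1)
    rw [lintegral_pi_pi_stdComplexNormal (hk n), hc k hk, lintegral_pi_stdComplexNormal
      (by fun_prop), ← mul_assoc _ (p ^ n), mul_assoc _ (p ^ n)⁻¹, ENNReal.inv_mul_cancel hp hp_top]
    simp only [Finset.prod_mul_distrib, mul_assoc, mul_one, p]
  have hone := density (fun _ => 1) fun m => by simp only [spectralProduct_one, measurable_const]
  simp only [spectralProduct_one, lintegral_const, measure_univ, mul_one, Finset.prod_const_one,
    one_mul] at hone
  rw [density h hm, ginibrePartition, ENNReal.eq_inv_of_mul_eq_one_left hone.symm]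

end StandardNormal

end SpectralProduct

section Andreief

open Matrix Equiv

variable {ι 𝕜 E : Type*} [Fintype ι] [DecidableEq ι]

lemma det_mul_det_eq_sum {R : Type*} [CommRing R] (f g : ι → E → R) (x : ι → E) :
    (of fun a i => f a (x i)).det * (of fun a i => g a (x i)).det =
      ∑ σ : Perm ι, ∑ τ : Perm ι, ((Perm.sign σ : ℤ) : R) * ((Perm.sign τ : ℤ) : R) *
        ∏ i, (f (σ i) (x i) * g (τ i) (x i)) := by
  rw [det_apply', det_apply', Finset.sum_mul_sum]
  refine Finset.sum_congr rfl fun σ _ => Finset.sum_congr rfl fun τ _ => ?_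
  simp only [of_apply, Finset.prod_mul_distrib]
  ring

lemma sum_sign_mul_sign_mul_prod {R : Type*} [CommRing R] (A : Matrix ι ι R) (σ : Perm ι) :
    ∑ τ : Perm ι, ((Perm.sign σ : ℤ) : R) * ((Perm.sign τ : ℤ) : R) * ∏ i, A (σ i) (τ i) =
      A.det := by
  have hperm : ((Perm.sign σ : ℤ) : R) * (A.submatrix σ id).det = A.det := by
    rw [det_permute, ← mul_assoc, ← Int.cast_mul, Int.units_coe_mul_self, Int.cast_one, one_mul]
  rw [← hperm, ← det_transpose, det_apply', Finset.mul_sum]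
  exact Finset.sum_congr rfl fun τ _ => mul_assoc _ _ _

variable [RCLike 𝕜] [MeasurableSpace E] {μ : Measure E} [SigmaFinite μ] {f g : ι → E → 𝕜}

lemma integrable_sign_mul_sign_mul_prod (h : ∀ a b, Integrable (fun x => f a x * g b x) μ)
    (σ τ : Perm ι) :
    Integrable (fun x : ι → E => ((Perm.sign σ : ℤ) : 𝕜) * ((Perm.sign τ : ℤ) : 𝕜) *
      ∏ i, (f (σ i) (x i) * g (τ i) (x i))) (Measure.pi fun _ => μ) :=
  (Integrable.fintype_prod fun i => h (σ i) (τ i)).const_mul _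

lemma integrable_det_mul_det (h : ∀ a b, Integrable (fun x => f a x * g b x) μ) :
    Integrable (fun x : ι → E => (of fun a i => f a (x i)).det * (of fun a i => g a (x i)).det)
      (Measure.pi fun _ => μ) := by
  simp only [det_mul_det_eq_sum]
  exact integrable_finsetSum _ fun σ _ => integrable_finsetSum _ fun τ _ =>
    integrable_sign_mul_sign_mul_prod h σ τ

/-- Andréief's identity. -/
theorem integral_det_mul_det (h : ∀ a b, Integrable (fun x => f a x * g b x) μ) :
    ∫ x : ι → E, (of fun a i => f a (x i)).det * (of fun a i => g a (x i)).det
      ∂(Measure.pi fun _ => μ) =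
      ((Fintype.card ι).factorial : 𝕜) * (of fun a b => ∫ x, f a x * g b x ∂μ).det := by
  have h_int := integrable_sign_mul_sign_mul_prod h
  simp only [det_mul_det_eq_sum]
  rw [integral_finsetSum _ fun σ _ => integrable_finsetSum _ fun τ _ => h_int σ τ,
    ← Fintype.card_perm, ← nsmul_eq_mul, ← Finset.card_univ, ← Finset.sum_const]
  refine Finset.sum_congr rfl fun σ _ => ?_
  rw [integral_finsetSum _ fun τ _ => h_int σ τ,
    ← sum_sign_mul_sign_mul_prod (of fun a b => ∫ x, f a x * g b x ∂μ) σ]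
  refine Finset.sum_congr rfl fun τ _ => ?_
  rw [integral_const_mul]
  congr 1
  exact integral_fintype_prod_eq_prod fun i x => f (σ i) x * g (τ i) x

end Andreief

section Pascal

open Matrix Polynomial

variable {R : Type*} [CommRing R]

/-- The matrix of the substitution `X ↦ X + u` on polynomials of degree less than `M`, in the
basis of monomials. -/
noncomputable def pascal (M : ℕ) (u : R) : Matrix (Fin M) (Fin M) R :=
  of fun m j => ((X + C u) ^ (m : ℕ)).coeff j

lemma pascal_apply (M : ℕ) (u : R) (m j : Fin M) :
    pascal M u m j = u ^ ((m : ℕ) - j) * ((m : ℕ).choose j : R) :=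
  coeff_X_add_C_pow u m j

lemma sum_coeff_mul_pow_of_natDegree_lt {S : Type*} [CommRing S] [Algebra R S] {M : ℕ} {p : R[X]}
    (hp : p.natDegree < M) (x : S) :
    ∑ j : Fin M, algebraMap R S (p.coeff j) * x ^ (j : ℕ) = aeval x p := by
  rw [aeval_def, eval₂_eq_sum_range' _ hp, Finset.sum_range]

lemma natDegree_X_add_C_pow_le (u : R) (m : ℕ) : ((X + C u) ^ m).natDegree ≤ m := by
  refine natDegree_pow_le.trans ?_
  calc m * (X + C u).natDegree ≤ m * 1 := Nat.mul_le_mul_left _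
        (natDegree_add_le_of_degree_le natDegree_X_le ((natDegree_C u).le.trans zero_le_one))
    _ = m := mul_one m

lemma sum_pascal_mul_pow {M : ℕ} (u x : R) (m : Fin M) :
    ∑ j, pascal M u m j * x ^ (j : ℕ) = (x + u) ^ (m : ℕ) := by
  have h := sum_coeff_mul_pow_of_natDegree_lt
    ((natDegree_X_add_C_pow_le u m).trans_lt m.2) x
  simpa [pascal] using h

lemma pascal_mul_pascal (M : ℕ) (u v : R) : pascal M u * pascal M v = pascal M (u + v) := by
  ext m l
  have h := congrArg (fun p => coeff p (l : ℕ)) (sum_coeff_mul_pow_of_natDegree_lt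
    ((natDegree_X_add_C_pow_le u m).trans_lt m.2) (X + C v))
  simp only [finsetSum_coeff, algebraMap_eq, coeff_C_mul, map_pow, map_add, aeval_X, aeval_C] at h
  simp only [mul_apply, pascal, of_apply, C_add]
  rw [h, add_assoc, add_comm (C v)]

lemma pascal_zero (M : ℕ) : pascal M (0 : R) = 1 := by
  ext m j
  simp [pascal, coeff_X_pow, one_apply, Fin.ext_iff, eq_comm]

lemma pascal_neg_mul_pascal (M : ℕ) (u : R) : pascal M (-u) * pascal M u = 1 := by
  rw [pascal_mul_pascal, neg_add_cancel, pascal_zero]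

lemma det_pascal (M : ℕ) (u : R) : (pascal M u).det = 1 := by
  rw [det_of_isLowerTriangular]
  · simp [pascal_apply]
  · intro i j hij
    have : (i : ℕ) < j := hij
    simp [pascal_apply, Nat.choose_eq_zero_of_lt this]

end Pascal

section ComplementaryMinors

open Matrix

variable {R : Type*} [CommRing R]

/-- Jacobi's identity for the complementary minors of a matrix and its inverse. -/
lemma det_mul_det_toBlocks₁₁ {l m : Type*} [Fintype l] [Fintype m] [DecidableEq l] [DecidableEq m]
    {A B : Matrix (l ⊕ m) (l ⊕ m) R} (h : A * B = 1) :
    A.det * B.toBlocks₁₁.det = A.toBlocks₂₂.det := by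
  have hA := fromBlocks_toBlocks A
  have hB := fromBlocks_toBlocks B
  rw [← hA, ← hB, fromBlocks_multiply, ← fromBlocks_one, fromBlocks_inj] at h
  have hmul : A * fromBlocks B.toBlocks₁₁ 0 B.toBlocks₂₁ 1 =
      fromBlocks 1 A.toBlocks₁₂ 0 A.toBlocks₂₂ := by
    conv_lhs => rw [← hA]
    rw [fromBlocks_multiply, h.1, h.2.2.1]
    simp
  have hdet := congrArg det hmul
  rwa [det_mul, det_fromBlocks_zero₁₂, det_fromBlocks_zero₂₁, det_one, det_one, mul_one,
    one_mul] at hdet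

lemma det_natAdd_of_mul_eq_one {k n : ℕ} {A B : Matrix (Fin (k + n)) (Fin (k + n)) R}
    (h : A * B = 1) :
    (A.submatrix (Fin.natAdd k) (Fin.natAdd k) : Matrix (Fin n) (Fin n) R).det =
      A.det * (B.submatrix (Fin.castAdd n) (Fin.castAdd n)).det := by
  have hblocks : A.submatrix finSumFinEquiv finSumFinEquiv *
      B.submatrix finSumFinEquiv finSumFinEquiv =
        (1 : Matrix (Fin k ⊕ Fin n) (Fin k ⊕ Fin n) R) := by
    rw [submatrix_mul_equiv, h, submatrix_one_equiv]
  have hjacobi := det_mul_det_toBlocks₁₁ hblocks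
  rw [det_submatrix_equiv_self] at hjacobi
  exact hjacobi.symm

end ComplementaryMinors

section OrthogonalMonomials

open Matrix ComplexConjugate

/-- The monomials `z ↦ z ^ i` are orthogonal in `L²(μ)`, with squared norms `m i`. -/
structure HasOrthogonalMonomials (μ : Measure ℂ) (m : ℕ → ℝ) : Prop where
  integrable : ∀ i j : ℕ, Integrable (fun z => z ^ i * conj z ^ j) μ
  integral_eq : ∀ i j : ℕ, ∫ z, z ^ i * conj z ^ j ∂μ = if i = j then (m i : ℂ) else 0

variable {μ : Measure ℂ} {m : ℕ → ℝ}

lemma sub_pow_mul_conj_sub_pow (u z : ℂ) {M : ℕ} (a b : Fin M) :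
    (z - u) ^ (a : ℕ) * conj (z - u) ^ (b : ℕ) =
      ∑ i, ∑ j, pascal M (-u) a i * conj (pascal M (-u) b j) *
        (z ^ (i : ℕ) * conj z ^ (j : ℕ)) := by
  rw [← map_pow, sub_eq_add_neg, ← sum_pascal_mul_pow, ← sum_pascal_mul_pow, map_sum,
    Finset.sum_mul_sum]
  refine Finset.sum_congr rfl fun i _ => Finset.sum_congr rfl fun j _ => ?_
  rw [map_mul, map_pow]
  ring

namespace HasOrthogonalMonomials

lemma integrable_sub_pow_mul_conj (h : HasOrthogonalMonomials μ m) (u : ℂ) (a b : ℕ) :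
    Integrable (fun z => (z - u) ^ a * conj (z - u) ^ b) μ := by
  have hexpand := fun z => sub_pow_mul_conj_sub_pow u z (M := a + b + 1) ⟨a, by omega⟩ ⟨b, by omega⟩
  simp only [hexpand]
  exact integrable_finsetSum _ fun i _ => integrable_finsetSum _ fun j _ =>
    (h.integrable i j).const_mul _

lemma gram_sub_pow (h : HasOrthogonalMonomials μ m) (u : ℂ) (M : ℕ) :
    (of fun a b : Fin M => ∫ z, (z - u) ^ (a : ℕ) * conj (z - u) ^ (b : ℕ) ∂μ) =
      pascal M (-u) * diagonal (fun j : Fin M => (m j : ℂ)) * (pascal M (-u))ᴴ := by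
  ext a b
  have h_int : ∀ i j : Fin M, Integrable (fun z =>
      pascal M (-u) a i * conj (pascal M (-u) b j) * (z ^ (i : ℕ) * conj z ^ (j : ℕ))) μ :=
    fun i j => (h.integrable i j).const_mul _
  simp only [of_apply, sub_pow_mul_conj_sub_pow]
  rw [integral_finsetSum _ fun i _ => integrable_finsetSum _ fun j _ => h_int i j, mul_apply]
  refine Finset.sum_congr rfl fun i _ => ?_
  rw [integral_finsetSum _ fun j _ => h_int i j]
  simp only [integral_const_mul, h.integral_eq, Fin.val_inj, mul_ite, mul_zero, Finset.sum_ite_eq,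
    Finset.mem_univ, if_true, mul_diagonal, conjTranspose_apply, RCLike.star_def]
  ring

end HasOrthogonalMonomials

/-- The leading `k × k` block of the inverse Gram matrix of the shifted monomials `(z - u) ^ a`,
`a < M`, for a measure whose monomials are orthogonal with squared norms `m`. Its entries are
the Taylor coefficients at `u` of the truncated reproducing kernel `∑_{j < M} (w̄ z)^j / m j`. -/
noncomputable def dualKernel (m : ℕ → ℝ) (k M : ℕ) (u : ℂ) : Matrix (Fin k) (Fin k) ℂ :=
  of fun a b => ∑ j ∈ Finset.range M, conj (u ^ (j - a) * (j.choose a : ℂ)) *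
    (u ^ (j - b) * (j.choose b : ℂ)) / (m j : ℂ)

lemma submatrix_pascal_eq_dualKernel (m : ℕ → ℝ) (k n : ℕ) (u : ℂ) :
    ((pascal (k + n) u)ᴴ * diagonal (fun j : Fin (k + n) => (m j : ℂ)⁻¹) *
      pascal (k + n) u).submatrix (Fin.castAdd n) (Fin.castAdd n) = dualKernel m k (k + n) u := by
  ext a b
  rw [submatrix_apply, mul_apply, dualKernel, of_apply, Finset.sum_range]
  refine Finset.sum_congr rfl fun j _ => ?_
  simp only [mul_diagonal, conjTranspose_apply, pascal_apply, Fin.val_castAdd, RCLike.star_def]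
  ring

namespace HasOrthogonalMonomials

/-- The Gram matrix of the `n` monomials of degree at least `k` is a corner of that of all `k + n`
monomials, so Jacobi's identity replaces its determinant by a complementary `k × k` minor of the
explicit inverse. -/
lemma det_gram_sub_pow (h : HasOrthogonalMonomials μ m) (hm : ∀ j, m j ≠ 0) (u : ℂ) (k n : ℕ) :
    (of fun a b : Fin n => ∫ z, (z - u) ^ (k + a : ℕ) * conj (z - u) ^ (k + b : ℕ) ∂μ).det =
      (∏ j ∈ Finset.range (k + n), (m j : ℂ)) * (dualKernel m k (k + n) u).det := by
  set P := pascal (k + n) u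
  set Q := pascal (k + n) (-u) with hQ
  set D : Fin (k + n) → ℂ := fun j => (m j : ℂ)
  have hQP : Q * P = 1 := pascal_neg_mul_pascal _ u
  have hQPstar : Qᴴ * Pᴴ = 1 := by
    rw [← conjTranspose_mul, mul_eq_one_comm.1 hQP, conjTranspose_one]
  have hDD : diagonal D * diagonal (fun j => (D j)⁻¹) = 1 := by
    simp only [diagonal_mul_diagonal, D, mul_inv_cancel₀ (Complex.ofReal_ne_zero.2 (hm _)),
      diagonal_one]
  have hinv : Q * diagonal D * Qᴴ * (Pᴴ * diagonal (fun j => (D j)⁻¹) * P) = 1 := by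
    calc Q * diagonal D * Qᴴ * (Pᴴ * diagonal (fun j => (D j)⁻¹) * P)
        = Q * (diagonal D * (Qᴴ * Pᴴ) * diagonal fun j => (D j)⁻¹) * P := by
          simp only [Matrix.mul_assoc]
      _ = 1 := by rw [hQPstar, Matrix.mul_one, hDD, Matrix.mul_one, hQP]
  have hdet : (Q * diagonal D * Qᴴ).det = ∏ j ∈ Finset.range (k + n), (m j : ℂ) := by
    rw [det_mul, det_mul, det_conjTranspose, hQ, det_pascal, det_diagonal, star_one, one_mul,
      mul_one, Finset.prod_range]
  have hjacobi := det_natAdd_of_mul_eq_one hinv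
  rw [hdet, submatrix_pascal_eq_dualKernel, ← h.gram_sub_pow] at hjacobi
  exact hjacobi

end HasOrthogonalMonomials

lemma det_sub_pow (u : ℂ) (k : ℕ) {n : ℕ} (x : Fin n → ℂ) :
    (of fun a i : Fin n => (x i - u) ^ (k + a : ℕ)).det =
      (∏ i, (x i - u) ^ k) * (vandermonde x).det := by
  rw [← det_vandermonde_sub x u, ← det_transpose (vandermonde _), ← det_mul_row]
  congr 1
  ext a i
  simp [pow_add]

lemma det_sub_pow_mul_det_conj (u : ℂ) (k : ℕ) {n : ℕ} (x : Fin n → ℂ) :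
    (of fun a i : Fin n => (x i - u) ^ (k + a : ℕ)).det *
        (of fun a i : Fin n => conj (x i - u) ^ (k + a : ℕ)).det =
      (((∏ i, ‖x i - u‖ ^ (2 * k)) * ‖(vandermonde x).det‖ ^ 2 : ℝ) : ℂ) := by
  have hconj : (of fun a i : Fin n => conj (x i - u) ^ (k + a : ℕ)).det =
      conj (of fun a i : Fin n => (x i - u) ^ (k + a : ℕ)).det := by
    rw [RingHom.map_det]
    congr 1
    ext a i
    simp
  rw [hconj, Complex.mul_conj, Complex.normSq_eq_norm_sq, det_sub_pow, norm_mul, norm_prod, mul_pow,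
    ← Finset.prod_pow]
  simp only [norm_pow, ← pow_mul, mul_comm k]

namespace HasOrthogonalMonomials

variable [SigmaFinite μ]

lemma integrable_prod_mul_det_vandermonde (h : HasOrthogonalMonomials μ m) (u : ℂ) (k n : ℕ) :
    Integrable (fun x : Fin n → ℂ => (∏ i, ‖x i - u‖ ^ (2 * k)) * ‖(vandermonde x).det‖ ^ 2)
      (Measure.pi fun _ => μ) := by
  have hdet := integrable_det_mul_det (μ := μ)
    (f := fun (a : Fin n) z => (z - u) ^ (k + a : ℕ))
    (g := fun b z => conj (z - u) ^ (k + b : ℕ))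
    fun a b => h.integrable_sub_pow_mul_conj u _ _
  simp only [det_sub_pow_mul_det_conj] at hdet
  exact hdet.re

lemma integral_prod_mul_det_vandermonde (h : HasOrthogonalMonomials μ m) (hm : ∀ j, m j ≠ 0)
    (u : ℂ) (k n : ℕ) :
    ∫ x : Fin n → ℂ, (∏ i, ‖x i - u‖ ^ (2 * k)) * ‖(vandermonde x).det‖ ^ 2
        ∂(Measure.pi fun _ => μ) =
      n.factorial * ((∏ j ∈ Finset.range (k + n), m j) * (dualKernel m k (k + n) u).det.re) := by
  have hdet := integral_det_mul_det (μ := μ)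
    (f := fun (a : Fin n) z => (z - u) ^ (k + a : ℕ))
    (g := fun b z => conj (z - u) ^ (k + b : ℕ))
    fun a b => h.integrable_sub_pow_mul_conj u _ _
  simp only [det_sub_pow_mul_det_conj] at hdet
  rw [integral_complex_ofReal, h.det_gram_sub_pow hm, Fintype.card_fin] at hdet
  have hre := congrArg Complex.re hdet
  rwa [Complex.ofReal_re, ← Complex.ofReal_natCast, Complex.re_ofReal_mul, ← Complex.ofReal_prod,
    Complex.re_ofReal_mul] at hre

lemma prod_mul_det_dualKernel_nonneg (h : HasOrthogonalMonomials μ m) (hm : ∀ j, m j ≠ 0)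
    (u : ℂ) (k n : ℕ) :
    0 ≤ (∏ j ∈ Finset.range (k + n), m j) * (dualKernel m k (k + n) u).det.re := by
  have h_nonneg : 0 ≤ ∫ x : Fin n → ℂ, (∏ i, ‖x i - u‖ ^ (2 * k)) * ‖(vandermonde x).det‖ ^ 2
      ∂(Measure.pi fun _ => μ) := integral_nonneg fun x => by positivity
  rw [h.integral_prod_mul_det_vandermonde hm] at h_nonneg
  exact nonneg_of_mul_nonneg_right h_nonneg (by positivity)

lemma lintegral_prod_mul_det_vandermonde (h : HasOrthogonalMonomials μ m) (hm : ∀ j, m j ≠ 0)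
    (u : ℂ) (k n : ℕ) :
    ∫⁻ x : Fin n → ℂ, (∏ i, ENNReal.ofReal (‖u - x i‖ ^ (2 * k))) * ‖(vandermonde x).det‖ₑ ^ 2
        ∂(Measure.pi fun _ => μ) =
      ENNReal.ofReal (n.factorial *
        ((∏ j ∈ Finset.range (k + n), m j) * (dualKernel m k (k + n) u).det.re)) := by
  rw [← h.integral_prod_mul_det_vandermonde hm, ofReal_integral_eq_lintegral_ofReal
    (h.integrable_prod_mul_det_vandermonde u k n) (ae_of_all _ fun x => by positivity)]
  refine lintegral_congr fun x => ?_
  rw [ENNReal.ofReal_mul (by positivity), ENNReal.ofReal_prod_of_nonneg fun _ _ => by positivity,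
    ENNReal.ofReal_pow (norm_nonneg _), ofReal_norm]
  simp only [norm_sub_rev u]

end HasOrthogonalMonomials

end OrthogonalMonomials

section RotationInvariant

open ComplexConjugate

lemma measurePreserving_rotation_withDensity {μ : Measure ℂ} {c : Circle}
    (hμ : MeasurePreserving (rotation c) μ μ) {f : ℝ → ℝ≥0∞} (hf : Measurable f) :
    MeasurePreserving (rotation c) (μ.withDensity fun z => f ‖z‖)
      (μ.withDensity fun z => f ‖z‖) := by
  refine ⟨hμ.measurable, Measure.ext_of_lintegral _ fun g hg => ?_⟩
  have hfg : Measurable ((fun z : ℂ => f ‖z‖) * g) := Measurable.mul (by fun_prop) hg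
  rw [lintegral_map hg hμ.measurable, lintegral_withDensity_eq_lintegral_mul _ (by fun_prop) hg,
    ← hμ.lintegral_comp hfg]
  refine (lintegral_withDensity_eq_lintegral_mul _ (by fun_prop) (hg.comp hμ.measurable)).trans ?_
  simp only [Pi.mul_apply, Function.comp_apply, LinearIsometryEquiv.norm_map]

lemma exists_circle_pow_mul_conj_pow_eq_neg_one {i j : ℕ} (hij : i ≠ j) :
    ∃ c : Circle, (c : ℂ) ^ i * conj (c : ℂ) ^ j = -1 := by
  refine ⟨Circle.exp (π / (i - j)), ?_⟩
  have hsub : ((i : ℂ) - j) ≠ 0 := sub_ne_zero.2 (by exact_mod_cast hij)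
  rw [Circle.coe_exp, ← Complex.exp_conj, ← Complex.exp_nat_mul, ← Complex.exp_nat_mul,
    ← Complex.exp_add, ← Complex.exp_pi_mul_I]
  congr 1
  simp only [map_mul, Complex.conj_I, Complex.conj_ofReal]
  push_cast
  field_simp
  ring

lemma integral_pow_mul_conj_pow_of_rotation_invariant {μ : Measure ℂ}
    (hμ : ∀ c : Circle, MeasurePreserving (rotation c) μ μ) {i j : ℕ} (hij : i ≠ j) :
    ∫ z, z ^ i * conj z ^ j ∂μ = 0 := by
  obtain ⟨c, hc⟩ := exists_circle_pow_mul_conj_pow_eq_neg_one hij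
  have hinv := (hμ c).integral_comp' (f := (rotation c).toHomeomorph.toMeasurableEquiv)
    fun z => z ^ i * conj z ^ j
  have hneg : ∀ z, rotation c z ^ i * conj (rotation c z) ^ j = -(z ^ i * conj z ^ j) := fun z => by
    rw [rotation_apply, map_mul, mul_pow, mul_pow]
    linear_combination z ^ i * conj z ^ j * hc
  have hself : ∫ z, -(z ^ i * conj z ^ j) ∂μ = ∫ z, z ^ i * conj z ^ j ∂μ := by
    simp only [← hneg]
    exact hinv
  rw [integral_neg] at hself
  exact self_eq_neg.1 hself.symm

end RotationInvariant

section ChargedGaussian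

open ComplexConjugate

/-- The measure `|z|^{2γ} dν`, with `ν` the standard complex normal law: the one-particle weight of
the Ginibre ensemble with a charge `γ` at the origin. -/
noncomputable def chargedGaussian (γ : ℝ) : Measure ℂ :=
  stdComplexNormal.withDensity fun z => ENNReal.ofReal (‖z‖ ^ (2 * γ))

instance sigmaFinite_chargedGaussian (γ : ℝ) : SigmaFinite (chargedGaussian γ) :=
  SigmaFinite.withDensity_ofReal _

lemma chargedGaussian_zero : chargedGaussian 0 = stdComplexNormal := by
  simp only [chargedGaussian, mul_zero, rpow_zero, ENNReal.ofReal_one]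
  exact withDensity_one

lemma measurePreserving_rotation_chargedGaussian (γ : ℝ) (c : Circle) :
    MeasurePreserving (rotation c) (chargedGaussian γ) (chargedGaussian γ) :=
  measurePreserving_rotation_withDensity (f := fun r => ENNReal.ofReal (r ^ (2 * γ)))
    (measurePreserving_rotation_withDensity (f := fun r => ENNReal.ofReal (π⁻¹ * rexp (-r ^ 2)))
      (rotation c).measurePreserving (by fun_prop)) (by fun_prop)

lemma integral_chargedGaussian {V : Type*} [NormedAddCommGroup V] [NormedSpace ℝ V] (γ : ℝ)
    (f : ℂ → V) :
    ∫ z, f z ∂(chargedGaussian γ) =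
      ∫ z, (π⁻¹ * rexp (-‖z‖ ^ 2)) • ‖z‖ ^ (2 * γ) • f z := by
  rw [chargedGaussian, integral_withDensity_eq_integral_toReal_smul (by fun_prop)
    (ae_of_all _ fun _ => ENNReal.ofReal_lt_top), stdComplexNormal,
    integral_withDensity_eq_integral_toReal_smul (by fun_prop)
    (ae_of_all _ fun _ => ENNReal.ofReal_lt_top)]
  refine integral_congr_ae (ae_of_all _ fun z => ?_)
  simp only [ENNReal.toReal_ofReal (show 0 ≤ π⁻¹ * rexp (-‖z‖ ^ 2) by positivity),
    ENNReal.toReal_ofReal (show 0 ≤ ‖z‖ ^ (2 * γ) by positivity)]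

variable {γ : ℝ}

lemma integral_norm_pow_chargedGaussian (hγ : -1 < γ) (n : ℕ) :
    ∫ z, ‖z‖ ^ n ∂(chargedGaussian γ) = Real.Gamma (γ + n / 2 + 1) := by
  have hexp : -2 < 2 * γ + n := by linarith [n.cast_nonneg (α := ℝ)]
  have hgauss := Complex.integral_rpow_mul_exp_neg_rpow (p := 2) (by norm_num) hexp
  have hrpow : ∀ᵐ z : ℂ, (π⁻¹ * rexp (-‖z‖ ^ 2)) • ‖z‖ ^ (2 * γ) • ‖z‖ ^ n =
      π⁻¹ * (‖z‖ ^ (2 * γ + n) * rexp (-‖z‖ ^ (2 : ℝ))) := by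
    filter_upwards [(Set.countable_singleton (0 : ℂ)).ae_notMem volume] with z hz
    rw [rpow_add_natCast (norm_ne_zero_iff.2 hz), rpow_two, smul_eq_mul, smul_eq_mul]
    ring
  rw [integral_chargedGaussian, integral_congr_ae hrpow, integral_const_mul, hgauss,
    mul_div_cancel_left₀ _ two_ne_zero, inv_mul_cancel_left₀ pi_ne_zero]
  ring_nf

lemma integrable_norm_pow_chargedGaussian (hγ : -1 < γ) (n : ℕ) :
    Integrable (fun z : ℂ => ‖z‖ ^ n) (chargedGaussian γ) := by
  have hpos : 0 < γ + n / 2 + 1 := by linarith [n.cast_nonneg (α := ℝ)]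
  exact Integrable.of_integral_ne_zero
    ((integral_norm_pow_chargedGaussian hγ n).trans_ne (Gamma_pos_of_pos hpos).ne')

theorem hasOrthogonalMonomials_chargedGaussian (hγ : -1 < γ) :
    HasOrthogonalMonomials (chargedGaussian γ) fun j => Real.Gamma (γ + j + 1) where
  integrable i j := by
    refine (integrable_norm_pow_chargedGaussian hγ (i + j)).mono'
      (Measurable.aestronglyMeasurable (by fun_prop)) (ae_of_all _ fun z => ?_)
    rw [norm_mul, norm_pow, norm_pow, Complex.norm_conj, pow_add]
  integral_eq i j := by
    split_ifs with hij
    · subst hij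
      have hnorm : ∀ z : ℂ, z ^ i * conj z ^ i = ((‖z‖ ^ (2 * i) : ℝ) : ℂ) := fun z => by
        rw [← mul_pow, Complex.mul_conj, Complex.normSq_eq_norm_sq, pow_mul]
        simp only [Complex.ofReal_pow]
      simp only [hnorm]
      rw [integral_complex_ofReal, integral_norm_pow_chargedGaussian hγ]
      push_cast
      rw [mul_div_cancel_left₀ _ two_ne_zero]
    · exact integral_pow_mul_conj_pow_of_rotation_invariant
        (measurePreserving_rotation_chargedGaussian γ) hij

end ChargedGaussian

section Correlator

open Matrix Polynomial

lemma norm_eval_charpoly {n : ℕ} (M : Matrix (Fin n) (Fin n) ℂ) (z : ℂ) :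
    ‖M.charpoly.eval z‖ = ‖(M - z • (1 : Matrix (Fin n) (Fin n) ℂ)).det‖ := by
  rw [eval_charpoly, ← neg_sub (M : Matrix (Fin n) (Fin n) ℂ), det_neg, norm_mul, norm_pow,
    norm_neg, norm_one, one_pow, one_mul, smul_one_eq_diagonal, scalar_apply]

lemma charPolyProduct_eq_norm_eval_charpoly {n : ℕ} (γ : ℝ) (k : ℕ) (z u : ℂ)
    (X : Fin n → Fin n → ℂ) :
    charPolyProduct γ k z u X =
      ‖(of X).charpoly.eval z‖ ^ (2 * γ) * ‖(of X).charpoly.eval u‖ ^ (2 * k) := by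
  rw [norm_eval_charpoly, norm_eval_charpoly, charPolyProduct]

lemma charPolyProduct_nonneg {n : ℕ} (γ : ℝ) (k : ℕ) (z u : ℂ) (X : Fin n → Fin n → ℂ) :
    0 ≤ charPolyProduct γ k z u X := by
  unfold charPolyProduct
  positivity

lemma measurable_charPolyProduct {n : ℕ} (γ : ℝ) (k : ℕ) (z u : ℂ) :
    Measurable fun X : Fin n → Fin n → ℂ => charPolyProduct γ k z u X := by
  simp only [charPolyProduct_eq_norm_eval_charpoly]
  exact ((measurable_eval_charpoly measurable_id measurable_const).norm.pow_const _).mul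
    ((measurable_eval_charpoly measurable_id measurable_const).norm.pow_const _)

lemma ofReal_norm_mul_rpow (p : ℝ) (a b : ℂ) :
    ENNReal.ofReal (‖a * b‖ ^ p) = ENNReal.ofReal (‖a‖ ^ p) * ENNReal.ofReal (‖b‖ ^ p) := by
  rw [norm_mul, mul_rpow (norm_nonneg _) (norm_nonneg _), ENNReal.ofReal_mul (by positivity)]

lemma lintegral_charPolyProduct_eq_lintegral_eigenvalues (γ : ℝ) (k : ℕ) (z u : ℂ) (n : ℕ) :
    ∫⁻ X : Fin n → Fin n → ℂ, ENNReal.ofReal (charPolyProduct γ k z u X)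
        ∂(Measure.pi fun _ => Measure.pi fun _ => stdComplexNormal) =
      (ginibrePartition n)⁻¹ * ∫⁻ x : Fin n → ℂ, (∏ i, ENNReal.ofReal (‖z - x i‖ ^ (2 * γ)) *
        ENNReal.ofReal (‖u - x i‖ ^ (2 * k))) * ‖(vandermonde x).det‖ₑ ^ 2
          ∂(Measure.pi fun _ => stdComplexNormal) := by
  have hone : ∀ p : ℝ, ENNReal.ofReal (‖(1 : ℂ)‖ ^ p) = 1 := by simp
  have hmeas : ∀ (p : ℝ) (w : ℂ) (m : ℕ), Measurable fun M : Fin m → Fin m → ℂ =>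
      spectralProduct (fun x => ENNReal.ofReal (‖w - x‖ ^ p)) (of M) := fun p w m =>
    measurable_spectralProduct_comp_sub (ψ := fun x => ENNReal.ofReal (‖x‖ ^ p)) (by fun_prop)
      (hone p) (ofReal_norm_mul_rpow p) w m
  have hspectral : ∀ (p : ℝ) (w : ℂ) (M : Matrix (Fin n) (Fin n) ℂ),
      spectralProduct (fun x => ENNReal.ofReal (‖w - x‖ ^ p)) M =
        ENNReal.ofReal (‖M.charpoly.eval w‖ ^ p) := fun p w M =>
    spectralProduct_comp_sub (ψ := fun x => ENNReal.ofReal (‖x‖ ^ p)) (hone p)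
      (ofReal_norm_mul_rpow p) w M
  have hdensity := lintegral_spectralProduct_stdComplexNormal (n := n)
    (h := fun x => ENNReal.ofReal (‖z - x‖ ^ (2 * γ)) * ENNReal.ofReal (‖u - x‖ ^ (2 * k : ℝ)))
    fun m => by
      simp only [spectralProduct_mul]
      exact (hmeas _ z m).mul (hmeas _ u m)
  have hcast : ∀ x : ℂ, ‖x‖ ^ (2 * k : ℝ) = ‖x‖ ^ (2 * k) := fun x => by
    exact_mod_cast rpow_natCast ‖x‖ (2 * k)
  simp only [spectralProduct_mul, hspectral] at hdensity
  simp only [hcast] at hdensity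
  rw [← hdensity]
  exact lintegral_congr fun X => by
    rw [charPolyProduct_eq_norm_eval_charpoly, ENNReal.ofReal_mul (by positivity)]

lemma ginibrePartition_eq (n : ℕ) :
    ginibrePartition n =
      ENNReal.ofReal (n.factorial * ∏ j ∈ Finset.range n, (j.factorial : ℝ)) := by
  have h := (hasOrthogonalMonomials_chargedGaussian neg_one_lt_zero
    ).lintegral_prod_mul_det_vandermonde (fun j => by positivity) 0 0 n
  simpa [ginibrePartition, chargedGaussian_zero, Real.Gamma_nat_eq_factorial] using h

variable {γ : ℝ}

lemma lintegral_charPolyProduct (hγ : -1 < γ) (k : ℕ) (u : ℂ) (n : ℕ) :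
    ∫⁻ X : Fin n → Fin n → ℂ, ENNReal.ofReal (charPolyProduct γ k 0 u X)
        ∂(Measure.pi fun _ => Measure.pi fun _ => stdComplexNormal) =
      ENNReal.ofReal ((∏ j ∈ Finset.range n, (j.factorial : ℝ))⁻¹ *
        ((∏ j ∈ Finset.range (k + n), Real.Gamma (γ + j + 1)) *
          (dualKernel (fun j => Real.Gamma (γ + j + 1)) k (k + n) u).det.re)) := by
  have hΓ : ∀ j : ℕ, Real.Gamma (γ + j + 1) ≠ 0 := fun j =>
    (Gamma_pos_of_pos (by linarith [j.cast_nonneg (α := ℝ)])).ne'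
  have hmono := (hasOrthogonalMonomials_chargedGaussian hγ).lintegral_prod_mul_det_vandermonde hΓ
    u k n
  rw [chargedGaussian, lintegral_pi_withDensity (by fun_prop) (by fun_prop)] at hmono
  simp only [lintegral_charPolyProduct_eq_lintegral_eigenvalues, zero_sub, norm_neg,
    Finset.prod_mul_distrib, mul_assoc]
  rw [hmono, ginibrePartition_eq, ← ENNReal.ofReal_inv_of_pos (by positivity),
    ← ENNReal.ofReal_mul (by positivity)]
  congr 1
  field_simp

lemma integrable_charPolyProduct (hγ : -1 < γ) (k : ℕ) (u : ℂ) (n : ℕ) :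
    Integrable (fun X : Fin n → Fin n → ℂ => charPolyProduct γ k 0 u X)
      (Measure.pi fun _ => Measure.pi fun _ => stdComplexNormal) := by
  refine ⟨(measurable_charPolyProduct γ k 0 u).aestronglyMeasurable, ?_⟩
  rw [hasFiniteIntegral_iff_ofReal (ae_of_all _ fun X => charPolyProduct_nonneg γ k 0 u X),
    lintegral_charPolyProduct hγ]
  exact ENNReal.ofReal_lt_top

lemma integral_charPolyProduct (hγ : -1 < γ) (k : ℕ) (u : ℂ) (n : ℕ) :
    ∫ X : Fin n → Fin n → ℂ, charPolyProduct γ k 0 u X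
        ∂(Measure.pi fun _ => Measure.pi fun _ => stdComplexNormal) =
      (∏ j ∈ Finset.range n, (j.factorial : ℝ))⁻¹ *
        ((∏ j ∈ Finset.range (k + n), Real.Gamma (γ + j + 1)) *
          (dualKernel (fun j => Real.Gamma (γ + j + 1)) k (k + n) u).det.re) := by
  have hΓ : ∀ j : ℕ, Real.Gamma (γ + j + 1) ≠ 0 := fun j =>
    (Gamma_pos_of_pos (by linarith [j.cast_nonneg (α := ℝ)])).ne'
  rw [integral_eq_lintegral_of_nonneg_ae (ae_of_all _ fun X => charPolyProduct_nonneg γ k 0 u X)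
    (measurable_charPolyProduct γ k 0 u).aestronglyMeasurable, lintegral_charPolyProduct hγ]
  exact ENNReal.toReal_ofReal (mul_nonneg (by positivity)
    ((hasOrthogonalMonomials_chargedGaussian hγ).prod_mul_det_dualKernel_nonneg hΓ u k n))

lemma norm_det_smul_sub_smul_one {n : ℕ} {c : ℝ} (hc : 0 ≤ c) (w : ℂ) (X : Fin n → Fin n → ℂ) :
    ‖(of ((c : ℂ) • X) - ((c : ℂ) * w) • (1 : Matrix (Fin n) (Fin n) ℂ)).det‖ =
      c ^ n * ‖(of X - w • (1 : Matrix (Fin n) (Fin n) ℂ)).det‖ := by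
  have hsmul : of ((c : ℂ) • X) - ((c : ℂ) * w) • (1 : Matrix (Fin n) (Fin n) ℂ) =
      (c : ℂ) • (of X - w • (1 : Matrix (Fin n) (Fin n) ℂ)) := by
    rw [smul_sub, smul_smul, ← smul_of]
  rw [hsmul, det_smul, norm_mul, norm_pow, Complex.norm_real, norm_of_nonneg hc, Fintype.card_fin]

lemma charPolyProduct_smul {n : ℕ} (γ : ℝ) (k : ℕ) (z u : ℂ) {c : ℝ} (hc : 0 < c)
    (X : Fin n → Fin n → ℂ) :
    charPolyProduct γ k (c * z) (c * u) ((c : ℂ) • X) =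
      c ^ (2 * (γ + k) * n) * charPolyProduct γ k z u X := by
  rw [charPolyProduct, charPolyProduct, norm_det_smul_sub_smul_one hc.le,
    norm_det_smul_sub_smul_one hc.le, mul_rpow (by positivity) (norm_nonneg _), mul_pow,
    ← rpow_natCast c n, ← rpow_mul hc.le, ← rpow_natCast (c ^ (n : ℝ)), ← rpow_mul hc.le,
    mul_mul_mul_comm, ← rpow_add hc]
  congr 2
  push_cast
  ring

lemma charPolyProduct_div_sqrt_comp_smul (γ : ℝ) (k : ℕ) {N : ℕ} (hN : 1 ≤ N) (u : ℂ) :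
    (charPolyProduct γ k 0 (u / (√(N : ℝ) : ℂ)) ∘
      fun X : Fin N → Fin N → ℂ => (((√(N : ℝ))⁻¹ : ℝ) : ℂ) • X) =
      fun X => (N : ℝ) ^ (-((γ + k) * N)) * charPolyProduct γ k 0 u X := by
  have hN_pos : (0 : ℝ) < N := by exact_mod_cast hN
  have hpow : (√(N : ℝ))⁻¹ ^ (2 * (γ + k) * N) = (N : ℝ) ^ (-((γ + k) * N)) := by
    rw [inv_rpow (by positivity), sqrt_eq_rpow, ← rpow_mul hN_pos.le, ← rpow_neg hN_pos.le]
    congr 1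
    ring
  have hsmul := charPolyProduct_smul (n := N) γ k 0 u (inv_pos.2 (sqrt_pos.2 hN_pos))
  rw [hpow, mul_zero, Complex.ofReal_inv, ← div_eq_inv_mul] at hsmul
  funext X
  rw [Function.comp_apply, Complex.ofReal_inv, hsmul]

theorem integrable_charPolyProduct_ginibre (hγ : -1 < γ) (k : ℕ) {N : ℕ} (hN : 1 ≤ N) (u : ℂ) :
    Integrable (charPolyProduct γ k 0 (u / (√(N : ℝ) : ℂ))) (ginibre N) := by
  rw [ginibre, integrable_map_measure (measurable_charPolyProduct γ k 0 _).aestronglyMeasurable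
    (by fun_prop), charPolyProduct_div_sqrt_comp_smul γ k hN]
  exact (integrable_charPolyProduct hγ k u N).const_mul _

theorem twoChargeCorrelator_eq (hγ : -1 < γ) (k : ℕ) {N : ℕ} (hN : 1 ≤ N) (u : ℂ) :
    twoChargeCorrelator N γ k 0 (u / (√(N : ℝ) : ℂ)) =
      (N : ℝ) ^ (-((γ + k) * N)) * ((∏ j ∈ Finset.range N, (j.factorial : ℝ))⁻¹ *
        ((∏ j ∈ Finset.range (k + N), Real.Gamma (γ + j + 1)) *
          (dualKernel (fun j => Real.Gamma (γ + j + 1)) k (k + N) u).det.re)) := by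
  rw [twoChargeCorrelator, ginibre, integral_map (by fun_prop)
    (measurable_charPolyProduct γ k 0 _).aestronglyMeasurable, ← integral_charPolyProduct hγ,
    ← integral_const_mul]
  exact congrArg _ (charPolyProduct_div_sqrt_comp_smul γ k hN u)

end Correlator

section ChargeKernel

open Matrix ComplexConjugate

/-- The real form of `dualKernel`: conjugating by powers of `conj u` leaves a kernel depending on
`x = ‖u‖ ^ 2` only. -/
noncomputable def binomialKernel (m : ℕ → ℝ) (k M : ℕ) (x : ℝ) : Matrix (Fin k) (Fin k) ℝ :=
  of fun a b => ∑ j ∈ Finset.range M, (j.choose a : ℝ) * (j.choose b) * x ^ (j - b) / m j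

lemma conj_pow_mul_dualKernel (m : ℕ → ℝ) (k M : ℕ) (u : ℂ) (a b : Fin k) :
    conj u ^ (a : ℕ) * dualKernel m k M u a b =
      conj u ^ (b : ℕ) * ((binomialKernel m k M (‖u‖ ^ 2) a b : ℝ) : ℂ) := by
  simp only [dualKernel, binomialKernel, of_apply, Complex.ofReal_sum, Finset.mul_sum]
  refine Finset.sum_congr rfl fun j _ => ?_
  rcases lt_or_ge j a with hja | hja
  · simp [Nat.choose_eq_zero_of_lt hja]
  rcases lt_or_ge j b with hjb | hjb
  · simp [Nat.choose_eq_zero_of_lt hjb]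
  have hpow : conj u ^ (a : ℕ) * conj u ^ (j - a) = conj u ^ (b : ℕ) * conj u ^ (j - b) := by
    rw [← pow_add, ← pow_add, Nat.add_sub_cancel' hja, Nat.add_sub_cancel' hjb]
  push_cast
  rw [← Complex.mul_conj', mul_pow, map_mul, map_pow, Complex.conj_natCast]
  linear_combination (j.choose a : ℂ) * (j.choose b) * u ^ (j - b) / m j * hpow

lemma det_dualKernel_of_ne_zero (m : ℕ → ℝ) (k M : ℕ) {u : ℂ} (hu : u ≠ 0) :
    (dualKernel m k M u).det = (((binomialKernel m k M (‖u‖ ^ 2)).det : ℝ) : ℂ) := by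
  have hpow : ∏ a : Fin k, conj u ^ (a : ℕ) ≠ 0 :=
    Finset.prod_ne_zero_iff.2 fun a _ => pow_ne_zero _ ((map_ne_zero _).2 hu)
  refine mul_left_cancel₀ hpow ?_
  rw [← Complex.ofRealHom_eq_coe, RingHom.map_det, ← det_mul_column, ← det_mul_row]
  congr 1
  ext a b
  exact conj_pow_mul_dualKernel m k M u a b

lemma det_dualKernel_eq_det_binomialKernel (m : ℕ → ℝ) (k M : ℕ) (u : ℂ) :
    (dualKernel m k M u).det = (((binomialKernel m k M (‖u‖ ^ 2)).det : ℝ) : ℂ) := by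
  have hdual : Continuous fun u : ℂ => (dualKernel m k M u).det := by
    refine Continuous.matrix_det (continuous_matrix fun a b => ?_)
    simp only [dualKernel, of_apply]
    fun_prop
  have hreal : Continuous fun u : ℂ => (((binomialKernel m k M (‖u‖ ^ 2)).det : ℝ) : ℂ) := by
    refine Complex.continuous_ofReal.comp
      (Continuous.matrix_det (continuous_matrix fun a b => ?_))
    simp only [binomialKernel, of_apply]
    fun_prop
  exact congrFun (hdual.ext_on (dense_compl_singleton 0) hreal
    fun v hv => det_dualKernel_of_ne_zero m k M hv) u

lemma add_one_mul_ring_choose_succ (r : ℝ) (a : ℕ) :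
    (a + 1) * Ring.choose r (a + 1) = (r - a) * Ring.choose r a := by
  rw [Ring.choose_eq_smul, Ring.choose_eq_smul, descPochhammer_succ_right,
    Polynomial.smeval_mul, Polynomial.smeval_sub, Polynomial.smeval_X,
    Polynomial.smeval_natCast, Nat.factorial_succ]
  simp only [smul_eq_mul, pow_one, pow_zero, nsmul_eq_mul, mul_one, Nat.cast_mul, Nat.cast_add,
    Nat.cast_one]
  field_simp

lemma ring_choose_mul_Gamma (r : ℝ) : ∀ a : ℕ, 0 < r + 1 - a →
    Ring.choose r a * (a.factorial * Real.Gamma (r + 1 - a)) = Real.Gamma (r + 1)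
  | 0, _ => by simp
  | a + 1, h => by
    have hra : 0 < r - a := by push_cast at h; linarith
    have hGamma : Real.Gamma (r + 1 - a) = (r - a) * Real.Gamma (r + 1 - (a + 1)) := by
      rw [add_sub_add_right_eq_sub, ← Real.Gamma_add_one hra.ne', sub_add_eq_add_sub]
    rw [← ring_choose_mul_Gamma r a (by linarith), hGamma, Nat.factorial_succ]
    push_cast
    linear_combination a.factorial * Real.Gamma (r + 1 - (a + 1)) * add_one_mul_ring_choose_succ r a

/-- The matrix of multiplication by the binomial series `(1 + T) ^ γ` on power series in `T`
truncated at order `k`. -/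
noncomputable def binomialToeplitz (γ : ℝ) (k : ℕ) : Matrix (Fin k) (Fin k) ℝ :=
  of fun a q => if (q : ℕ) ≤ a then Ring.choose γ ((a : ℕ) - q) else 0

lemma det_binomialToeplitz (γ : ℝ) (k : ℕ) : (binomialToeplitz γ k).det = 1 := by
  rw [det_of_isLowerTriangular, Finset.prod_eq_one]
  · intro a _
    simp [binomialToeplitz]
  · intro a q haq
    exact if_neg (not_le.2 haq)

lemma sum_binomialToeplitz_mul_choose (γ : ℝ) (j : ℕ) {k : ℕ} (a : Fin k) :
    ∑ q : Fin k, binomialToeplitz γ k a q * (j.choose q : ℝ) = Ring.choose (γ + j) (a : ℕ) := by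
  simp only [binomialToeplitz, of_apply]
  rw [add_comm γ, Ring.add_choose_eq _ (Commute.all _ _),
    Finset.Nat.sum_antidiagonal_eq_sum_range_succ
      (fun p q => Ring.choose (j : ℝ) p * Ring.choose γ q),
    ← Finset.sum_range (fun q => (if q ≤ (a : ℕ) then Ring.choose γ ((a : ℕ) - q) else 0) *
      (j.choose q : ℝ))]
  refine (Finset.sum_subset_zero_on_sdiff (Finset.range_subset_range.2 a.2) (fun q hq => ?_)
    (fun q hq => ?_)).symm
  · simp only [Finset.mem_sdiff, Finset.mem_range] at hq
    rw [if_neg (by lia), zero_mul]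
  · rw [Finset.mem_range] at hq
    rw [if_pos (by lia), Ring.choose_natCast, mul_comm]

/-- The kernel obtained from `binomialKernel` with the Gamma moments `Γ(γ + j + 1)` by unitriangular
row operations; its entries are beta integrals of truncated exponential series. -/
noncomputable def chargeKernel (γ : ℝ) (k M : ℕ) (x : ℝ) : Matrix (Fin k) (Fin k) ℝ :=
  of fun a b => ∑ j ∈ Finset.range M,
    (j.choose b : ℝ) * x ^ (j - b) / ((a : ℕ).factorial * Real.Gamma (γ + j + 1 - a))

variable {γ : ℝ} {k : ℕ}

lemma val_lt_of_natCast_lt_add_one (hγ : (k : ℝ) < γ + 1) (a : Fin k) : ((a : ℕ) : ℝ) < γ := by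
  have hak : ((a : ℕ) : ℝ) + 1 ≤ k := by exact_mod_cast a.2
  linarith

lemma binomialToeplitz_mul_binomialKernel (hγ : (k : ℝ) < γ + 1) (M : ℕ) (x : ℝ) :
    binomialToeplitz γ k * binomialKernel (fun j => Real.Gamma (γ + j + 1)) k M x =
      chargeKernel γ k M x := by
  ext a b
  simp only [mul_apply, binomialKernel, chargeKernel, of_apply, Finset.mul_sum]
  rw [Finset.sum_comm]
  refine Finset.sum_congr rfl fun j _ => ?_
  have haγ := val_lt_of_natCast_lt_add_one hγ a
  have hsub : 0 < γ + j + 1 - a := by linarith [j.cast_nonneg (α := ℝ)]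
  have hchoose := ring_choose_mul_Gamma (γ + j) a hsub
  have hGamma : 0 < Real.Gamma (γ + j + 1) :=
    Gamma_pos_of_pos (by linarith [(a : ℕ).cast_nonneg (α := ℝ)])
  have hGamma_sub : 0 < Real.Gamma (γ + j + 1 - a) := Gamma_pos_of_pos hsub
  calc ∑ q, binomialToeplitz γ k a q *
        ((j.choose q : ℝ) * (j.choose b) * x ^ (j - b) / Real.Gamma (γ + j + 1))
      = (∑ q, binomialToeplitz γ k a q * (j.choose q : ℝ)) *
          ((j.choose b) * x ^ (j - b) / Real.Gamma (γ + j + 1)) := by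
        rw [Finset.sum_mul]
        exact Finset.sum_congr rfl fun q _ => by ring
    _ = _ := by
        rw [sum_binomialToeplitz_mul_choose, mul_div_assoc', div_eq_div_iff hGamma.ne'
          (mul_pos (by positivity) hGamma_sub).ne', ← hchoose]
        ring

theorem det_dualKernel (hγ : (k : ℝ) < γ + 1) (M : ℕ) (u : ℂ) :
    (dualKernel (fun j => Real.Gamma (γ + j + 1)) k M u).det =
      (((chargeKernel γ k M (‖u‖ ^ 2)).det : ℝ) : ℂ) := by
  rw [det_dualKernel_eq_det_binomialKernel, ← binomialToeplitz_mul_binomialKernel hγ, det_mul,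
    det_binomialToeplitz, one_mul]

end ChargeKernel

section BetaIntegral

open Matrix

lemma ofReal_one_sub_rpow_mul_pow (c : ℝ) (m : ℕ) : Set.EqOn
    (fun s : ℝ => (s : ℂ) ^ (((m : ℂ) + 1) - 1) * (1 - (s : ℂ)) ^ ((c : ℂ) - 1))
    (fun s : ℝ => (((1 - s) ^ (c - 1) * s ^ m : ℝ) : ℂ)) (Set.Ioc 0 1) := fun s hs => by
  simp only [add_sub_cancel_right, Complex.cpow_natCast, Complex.ofReal_mul, Complex.ofReal_pow]
  rw [Complex.ofReal_cpow (sub_nonneg.2 hs.2)]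
  push_cast
  ring

lemma integrableOn_one_sub_rpow_mul_pow {c : ℝ} (hc : 0 < c) (m : ℕ) :
    IntegrableOn (fun s : ℝ => (1 - s) ^ (c - 1) * s ^ m) (Set.Ioc 0 1) := by
  have h := Complex.betaIntegral_convergent (u := (m : ℂ) + 1) (v := (c : ℂ))
    (by simpa using (by positivity : (0 : ℝ) < m + 1)) (by simpa using hc)
  rw [intervalIntegrable_iff_integrableOn_Ioc_of_le zero_le_one,
    integrableOn_congr_fun (ofReal_one_sub_rpow_mul_pow c m) measurableSet_Ioc] at h
  exact h.re

lemma integral_one_sub_rpow_mul_pow {c : ℝ} (hc : 0 < c) (m : ℕ) :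
    ∫ s in Set.Ioc (0 : ℝ) 1, (1 - s) ^ (c - 1) * s ^ m =
      Real.Gamma c * m.factorial / Real.Gamma (c + m + 1) := by
  have hbeta := Complex.betaIntegral_eq_Gamma_mul_div ((m : ℂ) + 1) (c : ℂ)
    (by simpa using (by positivity : (0 : ℝ) < m + 1)) (by simpa using hc)
  have hsum : ((m : ℂ) + 1) + c = ((c + m + 1 : ℝ) : ℂ) := by push_cast; ring
  rw [Complex.betaIntegral, intervalIntegral.integral_of_le zero_le_one,
    setIntegral_congr_fun measurableSet_Ioc (ofReal_one_sub_rpow_mul_pow c m),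
    integral_complex_ofReal, hsum, Complex.Gamma_ofReal, Complex.Gamma_ofReal,
    Complex.Gamma_nat_eq_factorial, mul_comm (m.factorial : ℂ)] at hbeta
  exact_mod_cast hbeta

/-- The functions of `s` whose integrals against `expColumn` are the entries of `limitKernel`, as
a family indexed by the rows. -/
noncomputable def betaRow (γ : ℝ) (a : ℕ) (s : ℝ) : ℝ :=
  (1 - s) ^ (γ - a - 1) / (a.factorial * Real.Gamma (γ - a))

/-- The functions of `s` whose integrals against `betaRow` are the entries of `limitKernel`, as
a family indexed by the columns. -/
noncomputable def expColumn (x : ℝ) (b : ℕ) (s : ℝ) : ℝ := s ^ b * rexp (x * s) / b.factorial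

section BetaRow

variable {γ : ℝ} {a : ℕ}

lemma integral_betaRow_mul_pow (ha : (a : ℝ) < γ) (n : ℕ) :
    ∫ s in Set.Ioc (0 : ℝ) 1, betaRow γ a s * s ^ n =
      n.factorial / (a.factorial * Real.Gamma (γ + n + 1 - a)) := by
  have hGamma : 0 < Real.Gamma (γ - a) := Gamma_pos_of_pos (sub_pos.2 ha)
  have harg : γ + n + 1 - a = γ - a + n + 1 := by ring
  simp only [betaRow, div_mul_eq_mul_div]
  rw [integral_div, integral_one_sub_rpow_mul_pow (sub_pos.2 ha), harg]
  field_simp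

lemma integrableOn_betaRow_mul_pow (ha : (a : ℝ) < γ) (n : ℕ) :
    IntegrableOn (fun s => betaRow γ a s * s ^ n) (Set.Ioc 0 1) := by
  simp only [betaRow, div_mul_eq_mul_div]
  exact (integrableOn_one_sub_rpow_mul_pow (sub_pos.2 ha) n).div_const _

lemma betaRow_nonneg (ha : (a : ℝ) < γ) {s : ℝ} (hs : s ≤ 1) : 0 ≤ betaRow γ a s :=
  div_nonneg (rpow_nonneg (sub_nonneg.2 hs) _)
    (mul_nonneg (Nat.cast_nonneg _) (Gamma_pos_of_pos (sub_pos.2 ha)).le)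

@[fun_prop]
lemma measurable_betaRow (γ : ℝ) (a : ℕ) : Measurable (betaRow γ a) := by
  unfold betaRow
  fun_prop

lemma sum_choose_mul_pow_div_Gamma (ha : (a : ℝ) < γ) (b M : ℕ) (x : ℝ) :
    ∑ j ∈ Finset.range (b + M), (j.choose b : ℝ) * x ^ (j - b) /
        (a.factorial * Real.Gamma (γ + j + 1 - a)) =
      ∫ s in Set.Ioc (0 : ℝ) 1, betaRow γ a s *
        (s ^ b * (∑ m ∈ Finset.range M, (x * s) ^ m / m.factorial) / b.factorial) := by
  have hexpand : ∀ s : ℝ, betaRow γ a s *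
        (s ^ b * (∑ m ∈ Finset.range M, (x * s) ^ m / m.factorial) / b.factorial) =
      ∑ m ∈ Finset.range M, x ^ m / (b.factorial * m.factorial) *
        (betaRow γ a s * s ^ (b + m)) := fun s => by
    rw [Finset.mul_sum, Finset.sum_div, Finset.mul_sum]
    refine Finset.sum_congr rfl fun m _ => ?_
    rw [mul_pow, pow_add]
    field_simp
  have hlow : ∑ j ∈ Finset.range b, (j.choose b : ℝ) * x ^ (j - b) /
      (a.factorial * Real.Gamma (γ + j + 1 - a)) = 0 :=
    Finset.sum_eq_zero fun j hj => by simp [Nat.choose_eq_zero_of_lt (Finset.mem_range.1 hj)]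
  simp only [hexpand]
  rw [integral_finsetSum _ fun m _ => (integrableOn_betaRow_mul_pow ha (b + m)).const_mul _,
    Finset.sum_range_add, hlow, zero_add]
  refine Finset.sum_congr rfl fun m _ => ?_
  rw [integral_const_mul, integral_betaRow_mul_pow ha, Nat.add_sub_cancel_left,
    ← Nat.add_choose_mul_factorial_mul_factorial b m, ← Nat.choose_symm_add]
  push_cast
  field_simp

lemma norm_betaRow_mul_pow_mul_le (ha : (a : ℝ) < γ) (b : ℕ) {y C s : ℝ} (hy : |y| ≤ C)
    (hs : s ∈ Set.Ioc (0 : ℝ) 1) :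
    ‖betaRow γ a s * (s ^ b * y / b.factorial)‖ ≤
      C / b.factorial * (betaRow γ a s * s ^ b) := by
  have hnonneg : 0 ≤ betaRow γ a s * s ^ b :=
    mul_nonneg (betaRow_nonneg ha hs.2) (pow_nonneg hs.1.le b)
  calc ‖betaRow γ a s * (s ^ b * y / b.factorial)‖
      = |y| / b.factorial * (betaRow γ a s * s ^ b) := by
        rw [mul_div_assoc', ← mul_assoc, norm_div, norm_mul, norm_of_nonneg hnonneg,
          norm_natCast, norm_eq_abs]
        ring
    _ ≤ C / b.factorial * (betaRow γ a s * s ^ b) := by gcongr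

lemma tendsto_integral_betaRow_mul {ι : Type*} {l : Filter ι} [l.IsCountablyGenerated]
    (ha : (a : ℝ) < γ) (b : ℕ) {h : ι → ℝ → ℝ} {h₀ : ℝ → ℝ} {C : ℝ}
    (hm : ∀ p, Measurable (h p)) (hC : ∀ᶠ p in l, ∀ s ∈ Set.Ioc (0 : ℝ) 1, |h p s| ≤ C)
    (hl : ∀ s ∈ Set.Ioc (0 : ℝ) 1, Tendsto (fun p => h p s) l (𝓝 (h₀ s))) :
    Tendsto (fun p => ∫ s in Set.Ioc (0 : ℝ) 1, betaRow γ a s * (s ^ b * h p s / b.factorial)) l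
      (𝓝 (∫ s in Set.Ioc (0 : ℝ) 1, betaRow γ a s * (s ^ b * h₀ s / b.factorial))) := by
  refine tendsto_integral_filter_of_dominated_convergence
    (fun s => C / b.factorial * (betaRow γ a s * s ^ b))
    (Eventually.of_forall fun p => ?_) ?_ ((integrableOn_betaRow_mul_pow ha b).const_mul _) ?_
  · have := hm p
    exact Measurable.aestronglyMeasurable (by fun_prop)
  · filter_upwards [hC] with p hp
    filter_upwards [ae_restrict_mem measurableSet_Ioc] with s hs
    exact norm_betaRow_mul_pow_mul_le ha b (hp s hs) hs
  · filter_upwards [ae_restrict_mem measurableSet_Ioc] with s hs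
    exact (((hl s hs).const_mul _).div_const _).const_mul _

lemma abs_mul_le_of_mem_Ioc (x : ℝ) {s : ℝ} (hs : s ∈ Set.Ioc (0 : ℝ) 1) : |x * s| ≤ |x| := by
  rw [abs_mul, abs_of_pos hs.1]
  exact mul_le_of_le_one_right (abs_nonneg x) hs.2

lemma abs_exp_mul_le_of_mem_Ioc (x : ℝ) {s : ℝ} (hs : s ∈ Set.Ioc (0 : ℝ) 1) :
    |rexp (x * s)| ≤ rexp |x| := by
  rw [abs_exp]
  exact exp_le_exp.2 ((le_abs_self _).trans (abs_mul_le_of_mem_Ioc x hs))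

lemma eventually_abs_le_abs_add_one (x : ℝ) : ∀ᶠ y in 𝓝 x, |y| ≤ |x| + 1 :=
  (continuous_abs.tendsto x).eventually_le_const (lt_add_one |x|)

lemma integrableOn_betaRow_mul_expColumn (ha : (a : ℝ) < γ) (x : ℝ) (b : ℕ) :
    IntegrableOn (fun s => betaRow γ a s * expColumn x b s) (Set.Ioc 0 1) := by
  refine Integrable.mono' ((integrableOn_betaRow_mul_pow ha b).const_mul (rexp |x| / b.factorial))
    (Measurable.aestronglyMeasurable (by unfold expColumn; fun_prop)) ?_
  filter_upwards [ae_restrict_mem measurableSet_Ioc] with s hs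
  exact norm_betaRow_mul_pow_mul_le ha b (abs_exp_mul_le_of_mem_Ioc x hs) hs

end BetaRow

lemma tendsto_sum_pow_div_factorial (y : ℝ) :
    Tendsto (fun p : ℕ × ℝ => ∑ m ∈ Finset.range p.1, p.2 ^ m / m.factorial)
      (atTop ×ˢ 𝓝 y) (𝓝 (rexp y)) := by
  have huniform := tendstoUniformlyOn_tsum_nat (f := fun (m : ℕ) (x : ℝ) => x ^ m / m.factorial)
    (summable_pow_div_factorial (|y| + 1)) (s := {x | |x| ≤ |y| + 1}) (fun m x hx => by
      rw [norm_div, norm_pow, norm_natCast, norm_eq_abs]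
      gcongr
      exact hx)
  have hexp : ∀ x : ℝ, ∑' m : ℕ, x ^ m / m.factorial = rexp x := fun x => by
    rw [exp_eq_exp_ℝ, NormedSpace.exp_eq_tsum_div]
  simp only [hexp] at huniform
  exact tendsto_comp_of_locally_uniform_limit (F := fun (p : ℕ × ℝ) (x : ℝ) =>
    ∑ m ∈ Finset.range p.1, x ^ m / (m.factorial : ℝ)) (f := rexp) (g := fun p : ℕ × ℝ => p.2)
    continuous_exp.continuousAt tendsto_snd fun v hv =>
      ⟨_, eventually_abs_le_abs_add_one y, (huniform v hv).prod_inl _⟩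

lemma abs_sum_pow_div_factorial_le (y : ℝ) (M : ℕ) :
    |∑ m ∈ Finset.range M, y ^ m / m.factorial| ≤ rexp |y| :=
  calc |∑ m ∈ Finset.range M, y ^ m / m.factorial|
      ≤ ∑ m ∈ Finset.range M, |y ^ m / m.factorial| := Finset.abs_sum_le_sum_abs _ _
    _ = ∑ m ∈ Finset.range M, |y| ^ m / m.factorial :=
        Finset.sum_congr rfl fun m _ => by rw [abs_div, abs_pow, Nat.abs_cast]
    _ ≤ rexp |y| := sum_le_exp_of_nonneg (abs_nonneg _) _

/-- The limit of `chargeKernel` as the truncation is removed. -/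
noncomputable def limitKernel (γ : ℝ) (k : ℕ) (x : ℝ) : Matrix (Fin k) (Fin k) ℝ :=
  of fun a b => ∫ s in Set.Ioc (0 : ℝ) 1, betaRow γ a s * expColumn x b s

variable {γ : ℝ} {k : ℕ}

lemma continuous_det_limitKernel (hγ : (k : ℝ) < γ + 1) :
    Continuous fun x => (limitKernel γ k x).det := by
  refine Continuous.matrix_det (continuous_matrix fun a b => ?_)
  refine continuous_iff_continuousAt.2 fun x => ?_
  simp only [limitKernel, of_apply, expColumn]
  refine tendsto_integral_betaRow_mul (val_lt_of_natCast_lt_add_one hγ a) b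
    (h := fun x s => rexp (x * s)) (C := rexp (|x| + 1)) (fun p => by fun_prop) ?_ fun s _ => ?_
  · filter_upwards [eventually_abs_le_abs_add_one x] with y hy s hs
    exact (abs_exp_mul_le_of_mem_Ioc y hs).trans (exp_le_exp.2 hy)
  · exact Continuous.tendsto (by fun_prop) x

lemma tendsto_chargeKernel_apply (hγ : (k : ℝ) < γ + 1) (x : ℝ) (a b : Fin k) :
    Tendsto (fun p : ℕ × ℝ => chargeKernel γ k (k + p.1) p.2 a b) (atTop ×ˢ 𝓝 x)
      (𝓝 (limitKernel γ k x a b)) := by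
  have ha := val_lt_of_natCast_lt_add_one hγ a
  have hsplit : ∀ M, k + M = (b : ℕ) + (k - b + M) := fun M => by lia
  have hintegral : ∀ p : ℕ × ℝ, chargeKernel γ k (k + p.1) p.2 a b =
      ∫ s in Set.Ioc (0 : ℝ) 1, betaRow γ a s * (s ^ (b : ℕ) *
        (∑ m ∈ Finset.range (k - b + p.1), (p.2 * s) ^ m / m.factorial) /
          (b : ℕ).factorial) := fun p => by
    rw [chargeKernel, of_apply, hsplit, sum_choose_mul_pow_div_Gamma ha]
  simp only [hintegral, limitKernel, of_apply, expColumn]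
  refine tendsto_integral_betaRow_mul ha b (h := fun (p : ℕ × ℝ) s =>
    ∑ m ∈ Finset.range (k - b + p.1), (p.2 * s) ^ m / m.factorial) (h₀ := fun s => rexp (x * s))
    (C := rexp (|x| + 1)) (fun p => by fun_prop) ?_ fun s _ => ?_
  · filter_upwards [tendsto_snd.eventually (eventually_abs_le_abs_add_one x)] with p hp s hs
    exact (abs_sum_pow_div_factorial_le _ _).trans
      (exp_le_exp.2 ((abs_mul_le_of_mem_Ioc p.2 hs).trans hp))
  · exact (tendsto_sum_pow_div_factorial (x * s)).comp
      (f := fun p : ℕ × ℝ => (k - b + p.1, p.2 * s))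
      ((tendsto_atTop_mono (fun p => Nat.le_add_left _ _) tendsto_fst).prodMk
        (tendsto_snd.mul_const s))

theorem tendsto_det_chargeKernel (hγ : (k : ℝ) < γ + 1) (x : ℝ) :
    Tendsto (fun p : ℕ × ℝ => (chargeKernel γ k (k + p.1) p.2).det) (atTop ×ˢ 𝓝 x)
      (𝓝 (limitKernel γ k x).det) :=
  ((continuous_id.matrix_det).tendsto (limitKernel γ k x)).comp
    (tendsto_pi_nhds.2 fun a => tendsto_pi_nhds.2 fun b => tendsto_chargeKernel_apply hγ x a b)

end BetaIntegral

section LimitKernel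

open Matrix

/-- The weight on `(0, 1)^k` whose integral is, for `α = γ - k`, a multiple of
`(limitKernel γ k x).det`; the substitution `s = 1 - t / x` turns it into `lueWeight k α t`. -/
noncomputable def jacobiWeight (α : ℝ) (k : ℕ) (x : ℝ) (s : Fin k → ℝ) : ℝ :=
  (∏ i, (1 - s i) ^ α * rexp (x * s i)) * (∏ i, ∏ j ∈ Finset.Ioi i, (s j - s i)) ^ 2

/-- The product of the denominators in the rows `betaRow γ a` and the columns `expColumn x b`. -/
noncomputable def limitConst (γ : ℝ) (k : ℕ) : ℝ :=
  ∏ a : Fin k, ((a : ℕ).factorial * Real.Gamma (γ - a) * (a : ℕ).factorial)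

variable {α γ : ℝ} {k : ℕ}

lemma limitConst_pos (hγ : (k : ℝ) < γ + 1) : 0 < limitConst γ k :=
  Finset.prod_pos fun a _ => by
    have := Gamma_pos_of_pos (sub_pos.2 (val_lt_of_natCast_lt_add_one hγ a))
    positivity

lemma det_betaRow (γ : ℝ) {s : Fin k → ℝ} (hs : ∀ i, s i < 1) :
    (of fun a i : Fin k => betaRow γ a (s i)).det =
      (∏ a : Fin k, ((a : ℕ).factorial * Real.Gamma (γ - a))⁻¹) * ((∏ i, (1 - s i) ^ (γ - k)) *
        ∏ i, ∏ j ∈ Finset.Ioi i, (s j - s i)) := by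
  have hvandermonde : ∏ i, ∏ j ∈ Finset.Ioi i, (s j - s i) =
      (projVandermonde (fun _ => 1) fun i => 1 - s i)ᵀ.det := by
    rw [det_transpose, det_projVandermonde]
    exact Finset.prod_congr rfl fun i _ => Finset.prod_congr rfl fun j _ => by ring
  rw [hvandermonde, ← det_mul_row, ← det_mul_column]
  congr 1
  ext a i
  have hexponent : γ - (a : ℕ) - 1 = (γ - k) + ((Fin.rev a : ℕ) : ℝ) := by
    rw [Fin.val_rev, Nat.cast_sub (by lia)]
    push_cast
    ring
  simp only [of_apply, transpose_apply, projVandermonde_apply, one_pow, one_mul, betaRow]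
  rw [hexponent, rpow_add (sub_pos.2 (hs i)), rpow_natCast, div_eq_inv_mul]

lemma det_expColumn (x : ℝ) (s : Fin k → ℝ) :
    (of fun b i : Fin k => expColumn x b (s i)).det =
      (∏ b : Fin k, ((b : ℕ).factorial : ℝ)⁻¹) * ((∏ i, rexp (x * s i)) *
        ∏ i, ∏ j ∈ Finset.Ioi i, (s j - s i)) := by
  rw [← det_vandermonde, ← det_transpose (vandermonde s), ← det_mul_row, ← det_mul_column]
  congr 1
  ext b i
  simp only [of_apply, transpose_apply, vandermonde_apply, expColumn]
  ring

lemma det_betaRow_mul_det_expColumn (γ x : ℝ) {s : Fin k → ℝ} (hs : ∀ i, s i < 1) :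
    (of fun a i : Fin k => betaRow γ a (s i)).det *
      (of fun b i : Fin k => expColumn x b (s i)).det =
        (limitConst γ k)⁻¹ * jacobiWeight (γ - k) k x s := by
  rw [det_betaRow γ hs, det_expColumn, limitConst, jacobiWeight, ← Finset.prod_inv_distrib,
    mul_mul_mul_comm, ← Finset.prod_mul_distrib, mul_mul_mul_comm, ← Finset.prod_mul_distrib, ← sq]
  congr 1
  exact Finset.prod_congr rfl fun a _ => by rw [mul_inv (_ * _)]

lemma ae_mem_Ioo_pi_restrict_Ioc (k : ℕ) :
    ∀ᵐ s ∂(Measure.pi fun _ : Fin k => volume.restrict (Set.Ioc (0 : ℝ) 1)),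
      ∀ i, s i ∈ Set.Ioo (0 : ℝ) 1 := by
  rw [← Measure.restrict_congr_set (Ioo_ae_eq_Ioc (α := ℝ)), ← Measure.restrict_pi_pi]
  filter_upwards [ae_restrict_mem (MeasurableSet.univ_pi fun _ => measurableSet_Ioo)] with s hs i
  exact hs i (Set.mem_univ i)

lemma integrable_jacobiWeight (hγ : (k : ℝ) < γ + 1) (x : ℝ) :
    Integrable (jacobiWeight (γ - k) k x)
      (Measure.pi fun _ : Fin k => volume.restrict (Set.Ioc (0 : ℝ) 1)) := by
  have hdet := integrable_det_mul_det (μ := volume.restrict (Set.Ioc (0 : ℝ) 1))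
    (f := fun a : Fin k => betaRow γ a) (g := fun b : Fin k => expColumn x b)
    fun a b => integrableOn_betaRow_mul_expColumn (val_lt_of_natCast_lt_add_one hγ a) x b
  refine (hdet.const_mul (limitConst γ k)).congr ?_
  filter_upwards [ae_mem_Ioo_pi_restrict_Ioc k] with s hs
  rw [det_betaRow_mul_det_expColumn γ x fun i => (hs i).2,
    mul_inv_cancel_left₀ (limitConst_pos hγ).ne']

lemma det_limitKernel (hγ : (k : ℝ) < γ + 1) (x : ℝ) :
    (limitKernel γ k x).det = (k.factorial * limitConst γ k)⁻¹ *
      ∫ s, jacobiWeight (γ - k) k x s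
        ∂(Measure.pi fun _ : Fin k => volume.restrict (Set.Ioc (0 : ℝ) 1)) := by
  have handreief := integral_det_mul_det (μ := volume.restrict (Set.Ioc (0 : ℝ) 1))
    (f := fun a : Fin k => betaRow γ a) (g := fun b : Fin k => expColumn x b)
    fun a b => integrableOn_betaRow_mul_expColumn (val_lt_of_natCast_lt_add_one hγ a) x b
  have hweight : ∀ᵐ s ∂(Measure.pi fun _ : Fin k => volume.restrict (Set.Ioc (0 : ℝ) 1)),
      (of fun a i : Fin k => betaRow γ a (s i)).det *
        (of fun b i : Fin k => expColumn x b (s i)).det =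
          (limitConst γ k)⁻¹ * jacobiWeight (γ - k) k x s := by
    filter_upwards [ae_mem_Ioo_pi_restrict_Ioc k] with s hs
    exact det_betaRow_mul_det_expColumn γ x fun i => (hs i).2
  rw [integral_congr_ae hweight, integral_const_mul, Fintype.card_fin] at handreief
  rw [mul_inv, mul_assoc, handreief]
  exact (inv_mul_cancel_left₀ (by positivity) _).symm

lemma jacobiWeight_nonneg (α x : ℝ) {s : Fin k → ℝ} (hs : ∀ i, s i ≤ 1) :
    0 ≤ jacobiWeight α k x s :=
  mul_nonneg (Finset.prod_nonneg fun i _ =>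
    mul_nonneg (rpow_nonneg (sub_nonneg.2 (hs i)) _) (exp_pos _).le) (sq_nonneg _)

lemma jacobiWeight_pos (α x : ℝ) {s : Fin k → ℝ} (hs : ∀ i, s i < 1) (hmono : StrictMono s) :
    0 < jacobiWeight α k x s :=
  mul_pos (Finset.prod_pos fun i _ => mul_pos (rpow_pos_of_pos (sub_pos.2 (hs i)) _) (exp_pos _))
    (pow_pos (Finset.prod_pos fun _ _ => Finset.prod_pos fun _ hj =>
      sub_pos.2 (hmono (Finset.mem_Ioi.1 hj))) 2)

lemma pi_restrict_Ioc_strictMono_pos (k : ℕ) :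
    0 < (Measure.pi fun _ : Fin k => volume.restrict (Set.Ioc (0 : ℝ) 1))
      {s | (∀ i, s i < 1) ∧ StrictMono s} := by
  set cell : Fin k → Set ℝ := fun i =>
    Set.Ioo (((i : ℕ) : ℝ) / k) (((i : ℕ) + 1 : ℝ) / k) with hcell
  have hk : Fin k → (0 : ℝ) < k := fun i => Nat.cast_pos.2 i.pos
  have hle_one : ∀ i : Fin k, ((i : ℕ) + 1 : ℝ) / k ≤ 1 := fun i => by
    rw [div_le_one (hk i)]
    exact_mod_cast i.2
  have hsubset : Set.univ.pi cell ⊆ {s | (∀ i, s i < 1) ∧ StrictMono s} := fun s hs => by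
    refine ⟨fun i => (hs i (Set.mem_univ i)).2.trans_le (hle_one i), fun i j hij => ?_⟩
    have hsucc : ((i : ℕ) + 1 : ℝ) ≤ (j : ℕ) := by exact_mod_cast hij
    exact (hs i (Set.mem_univ i)).2.trans
      ((div_le_div_of_nonneg_right hsucc (hk i).le).trans_lt (hs j (Set.mem_univ j)).1)
  refine lt_of_lt_of_le (pos_iff_ne_zero.2 ?_) (measure_mono hsubset)
  rw [Measure.pi_pi]
  refine Finset.prod_ne_zero_iff.2 fun i _ => ?_
  have hcell_subset : cell i ⊆ Set.Ioc 0 1 := fun x hx =>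
    ⟨lt_of_le_of_lt (by positivity) hx.1, hx.2.le.trans (hle_one i)⟩
  rw [Measure.restrict_apply measurableSet_Ioo, Set.inter_eq_left.2 hcell_subset, hcell, volume_Ioo]
  have := hk i
  exact (ENNReal.ofReal_pos.2 (sub_pos.2 (by gcongr; exact lt_add_one _))).ne'

lemma det_limitKernel_pos (hγ : (k : ℝ) < γ + 1) (x : ℝ) : 0 < (limitKernel γ k x).det := by
  rw [det_limitKernel hγ]
  refine mul_pos (inv_pos.2 (mul_pos (by positivity) (limitConst_pos hγ))) ?_
  rw [integral_pos_iff_support_of_nonneg_ae ?_ (integrable_jacobiWeight hγ x)]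
  · exact (pi_restrict_Ioc_strictMono_pos k).trans_le
      (measure_mono fun s hs => (jacobiWeight_pos _ x hs.1 hs.2).ne')
  · filter_upwards [ae_mem_Ioo_pi_restrict_Ioc k] with s hs
    exact jacobiWeight_nonneg _ x fun i => (hs i).2.le

lemma sq_prod_prod_Ioi_const_mul (c : ℝ) (t : Fin k → ℝ) :
    (∏ i, ∏ j ∈ Finset.Ioi i, c * (t j - t i)) ^ 2 =
      c ^ (k * (k - 1)) * (∏ i, ∏ j ∈ Finset.Ioi i, (t j - t i)) ^ 2 := by
  have hcard : (∑ i : Fin k, (Finset.Ioi i).card) * 2 = k * (k - 1) := by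
    simp only [Fin.card_Ioi]
    rw [← Finset.sum_range (fun i => k - 1 - i), Finset.sum_range_reflect (fun i => i),
      Finset.sum_range_id_mul_two]
  simp only [Finset.prod_mul_distrib, Finset.prod_const, Finset.prod_pow_eq_pow_sum]
  rw [mul_pow, ← pow_mul, hcard]

lemma jacobiWeight_one_sub_smul (α : ℝ) {x : ℝ} (hx : 0 < x) {t : Fin k → ℝ} (ht : ∀ i, 0 ≤ t i) :
    jacobiWeight α k x (1 - x⁻¹ • t) =
      (x ^ (-(α * k)) * x⁻¹ ^ (k * (k - 1))) * rexp (k * x) * lueWeight k α t := by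
  have hfactor : ∀ i, (1 - (1 - x⁻¹ • t) i) ^ α * rexp (x * (1 - x⁻¹ • t) i) =
      (x ^ (-α) * rexp x) * (t i ^ α * rexp (-t i)) := fun i => by
    simp only [Pi.sub_apply, Pi.one_apply, Pi.smul_apply, smul_eq_mul, sub_sub_cancel]
    rw [mul_rpow (by positivity) (ht i), inv_rpow hx.le, rpow_neg hx.le, mul_sub, mul_one,
      mul_inv_cancel_left₀ hx.ne', sub_eq_add_neg x, Real.exp_add]
    ring
  have hdiff : ∀ i j, (1 - x⁻¹ • t) j - (1 - x⁻¹ • t) i = -x⁻¹ * (t j - t i) := fun i j => by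
    simp only [Pi.sub_apply, Pi.one_apply, Pi.smul_apply, smul_eq_mul]
    ring
  rw [jacobiWeight, lueWeight]
  simp only [hfactor, hdiff]
  rw [sq_prod_prod_Ioi_const_mul, (Nat.even_mul_pred_self k).neg_pow, Finset.prod_mul_distrib,
    Finset.prod_const, Finset.card_univ, Fintype.card_fin, mul_pow, ← rpow_natCast (x ^ (-α)),
    ← rpow_mul hx.le, neg_mul, ← Real.exp_nat_mul]
  ring

lemma setIntegral_pi_Ioc_eq_setIntegral_pi_Ico {E : Type*} [NormedAddCommGroup E] [NormedSpace ℝ E]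
    (f : (Fin k → ℝ) → E) {x : ℝ} (hx : 0 < x) :
    ∫ s in Set.univ.pi fun _ : Fin k => Set.Ioc (0 : ℝ) 1, f s =
      (x⁻¹ ^ k) • ∫ t in Set.univ.pi fun _ : Fin k => Set.Ico 0 x, f (1 - x⁻¹ • t) := by
  have hmem : ∀ t : Fin k → ℝ, t ∈ Set.univ.pi (fun _ : Fin k => Set.Ico (0 : ℝ) x) ↔
      (1 - x⁻¹ • t) ∈ Set.univ.pi fun _ : Fin k => Set.Ioc (0 : ℝ) 1 := fun t => by
    refine forall₂_congr fun i _ => ?_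
    simp only [Pi.sub_apply, Pi.one_apply, Pi.smul_apply, smul_eq_mul, Set.mem_Ioc, Set.mem_Ico,
      sub_pos, inv_mul_lt_iff₀ hx, mul_one, sub_le_self_iff]
    rw [and_comm, mul_nonneg_iff_of_pos_left (inv_pos.2 hx)]
  have hindicator : ∀ t : Fin k → ℝ,
      (Set.univ.pi fun _ : Fin k => Set.Ico (0 : ℝ) x).indicator (fun t => f (1 - x⁻¹ • t)) t =
        (Set.univ.pi fun _ : Fin k => Set.Ioc (0 : ℝ) 1).indicator f (1 - x⁻¹ • t) := fun t => by
    by_cases ht : t ∈ Set.univ.pi fun _ : Fin k => Set.Ico (0 : ℝ) x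
    · rw [Set.indicator_of_mem ht, Set.indicator_of_mem ((hmem t).1 ht)]
    · rw [Set.indicator_of_notMem ht, Set.indicator_of_notMem fun h => ht ((hmem t).2 h)]
  rw [← integral_indicator (MeasurableSet.univ_pi fun _ => measurableSet_Ico),
    ← integral_indicator (MeasurableSet.univ_pi fun _ => measurableSet_Ioc)]
  simp only [hindicator]
  rw [Measure.integral_comp_smul volume (fun t : Fin k → ℝ =>
      (Set.univ.pi fun _ : Fin k => Set.Ioc (0 : ℝ) 1).indicator f (1 - t)) x⁻¹,
    integral_sub_left_eq_self _ volume (1 : Fin k → ℝ), Module.finrank_fin_fun, smul_smul,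
    abs_of_pos (by positivity), mul_inv_cancel₀ (by positivity), one_smul]

lemma integral_jacobiWeight (α : ℝ) (k : ℕ) {x : ℝ} (hx : 0 < x) :
    ∫ s, jacobiWeight α k x s
        ∂(Measure.pi fun _ : Fin k => volume.restrict (Set.Ioc (0 : ℝ) 1)) =
      x ^ (-((α + k) * k)) * rexp (k * x) *
        ∫ t in Set.univ.pi fun _ : Fin k => Set.Ico 0 x, lueWeight k α t := by
  have hpow : x⁻¹ ^ k * (x ^ (-(α * k)) * x⁻¹ ^ (k * (k - 1))) = x ^ (-((α + k) * k)) := by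
    have hsquare : k + k * (k - 1) = k * k := by
      cases k with
      | zero => rfl
      | succ n => rw [Nat.add_sub_cancel]; ring
    rw [mul_left_comm, ← pow_add, hsquare, inv_pow, ← rpow_natCast, ← rpow_neg hx.le, ← rpow_add hx]
    congr 1
    push_cast
    ring
  rw [← Measure.restrict_pi_pi, ← volume_pi, setIntegral_pi_Ioc_eq_setIntegral_pi_Ico _ hx,
    setIntegral_congr_fun (MeasurableSet.univ_pi fun _ => measurableSet_Ico)
      fun t ht => jacobiWeight_one_sub_smul α hx fun i => (ht i (Set.mem_univ i)).1,
    integral_const_mul, smul_eq_mul, ← hpow]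
  ring

end LimitKernel

section Laguerre

open Matrix

variable {k : ℕ} {α : ℝ}

lemma Gamma_add_natCast {z : ℝ} (hz : 0 < z) : ∀ n : ℕ,
    Real.Gamma (z + n) = Real.Gamma z * (ascPochhammer ℝ n).eval z
  | 0 => by simp
  | n + 1 => by
    rw [ascPochhammer_succ_eval, ← mul_assoc, ← Gamma_add_natCast hz n, Nat.cast_succ, ← add_assoc,
      Real.Gamma_add_one (by positivity), mul_comm]

lemma det_vandermonde_natCast_add (k : ℕ) (c : ℝ) :
    (vandermonde fun a : Fin k => (a : ℝ) + c).det = ∏ a : Fin k, ((a : ℕ).factorial : ℝ) := by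
  rw [det_vandermonde_add]
  cases k with
  | zero => simp
  | succ n =>
    rw [det_vandermonde_id_eq_superFactorial, ← Nat.prod_range_succ_factorial, Finset.prod_range]
    exact Nat.cast_prod _ _

lemma det_Gamma_add_add (k : ℕ) (hα : -1 < α) :
    (of fun a b : Fin k => Real.Gamma (α + a + b + 1)).det =
      ∏ a : Fin k, Real.Gamma (α + a + 1) * (a : ℕ).factorial := by
  have hpochhammer : (of fun a b : Fin k => Real.Gamma (α + a + b + 1)) =
      of fun a b : Fin k => Real.Gamma (α + a + 1) * (of fun a b : Fin k =>
        (ascPochhammer ℝ b).eval ((a : ℝ) + (α + 1))) a b := by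
    ext a b
    have hpos : 0 < α + a + 1 := by linarith [(a : ℕ).cast_nonneg (α := ℝ)]
    rw [of_apply, of_apply, of_apply, add_right_comm _ _ 1, Gamma_add_natCast hpos,
      add_comm α, add_assoc]
  rw [hpochhammer, det_mul_column, ← det_eval_matrixOfPolynomials_eq_det_vandermonde _ _
    (fun i => ascPochhammer_natDegree _ _) (fun i => monic_ascPochhammer _ _),
    det_vandermonde_natCast_add, Finset.prod_mul_distrib]

lemma det_mul_det_eq_lueWeight (α : ℝ) (t : Fin k → ℝ) :
    (of fun a i : Fin k => (t i ^ α * rexp (-t i)) * t i ^ (a : ℕ)).det *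
      (of fun b i : Fin k => t i ^ (b : ℕ)).det = lueWeight k α t := by
  have hvandermonde : (of fun b i : Fin k => t i ^ (b : ℕ)).det =
      ∏ i, ∏ j ∈ Finset.Ioi i, (t j - t i) := by
    rw [← det_vandermonde, ← det_transpose (vandermonde t)]
    rfl
  have hrow := det_mul_row (fun i => t i ^ α * rexp (-t i))
    (of fun b i : Fin k => t i ^ (b : ℕ))
  simp only [of_apply] at hrow
  rw [hrow, hvandermonde, lueWeight, mul_assoc, sq]

lemma rpow_mul_exp_neg_mul_pow_mul_pow (α : ℝ) (a b : ℕ) : Set.EqOn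
    (fun t : ℝ => t ^ α * rexp (-t) * t ^ a * t ^ b)
    (fun t : ℝ => rexp (-t) * t ^ ((α + a + b + 1) - 1)) (Set.Ioi 0) := fun t ht => by
  simp only
  rw [add_sub_cancel_right, rpow_add ht, rpow_add ht, rpow_natCast, rpow_natCast]
  ring

lemma integrableOn_laguerre_moment (hα : -1 < α) (a b : ℕ) :
    IntegrableOn (fun t : ℝ => t ^ α * rexp (-t) * t ^ a * t ^ b) (Set.Ici 0) := by
  rw [integrableOn_Ici_iff_integrableOn_Ioi,
    integrableOn_congr_fun (rpow_mul_exp_neg_mul_pow_mul_pow α a b) measurableSet_Ioi]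
  exact GammaIntegral_convergent
    (by linarith [a.cast_nonneg (α := ℝ), b.cast_nonneg (α := ℝ)])

lemma integral_laguerre_moment (hα : -1 < α) (a b : ℕ) :
    ∫ t in Set.Ici (0 : ℝ), t ^ α * rexp (-t) * t ^ a * t ^ b = Real.Gamma (α + a + b + 1) := by
  rw [integral_Ici_eq_integral_Ioi,
    setIntegral_congr_fun measurableSet_Ioi (rpow_mul_exp_neg_mul_pow_mul_pow α a b),
    ← Gamma_eq_integral (by linarith [a.cast_nonneg (α := ℝ), b.cast_nonneg (α := ℝ)])]

lemma setOf_nonneg_eq_pi : {t : Fin k → ℝ | ∀ i, 0 ≤ t i} = Set.univ.pi fun _ => Set.Ici 0 := by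
  ext t
  simp only [Set.mem_ofPred_eq, Set.mem_univ_pi, Set.mem_Ici]

lemma measurableSet_setOf_nonneg : MeasurableSet {t : Fin k → ℝ | ∀ i, 0 ≤ t i} := by
  rw [setOf_nonneg_eq_pi]
  exact MeasurableSet.univ_pi fun _ => measurableSet_Ici

lemma integrableOn_lueWeight (k : ℕ) (hα : -1 < α) :
    IntegrableOn (lueWeight k α) {t : Fin k → ℝ | ∀ i, 0 ≤ t i} := by
  have hdet := integrable_det_mul_det (μ := volume.restrict (Set.Ici (0 : ℝ)))
    (f := fun (a : Fin k) t => t ^ α * rexp (-t) * t ^ (a : ℕ)) (g := fun b t => t ^ (b : ℕ))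
    (fun a b => integrableOn_laguerre_moment hα a b)
  simp only [det_mul_det_eq_lueWeight] at hdet
  rwa [← Measure.restrict_pi_pi, ← volume_pi, ← setOf_nonneg_eq_pi] at hdet

lemma integral_lueWeight (k : ℕ) (hα : -1 < α) :
    ∫ t in {t : Fin k → ℝ | ∀ i, 0 ≤ t i}, lueWeight k α t =
      k.factorial * ∏ a : Fin k, Real.Gamma (α + a + 1) * (a : ℕ).factorial := by
  have handreief := integral_det_mul_det (μ := volume.restrict (Set.Ici (0 : ℝ)))
    (f := fun (a : Fin k) t => t ^ α * rexp (-t) * t ^ (a : ℕ)) (g := fun b t => t ^ (b : ℕ))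
    (fun a b => integrableOn_laguerre_moment hα a b)
  simp only [det_mul_det_eq_lueWeight, integral_laguerre_moment hα, det_Gamma_add_add k hα,
    Fintype.card_fin] at handreief
  rwa [← Measure.restrict_pi_pi, ← volume_pi, ← setOf_nonneg_eq_pi] at handreief

lemma lueWeight_nonneg (α : ℝ) {t : Fin k → ℝ} (ht : ∀ i, 0 ≤ t i) : 0 ≤ lueWeight k α t :=
  mul_nonneg (Finset.prod_nonneg fun i _ => mul_nonneg (rpow_nonneg (ht i) _) (exp_pos _).le)
    (sq_nonneg _)

lemma lueMeasure_apply (hα : -1 < α) {S : Set (Fin k → ℝ)} (hS : MeasurableSet S) :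
    lueMeasure k α S =
      ENNReal.ofReal (∫ t in S ∩ {t | ∀ i, 0 ≤ t i}, lueWeight k α t) := by
  rw [lueMeasure, withDensity_apply _ hS, Measure.restrict_restrict hS,
    ofReal_integral_eq_lintegral_ofReal
      ((integrableOn_lueWeight k hα).mono_set Set.inter_subset_right)]
  filter_upwards [ae_restrict_mem (hS.inter measurableSet_setOf_nonneg)] with t ht
  exact lueWeight_nonneg α ht.2

variable {γ : ℝ}

lemma lueLaw_real_apply (hγ : (k : ℝ) < γ + 1) {S : Set (Fin k → ℝ)} (hS : MeasurableSet S) :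
    (lueLaw k γ).real S =
      (k.factorial * ∏ a : Fin k, Real.Gamma (γ - k + a + 1) * (a : ℕ).factorial)⁻¹ *
        ∫ t in S ∩ {t | ∀ i, 0 ≤ t i}, lueWeight k (γ - k) t := by
  have hα : -1 < γ - k := by linarith
  have hnonneg : ∀ {S : Set (Fin k → ℝ)}, MeasurableSet S →
      0 ≤ ∫ t in S ∩ {t | ∀ i, 0 ≤ t i}, lueWeight k (γ - k) t := fun hS =>
    setIntegral_nonneg (hS.inter measurableSet_setOf_nonneg) fun t ht => lueWeight_nonneg _ ht.2
  rw [lueLaw, measureReal_def, Measure.smul_apply, smul_eq_mul, ENNReal.toReal_mul,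
    ENNReal.toReal_inv, lueMeasure_apply hα hS, lueMeasure_apply hα MeasurableSet.univ,
    ENNReal.toReal_ofReal (hnonneg hS), ENNReal.toReal_ofReal (hnonneg MeasurableSet.univ),
    Set.univ_inter, integral_lueWeight k hα]

lemma lueMaxCDF_eq (hγ : (k : ℝ) < γ + 1) (x : ℝ) :
    lueMaxCDF γ k x =
      (k.factorial * ∏ a : Fin k, Real.Gamma (γ - k + a + 1) * (a : ℕ).factorial)⁻¹ *
      ∫ t in Set.univ.pi fun _ : Fin k => Set.Ico 0 x, lueWeight k (γ - k) t := by
  have hpi : {t : Fin k → ℝ | ∀ i, t i < x} = Set.univ.pi fun _ => Set.Iio x := by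
    ext t
    simp only [Set.mem_ofPred_eq, Set.mem_univ_pi, Set.mem_Iio]
  rw [lueMaxCDF, hpi, lueLaw_real_apply hγ
    (MeasurableSet.univ_pi fun _ => measurableSet_Iio), setOf_nonneg_eq_pi,
    ← Set.pi_inter_distrib]
  simp only [Set.Iio_inter_Ici]

lemma limitConst_eq (γ : ℝ) (k : ℕ) : limitConst γ k =
    (∏ a : Fin k, Real.Gamma (γ - k + a + 1) * (a : ℕ).factorial) *
      ∏ a : Fin k, ((a : ℕ).factorial : ℝ) := by
  have hreflect : ∏ a : Fin k, Real.Gamma (γ - a) = ∏ a : Fin k, Real.Gamma (γ - k + a + 1) := by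
    rw [← Equiv.prod_comp Fin.revPerm]
    refine Finset.prod_congr rfl fun a _ => ?_
    rw [Fin.revPerm_apply, Fin.val_rev, Nat.cast_sub (by lia)]
    push_cast
    congr 1
    ring
  simp only [limitConst, Finset.prod_mul_distrib, hreflect]
  ring

theorem det_limitKernel_eq_lueMaxCDF (hγ : (k : ℝ) < γ + 1) {x : ℝ} (hx : 0 < x) :
    (limitKernel γ k x).det =
      x ^ (-(γ * k)) * rexp (k * x) * lueMaxCDF γ k x / ∏ a : Fin k, ((a : ℕ).factorial : ℝ) := by
  rw [det_limitKernel hγ, integral_jacobiWeight _ _ hx, lueMaxCDF_eq hγ, limitConst_eq,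
    sub_add_cancel]
  simp only [mul_inv]
  ring

end Laguerre

section GammaAsymptotics

lemma abs_log_one_add_div_sub_le (a : ℝ) {n : ℕ} (hn : 0 < n) (h : 2 * |a| ≤ n) :
    |Real.log (1 + a / n) - a / n + a ^ 2 / (2 * n ^ 2)| ≤ 2 * |a| ^ 3 / n ^ 3 := by
  have hn_pos : (0 : ℝ) < n := Nat.cast_pos.2 hn
  have hhalf : |-(a / n)| ≤ 1 / 2 := by
    rw [abs_neg, abs_div, abs_of_pos hn_pos, div_le_iff₀ hn_pos]
    linarith
  have htaylor := Real.abs_log_sub_add_sum_range_le (hhalf.trans_lt one_half_lt_one) 2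
  rw [Finset.sum_range_succ, Finset.sum_range_one, sub_neg_eq_add] at htaylor
  calc _ = |(-(a / n : ℝ)) ^ (0 + 1) / ((0 : ℕ) + 1) + (-(a / n : ℝ)) ^ (1 + 1) / ((1 : ℕ) + 1) +
        Real.log (1 + a / n)| := by
        congr 1
        push_cast
        ring
    _ ≤ |-(a / n : ℝ)| ^ (2 + 1) / (1 - |-(a / n : ℝ)|) := htaylor
    _ ≤ |-(a / n : ℝ)| ^ (2 + 1) / (1 / 2) := by gcongr; linarith
    _ = _ := by
      rw [abs_neg, abs_div, abs_of_pos hn_pos, div_pow]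
      ring

lemma tendsto_sq_mul_log_one_add_div (a : ℝ) :
    Tendsto (fun n : ℕ => (n : ℝ) ^ 2 * (Real.log (1 + a / n) - a / n)) atTop
      (𝓝 (-(a ^ 2 / 2))) := by
  rw [tendsto_iff_norm_sub_tendsto_zero]
  refine squeeze_zero' (g := fun n : ℕ => 2 * |a| ^ 3 * (n : ℝ)⁻¹)
    (Eventually.of_forall fun n => norm_nonneg _) ?_ ?_
  · filter_upwards [eventually_gt_atTop 0, eventually_ge_atTop ⌈2 * |a|⌉₊] with n hn hn_ge
    have : (0 : ℝ) < n := Nat.cast_pos.2 hn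
    have htaylor := abs_log_one_add_div_sub_le a hn (Nat.ceil_le.1 hn_ge)
    rw [Real.norm_eq_abs]
    calc _ = |(n : ℝ) ^ 2 * (Real.log (1 + a / n) - a / n + a ^ 2 / (2 * n ^ 2))| := by
          congr 1
          field_simp
          ring
      _ = (n : ℝ) ^ 2 * |Real.log (1 + a / n) - a / n + a ^ 2 / (2 * n ^ 2)| := by
          rw [abs_mul, abs_of_pos (by positivity)]
      _ ≤ (n : ℝ) ^ 2 * (2 * |a| ^ 3 / n ^ 3) := by gcongr
      _ = _ := by field_simp
  · simpa using (tendsto_inv_atTop_nhds_zero_nat (𝕜 := ℝ)).const_mul (2 * |a| ^ 3)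

lemma sub_div_natCast_le_succ {w : ℕ → ℝ} {c : ℝ} {n : ℕ} (hn : 0 < n)
    (h : (n : ℝ) * (n + 1) * (w n - w (n + 1)) ≤ c) :
    w n - c / n ≤ w (n + 1) - c / (n + 1 : ℕ) := by
  have : (0 : ℝ) < n := Nat.cast_pos.2 hn
  have hstep : w n - w (n + 1) ≤ c / (n * (n + 1)) := by
    rw [le_div_iff₀ (by positivity)]
    linarith
  have htelescope : c / n - c / (n + 1 : ℕ) = c / (n * (n + 1)) := by
    push_cast
    field_simp
    ring
  linarith

lemma eventually_mul_le_of_tendsto_sub {w : ℕ → ℝ} (hw : Tendsto w atTop (𝓝 0)) {c : ℝ}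
    (h : ∀ᶠ n : ℕ in atTop, (n : ℝ) * (n + 1) * (w n - w (n + 1)) ≤ c) :
    ∀ᶠ n : ℕ in atTop, (n : ℝ) * w n ≤ c := by
  obtain ⟨n₀, hn₀⟩ := eventually_atTop.1 (h.and (eventually_gt_atTop 0))
  filter_upwards [eventually_ge_atTop n₀] with n hn
  have hmono : Monotone fun m : ℕ => w (m + n) - c / ((m + n : ℕ) : ℝ) :=
    monotone_nat_of_le_succ fun m => by
      obtain ⟨hle, hpos⟩ := hn₀ (m + n) (by lia)
      rw [add_right_comm m 1 n]
      exact sub_div_natCast_le_succ hpos hle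
  have hlim : Tendsto (fun m : ℕ => w m - c / (m : ℝ)) atTop (𝓝 0) := by
    simpa using hw.sub (tendsto_const_div_atTop_nhds_zero_nat c)
  have hle_zero := hmono.ge_of_tendsto ((tendsto_add_atTop_iff_nat n).2 hlim) 0
  rw [zero_add, sub_nonpos, le_div_iff₀ (Nat.cast_pos.2 (hn₀ n hn).2)] at hle_zero
  linarith

/-- The Stolz–Cesàro theorem for the quotient of `w n` by `1 / n`. -/
lemma tendsto_mul_of_tendsto_sub {w : ℕ → ℝ} (hw : Tendsto w atTop (𝓝 0)) {L : ℝ}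
    (h : Tendsto (fun n : ℕ => (n : ℝ) * (n + 1) * (w n - w (n + 1))) atTop (𝓝 L)) :
    Tendsto (fun n : ℕ => (n : ℝ) * w n) atTop (𝓝 L) := by
  rw [tendsto_order] at h ⊢
  refine ⟨fun a ha => ?_, fun a ha => ?_⟩
  · obtain ⟨b, hab, hbL⟩ := exists_between ha
    have hneg : Tendsto (fun n => -w n) atTop (𝓝 0) := by simpa using hw.neg
    filter_upwards [eventually_mul_le_of_tendsto_sub hneg (c := -b)
      ((h.1 b hbL).mono fun n hn => by linarith)] with n hn
    linarith
  · obtain ⟨b, hLb, hba⟩ := exists_between ha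
    filter_upwards [eventually_mul_le_of_tendsto_sub hw ((h.2 b hLb).mono fun n hn => hn.le)]
      with n hn
    linarith

/-- The quotient of `Γ(γ + n + 1)` by its leading asymptotics `n! n ^ γ` as `n → ∞`. -/
noncomputable def gammaRatio (γ : ℝ) (n : ℕ) : ℝ :=
  Real.Gamma (γ + n + 1) / (n.factorial * (n : ℝ) ^ γ)

variable {γ : ℝ}

lemma add_natCast_add_one_pos (hγ : -1 < γ) (n : ℕ) : 0 < γ + n + 1 := by
  linarith [n.cast_nonneg (α := ℝ)]

lemma one_add_div_natCast_succ_pos (hγ : -1 < γ) (n : ℕ) : 0 < 1 + γ / (n + 1 : ℝ) := by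
  rw [one_add_div (by positivity)]
  exact div_pos (by linarith [add_natCast_add_one_pos hγ n]) (by positivity)

lemma gammaRatio_pos (hγ : -1 < γ) {n : ℕ} (hn : 0 < n) : 0 < gammaRatio γ n :=
  div_pos (Gamma_pos_of_pos (add_natCast_add_one_pos hγ n))
    (mul_pos (by positivity) (rpow_pos_of_pos (Nat.cast_pos.2 hn) γ))

lemma prod_range_add_eq_ascPochhammer_eval (z : ℝ) : ∀ n : ℕ,
    ∏ j ∈ Finset.range n, (z + j) = (ascPochhammer ℝ n).eval z
  | 0 => by simp
  | n + 1 => by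
    rw [Finset.prod_range_succ, ascPochhammer_succ_eval, prod_range_add_eq_ascPochhammer_eval z n]

lemma Gamma_mul_inv_GammaSeq_mul (hγ : -1 < γ) {n : ℕ} (hn : 0 < n) :
    Real.Gamma (γ + 1) * (GammaSeq (γ + 1) n)⁻¹ * (n / (n + (γ + 1))) = gammaRatio γ n := by
  have hn_pos : (0 : ℝ) < n := Nat.cast_pos.2 hn
  have hsum := add_natCast_add_one_pos hγ n
  have := rpow_pos_of_pos hn_pos γ
  have hprod : Real.Gamma (γ + 1) * ∏ j ∈ Finset.range (n + 1), (γ + 1 + j) =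
      (γ + n + 1) * Real.Gamma (γ + n + 1) := by
    rw [prod_range_add_eq_ascPochhammer_eval, ← Gamma_add_natCast (neg_lt_iff_pos_add.1 hγ),
      ← Real.Gamma_add_one hsum.ne']
    push_cast
    ring_nf
  rw [GammaSeq, gammaRatio, inv_div, rpow_add hn_pos, rpow_one,
    ← mul_div_assoc (Real.Gamma (γ + 1)) (Finset.prod _ _), hprod, add_left_comm, ← add_assoc]
  field_simp

lemma tendsto_gammaRatio (hγ : -1 < γ) : Tendsto (gammaRatio γ) atTop (𝓝 1) := by
  have hΓ := (Gamma_pos_of_pos (neg_lt_iff_pos_add.1 hγ)).ne'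
  have hlim := (((Real.GammaSeq_tendsto_Gamma (γ + 1)).inv₀ hΓ).const_mul
    (Real.Gamma (γ + 1))).mul (tendsto_natCast_div_add_atTop (γ + 1))
  rw [mul_inv_cancel₀ hΓ, one_mul] at hlim
  refine hlim.congr' ?_
  filter_upwards [eventually_gt_atTop 0] with n hn
  exact Gamma_mul_inv_GammaSeq_mul hγ hn

lemma gammaRatio_succ_mul (hγ : -1 < γ) {n : ℕ} (hn : 0 < n) :
    gammaRatio γ (n + 1) * (1 + 1 / (n : ℝ)) ^ γ = gammaRatio γ n * (1 + γ / (n + 1 : ℝ)) := by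
  have hn_pos : (0 : ℝ) < n := Nat.cast_pos.2 hn
  have hsucc_pos : (0 : ℝ) < n + 1 := by positivity
  have := rpow_pos_of_pos hn_pos γ
  have := rpow_pos_of_pos hsucc_pos γ
  have hshift : γ + (n + 1 : ℕ) + 1 = (γ + n + 1) + 1 := by
    push_cast
    ring
  rw [one_add_div hn_pos.ne', div_rpow hsucc_pos.le hn_pos.le, gammaRatio, gammaRatio, hshift,
    Real.Gamma_add_one (add_natCast_add_one_pos hγ n).ne', Nat.factorial_succ]
  push_cast
  field_simp
  ring

lemma log_gammaRatio_sub (hγ : -1 < γ) {n : ℕ} (hn : 0 < n) :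
    Real.log (gammaRatio γ n) - Real.log (gammaRatio γ (n + 1)) =
      γ * Real.log (1 + 1 / n) - Real.log (1 + γ / (n + 1 : ℝ)) := by
  have hbase : 0 < 1 + 1 / (n : ℝ) := by positivity
  have hlog := congrArg Real.log (gammaRatio_succ_mul hγ hn)
  rw [Real.log_mul (gammaRatio_pos hγ n.succ_pos).ne' (rpow_pos_of_pos hbase γ).ne',
    Real.log_mul (gammaRatio_pos hγ hn).ne' (one_add_div_natCast_succ_pos hγ n).ne',
    Real.log_rpow hbase] at hlog
  linarith

lemma tendsto_mul_log_gammaRatio (hγ : -1 < γ) :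
    Tendsto (fun n : ℕ => (n : ℝ) * Real.log (gammaRatio γ n)) atTop (𝓝 (γ * (γ + 1) / 2)) := by
  have hlog : Tendsto (fun n => Real.log (gammaRatio γ n)) atTop (𝓝 0) := by
    simpa using (tendsto_gammaRatio hγ).log one_ne_zero
  have hratio : Tendsto (fun n : ℕ => (n : ℝ) / (n + 1)) atTop (𝓝 1) :=
    tendsto_natCast_div_add_atTop 1
  have hone := tendsto_sq_mul_log_one_add_div 1
  have hsucc := (tendsto_add_atTop_iff_nat 1).2 (tendsto_sq_mul_log_one_add_div γ)
  have hlim := (((hone.const_mul γ).mul (hratio.inv₀ one_ne_zero)).sub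
    (hsucc.mul hratio)).const_add γ
  refine tendsto_mul_of_tendsto_sub hlog ((hlim.congr' ?_).trans_eq (by congr 1; ring))
  filter_upwards [eventually_gt_atTop 0] with n hn
  have : (0 : ℝ) < n := Nat.cast_pos.2 hn
  rw [log_gammaRatio_sub hγ hn]
  push_cast
  field_simp
  ring

lemma tendsto_gammaRatio_pow (hγ : -1 < γ) :
    Tendsto (fun n : ℕ => gammaRatio γ n ^ n) atTop (𝓝 (rexp (γ * (γ + 1) / 2))) := by
  refine ((continuous_exp.tendsto _).comp (tendsto_mul_log_gammaRatio hγ)).congr' ?_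
  filter_upwards [eventually_gt_atTop 0] with n hn
  rw [Function.comp_apply, Real.exp_nat_mul, Real.exp_log (gammaRatio_pos hγ hn)]

end GammaAsymptotics

section Barnes

variable {γ : ℝ}

/-- The factors of the Weierstrass product of `barnesG (1 + γ)`, indexed from `0`. -/
noncomputable def barnesFactor (γ : ℝ) (m : ℕ) : ℝ :=
  (1 + γ / (m + 1 : ℝ)) ^ (m + 1) * rexp (-γ + γ ^ 2 / (2 * (m + 1 : ℝ)))

lemma barnesFactor_pos (hγ : -1 < γ) (m : ℕ) : 0 < barnesFactor γ m :=
  mul_pos (pow_pos (one_add_div_natCast_succ_pos hγ m) _) (exp_pos _)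

lemma log_barnesFactor (hγ : -1 < γ) (m : ℕ) :
    Real.log (barnesFactor γ m) = ((m + 1 : ℕ) : ℝ) * (Real.log (1 + γ / ((m + 1 : ℕ) : ℝ)) -
      γ / ((m + 1 : ℕ) : ℝ) + γ ^ 2 / (2 * ((m + 1 : ℕ) : ℝ) ^ 2)) := by
  rw [barnesFactor, Real.log_mul (pow_pos (one_add_div_natCast_succ_pos hγ m) _).ne'
    (exp_pos _).ne', Real.log_exp, Real.log_pow]
  push_cast
  field_simp
  ring

lemma summable_log_barnesFactor (hγ : -1 < γ) :
    Summable fun m => Real.log (barnesFactor γ m) := by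
  refine Summable.of_norm_bounded_eventually_nat
    (g := fun m : ℕ => 2 * |γ| ^ 3 * (((m + 1 : ℕ) : ℝ) ^ 2)⁻¹) ?_ ?_
  · exact ((summable_nat_add_iff 1).2 (Real.summable_nat_pow_inv.2 one_lt_two)).mul_left _
  · filter_upwards [eventually_ge_atTop ⌈2 * |γ|⌉₊] with m hm
    have htaylor := abs_log_one_add_div_sub_le γ m.succ_pos
      ((Nat.ceil_le.1 hm).trans (Nat.cast_le.2 m.le_succ))
    rw [log_barnesFactor hγ, Real.norm_eq_abs, abs_mul, Nat.abs_cast]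
    calc _ ≤ ((m + 1 : ℕ) : ℝ) * (2 * |γ| ^ 3 / ((m + 1 : ℕ) : ℝ) ^ 3) := by gcongr
      _ = _ := by field_simp

lemma tprod_barnesFactor_pos (hγ : -1 < γ) : 0 < ∏' m, barnesFactor γ m := by
  rw [← Real.rexp_tsum_eq_tprod (barnesFactor_pos hγ) (summable_log_barnesFactor hγ)]
  exact exp_pos _

lemma tendsto_prod_barnesFactor (hγ : -1 < γ) :
    Tendsto (fun n => ∏ m ∈ Finset.range n, barnesFactor γ m) atTop
      (𝓝 (∏' m, barnesFactor γ m)) :=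
  (Real.multipliable_of_summable_log (barnesFactor_pos hγ)
    (summable_log_barnesFactor hγ)).hasProd.tendsto_prod_nat

lemma barnesG_one_add (γ : ℝ) : barnesG (1 + γ) = (2 * π) ^ (γ / 2) *
    rexp (-(γ * (γ + 1) / 2) - Real.eulerMascheroniConstant * γ ^ 2 / 2) *
      ∏' m, barnesFactor γ m := by
  unfold barnesG barnesFactor
  rw [add_sub_cancel_left]
  congr 3
  ring

lemma barnesG_one_add_pos (hγ : -1 < γ) : 0 < barnesG (1 + γ) := by
  rw [barnesG_one_add]
  have := tprod_barnesFactor_pos hγ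
  positivity

/-- The product of the quotients of the moments `Γ(γ + j + 1)` of the charged Gaussian weight by
the moments `j!` of the Gaussian weight: up to scaling, the moment `𝔼 |det G| ^ (2 * γ)`. -/
noncomputable def gammaProd (γ : ℝ) (n : ℕ) : ℝ :=
  ∏ j ∈ Finset.range n, Real.Gamma (γ + j + 1) / j.factorial

lemma gammaProd_mul_prod (hγ : -1 < γ) (n : ℕ) :
    gammaProd γ n * ∏ m ∈ Finset.range n, (1 + γ / (m + 1 : ℝ)) ^ (m + 1) =
      (Real.Gamma (γ + n + 1) / n.factorial) ^ n := by
  induction n with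
  | zero => simp [gammaProd]
  | succ n ih =>
    have hshift : γ + (n + 1 : ℕ) + 1 = (γ + n + 1) + 1 := by
      push_cast
      ring
    have hquotient : (γ + n + 1) * Real.Gamma (γ + n + 1) / (((n + 1) * n.factorial : ℕ) : ℝ) =
        Real.Gamma (γ + n + 1) / n.factorial * (1 + γ / (n + 1 : ℝ)) := by
      push_cast
      field_simp
      ring
    rw [gammaProd, Finset.prod_range_succ, Finset.prod_range_succ, mul_mul_mul_comm, ← gammaProd,
      ih, hshift, Real.Gamma_add_one (add_natCast_add_one_pos hγ n).ne', Nat.factorial_succ,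
      hquotient, mul_pow]
    ring

lemma gammaProd_mul_prod_barnesFactor (hγ : -1 < γ) (n : ℕ) :
    gammaProd γ n * ∏ m ∈ Finset.range n, barnesFactor γ m =
      (Real.Gamma (γ + n + 1) / n.factorial) ^ n * rexp (-γ * n + γ ^ 2 / 2 * harmonic n) := by
  unfold barnesFactor
  rw [Finset.prod_mul_distrib, ← mul_assoc, gammaProd_mul_prod hγ, ← Real.exp_sum]
  congr 2
  rw [Finset.sum_add_distrib, Finset.sum_const, Finset.card_range, harmonic, Rat.cast_sum,
    Finset.mul_sum, nsmul_eq_mul]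
  congr 1
  · ring
  · refine Finset.sum_congr rfl fun m _ => ?_
    push_cast
    field_simp

lemma gammaProd_mul_barnesG_div (hγ : -1 < γ) {n : ℕ} (hn : 0 < n) :
    gammaProd γ n * barnesG (1 + γ) /
        ((n : ℝ) ^ (γ * n + γ ^ 2 / 2) * rexp (-γ * n) * (2 * π) ^ (γ / 2)) =
      gammaRatio γ n ^ n * rexp (-(γ * (γ + 1) / 2)) *
        rexp (γ ^ 2 / 2 * (harmonic n - Real.log n - Real.eulerMascheroniConstant)) *
        ((∏ m ∈ Finset.range n, barnesFactor γ m)⁻¹ * ∏' m, barnesFactor γ m) := by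
  have hn_pos : (0 : ℝ) < n := Nat.cast_pos.2 hn
  have := rpow_pos_of_pos hn_pos γ
  have hprod : 0 < ∏ m ∈ Finset.range n, barnesFactor γ m :=
    Finset.prod_pos fun m _ => barnesFactor_pos hγ m
  have hΓ : Real.Gamma (γ + n + 1) / n.factorial = gammaRatio γ n * n ^ γ := by
    rw [gammaRatio]
    field_simp
  have hpow_split : (n : ℝ) ^ (γ * n + γ ^ 2 / 2) =
      (n ^ γ) ^ n * rexp (γ ^ 2 / 2 * Real.log n) := by
    rw [rpow_add hn_pos, rpow_mul hn_pos.le, rpow_natCast, rpow_def_of_pos hn_pos (γ ^ 2 / 2),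
      mul_comm (Real.log n)]
  have hexp : rexp (γ ^ 2 / 2 * (harmonic n - Real.log n - Real.eulerMascheroniConstant)) =
      rexp (γ ^ 2 / 2 * harmonic n) / rexp (γ ^ 2 / 2 * Real.log n) *
        rexp (-(Real.eulerMascheroniConstant * γ ^ 2 / 2)) := by
    rw [← Real.exp_sub, ← Real.exp_add]
    congr 1
    ring
  rw [hexp, eq_div_of_mul_eq hprod.ne' (gammaProd_mul_prod_barnesFactor hγ n), barnesG_one_add, hΓ,
    hpow_split, mul_pow, Real.exp_add, sub_eq_add_neg, Real.exp_add]
  field_simp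

theorem tendsto_gammaProd (hγ : -1 < γ) :
    Tendsto (fun n : ℕ => gammaProd γ n * barnesG (1 + γ) /
      ((n : ℝ) ^ (γ * n + γ ^ 2 / 2) * rexp (-γ * n) * (2 * π) ^ (γ / 2))) atTop (𝓝 1) := by
  have hratio := (tendsto_gammaRatio_pow hγ).mul_const (rexp (-(γ * (γ + 1) / 2)))
  rw [← Real.exp_add, add_neg_cancel, Real.exp_zero] at hratio
  have hharmonic := (continuous_exp.tendsto _).comp
    ((Real.tendsto_harmonic_sub_log.sub_const Real.eulerMascheroniConstant).const_mul (γ ^ 2 / 2))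
  rw [sub_self, mul_zero, Real.exp_zero] at hharmonic
  have hweierstrass := ((tendsto_prod_barnesFactor hγ).inv₀ (tprod_barnesFactor_pos hγ).ne'
    ).mul_const (∏' m, barnesFactor γ m)
  rw [inv_mul_cancel₀ (tprod_barnesFactor_pos hγ).ne'] at hweierstrass
  have hlim := (hratio.mul hharmonic).mul hweierstrass
  rw [one_mul, one_mul] at hlim
  refine hlim.congr' ?_
  filter_upwards [eventually_gt_atTop 0] with n hn
  exact (gammaProd_mul_barnesG_div hγ hn).symm

lemma tendsto_Gamma_stirling (hγ : -1 < γ) :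
    Tendsto (fun n : ℕ => Real.Gamma (γ + n + 1) /
      ((n : ℝ) ^ (n + γ + 1 / 2) * rexp (-n) * (2 * π) ^ (1 / 2 : ℝ))) atTop (𝓝 1) := by
  have hstirling := Stirling.tendsto_stirlingSeq_sqrt_pi.div_const (√π)
  rw [div_self (by positivity)] at hstirling
  have hlim := (tendsto_gammaRatio hγ).mul hstirling
  rw [one_mul] at hlim
  refine hlim.congr' ?_
  filter_upwards [eventually_gt_atTop 0] with n hn
  have hn_pos : (0 : ℝ) < n := Nat.cast_pos.2 hn
  have := rpow_pos_of_pos hn_pos γ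
  have hpow_split : (n : ℝ) ^ (n + γ + 1 / 2) = n ^ n * n ^ γ * √n := by
    rw [rpow_add hn_pos, rpow_add hn_pos, rpow_natCast, sqrt_eq_rpow]
  have hexp : rexp (-n) = (rexp 1 ^ n)⁻¹ := by
    rw [← Real.exp_nat_mul, mul_one, Real.exp_neg]
  rw [gammaRatio, Stirling.stirlingSeq, hpow_split, hexp, ← sqrt_eq_rpow, div_pow,
    Real.sqrt_mul zero_le_two, Real.sqrt_mul zero_le_two]
  field_simp

lemma tendsto_prod_Gamma_stirling (hγ : -1 < γ) (k : ℕ) :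
    Tendsto (fun n : ℕ => (∏ i ∈ Finset.range k, Real.Gamma (γ + n + i + 1)) /
      ((n : ℝ) ^ (k * n + k * γ + (k : ℝ) ^ 2 / 2) * rexp (-k * n) * (2 * π) ^ (k / 2 : ℝ)))
      atTop (𝓝 1) := by
  induction k with
  | zero => simp
  | succ k ih =>
    have hlim := ih.mul (tendsto_Gamma_stirling (γ := γ + k)
      (hγ.trans_le (le_add_of_nonneg_right k.cast_nonneg)))
    rw [one_mul] at hlim
    refine hlim.congr' ?_
    filter_upwards [eventually_gt_atTop 0] with n hn
    have hpow : (n : ℝ) ^ (((k + 1 : ℕ) : ℝ) * n + ((k + 1 : ℕ) : ℝ) * γ +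
        ((k + 1 : ℕ) : ℝ) ^ 2 / 2) =
        n ^ (k * n + k * γ + (k : ℝ) ^ 2 / 2) * n ^ (n + (γ + k) + 1 / 2) := by
      rw [← rpow_add (Nat.cast_pos.2 hn)]
      congr 1
      push_cast
      ring
    have hexp : rexp (-((k + 1 : ℕ) : ℝ) * n) = rexp (-k * n) * rexp (-n) := by
      rw [← Real.exp_add]
      congr 1
      push_cast
      ring
    have htwo_pi : (2 * π) ^ (((k + 1 : ℕ) : ℝ) / 2) =
        (2 * π) ^ (k / 2 : ℝ) * (2 * π) ^ (1 / 2 : ℝ) := by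
      rw [← rpow_add (by positivity), Nat.cast_succ, add_div]
    rw [Finset.prod_range_succ, hpow, hexp, htwo_pi, div_mul_div_comm, add_right_comm γ k n]
    ring

lemma gammaProd_natCast_mul (k n : ℕ) :
    gammaProd k n * ∏ j ∈ Finset.range k, (j.factorial : ℝ) =
      ∏ i ∈ Finset.range k, Real.Gamma (0 + n + i + 1) := by
  have hΓ : ∀ a b : ℕ, Real.Gamma ((a : ℝ) + b + 1) = ((a + b).factorial : ℝ) := fun a b => by
    rw [← Real.Gamma_nat_eq_factorial, Nat.cast_add]
  have hne : (∏ j ∈ Finset.range n, (j.factorial : ℝ)) ≠ 0 :=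
    Finset.prod_ne_zero_iff.2 fun j _ => by positivity
  have hsplit := Finset.prod_range_add (fun j => (j.factorial : ℝ)) k n
  rw [add_comm, Finset.prod_range_add (fun j => (j.factorial : ℝ)) n k] at hsplit
  simp only [gammaProd, zero_add, hΓ, Finset.prod_div_distrib]
  rw [div_mul_eq_mul_div, div_eq_iff hne, mul_comm, ← hsplit, mul_comm]

theorem barnesG_one_add_natCast (k : ℕ) :
    barnesG (1 + k) = ∏ j ∈ Finset.range k, (j.factorial : ℝ) := by
  have hk : (-1 : ℝ) < k := neg_one_lt_zero.trans_le k.cast_nonneg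
  have hG := barnesG_one_add_pos hk
  have hlim := ((tendsto_gammaProd hk).mul_const (barnesG (1 + k))⁻¹).mul_const
    (∏ j ∈ Finset.range k, (j.factorial : ℝ))
  have heq := tendsto_nhds_unique (hlim.congr fun n => ?_)
    (tendsto_prod_Gamma_stirling neg_one_lt_zero k)
  · rwa [one_mul, inv_mul_eq_one₀ hG.ne'] at heq
  · rw [← gammaProd_natCast_mul, mul_zero, add_zero]
    field_simp

end Barnes

section Asymptotics

variable {γ : ℝ} {k : ℕ}

lemma correlatorConst_div_eq (hγ : -1 < γ) (k : ℕ) {n : ℕ} (hn : 0 < n) :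
    (n : ℝ) ^ (-((γ + k) * n)) * ((∏ j ∈ Finset.range n, (j.factorial : ℝ))⁻¹ *
        ∏ j ∈ Finset.range (k + n), Real.Gamma (γ + j + 1)) /
      (rexp (-(γ + k) * n) * (n : ℝ) ^ ((γ + k) ^ 2 / 2) * (2 * π) ^ ((γ + k) / 2) /
        barnesG (1 + γ)) =
      gammaProd γ n * barnesG (1 + γ) /
        ((n : ℝ) ^ (γ * n + γ ^ 2 / 2) * rexp (-γ * n) * (2 * π) ^ (γ / 2)) *
      ((∏ i ∈ Finset.range k, Real.Gamma (γ + n + i + 1)) /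
        ((n : ℝ) ^ (k * n + k * γ + (k : ℝ) ^ 2 / 2) * rexp (-k * n) *
          (2 * π) ^ (k / 2 : ℝ))) := by
  have hn_pos : (0 : ℝ) < n := Nat.cast_pos.2 hn
  have hprod : (∏ j ∈ Finset.range n, (j.factorial : ℝ))⁻¹ *
      ∏ j ∈ Finset.range (k + n), Real.Gamma (γ + j + 1) =
      gammaProd γ n * ∏ i ∈ Finset.range k, Real.Gamma (γ + n + i + 1) := by
    rw [inv_mul_eq_div, add_comm k, Finset.prod_range_add, gammaProd, Finset.prod_div_distrib,
      div_mul_eq_mul_div]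
    simp only [Nat.cast_add, add_assoc]
  have hpow : (n : ℝ) ^ (-((γ + k) * n)) *
      (n ^ (γ * n + γ ^ 2 / 2) * n ^ (k * n + k * γ + (k : ℝ) ^ 2 / 2)) =
      n ^ ((γ + k) ^ 2 / 2) := by
    rw [← rpow_add hn_pos, ← rpow_add hn_pos]
    congr 1
    ring
  have hexp : rexp (-(γ + k) * n) = rexp (-γ * n) * rexp (-k * n) := by
    rw [← Real.exp_add]
    congr 1
    ring
  have htwo_pi : (2 * π) ^ ((γ + k) / 2) = (2 * π) ^ (γ / 2) * (2 * π) ^ (k / 2 : ℝ) := by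
    rw [← rpow_add (by positivity), add_div]
  have := barnesG_one_add_pos hγ
  have := rpow_pos_of_pos hn_pos (-((γ + k) * n))
  have := rpow_pos_of_pos hn_pos (γ * n + γ ^ 2 / 2)
  have := rpow_pos_of_pos hn_pos (k * n + k * γ + (k : ℝ) ^ 2 / 2)
  rw [hprod, ← hpow, hexp, htwo_pi]
  field_simp

lemma tendsto_correlatorConst_div (hγ : -1 < γ) (k : ℕ) :
    Tendsto (fun n : ℕ => (n : ℝ) ^ (-((γ + k) * n)) *
      ((∏ j ∈ Finset.range n, (j.factorial : ℝ))⁻¹ *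
        ∏ j ∈ Finset.range (k + n), Real.Gamma (γ + j + 1)) /
      (rexp (-(γ + k) * n) * (n : ℝ) ^ ((γ + k) ^ 2 / 2) * (2 * π) ^ ((γ + k) / 2) /
        barnesG (1 + γ))) atTop (𝓝 1) := by
  have hlim := (tendsto_gammaProd hγ).mul (tendsto_prod_Gamma_stirling hγ k)
  rw [one_mul] at hlim
  refine hlim.congr' ?_
  filter_upwards [eventually_gt_atTop 0] with n hn
  exact (correlatorConst_div_eq hγ k hn).symm

/-- The continuous extension of `twoChargeAsymptotic N γ k 0 (u / √N)` to `u = 0`. -/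
noncomputable def collisionAsymptotic (γ : ℝ) (k N : ℕ) (u : ℂ) : ℝ :=
  rexp (-(γ + k) * N) * (N : ℝ) ^ ((γ + k) ^ 2 / 2) * (2 * π) ^ ((γ + k) / 2) /
    barnesG (1 + γ) * (limitKernel γ k (‖u‖ ^ 2)).det

lemma continuous_collisionAsymptotic (hγ : (k : ℝ) < γ + 1) (N : ℕ) :
    Continuous (collisionAsymptotic γ k N) :=
  continuous_const.mul ((continuous_det_limitKernel hγ).comp (continuous_norm.pow 2))

lemma exp_collision_exponents (γ : ℝ) (k : ℕ) {n : ℝ} (hn : n ≠ 0) (x L : ℝ) :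
    rexp (γ * n * (0 ^ 2 - 1) + k * n * (x / n - 1) + γ ^ 2 / 2 * Real.log n +
        (k : ℝ) ^ 2 / 2 * Real.log n) * rexp (-2 * γ * k * (L / 2 - Real.log n / 2)) =
      rexp (-(γ + k) * n) * rexp (Real.log n * ((γ + k) ^ 2 / 2)) *
        (rexp (L * -(γ * k)) * rexp (k * x)) := by
  simp only [← Real.exp_add]
  congr 1
  field_simp
  ring

theorem collisionAsymptotic_eq (hγ : (k : ℝ) < γ + 1) {N : ℕ} (hN : 1 ≤ N) {u : ℂ} (hu : u ≠ 0) :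
    collisionAsymptotic γ k N u = twoChargeAsymptotic N γ k 0 (u / (√(N : ℝ) : ℂ)) := by
  have hN_pos : (0 : ℝ) < N := Nat.cast_pos.2 hN
  have hu_pos : 0 < ‖u‖ := norm_pos_iff.2 hu
  have hnorm : ‖u / (√(N : ℝ) : ℂ)‖ = ‖u‖ / √N := by
    rw [norm_div, Complex.norm_real, norm_of_nonneg (sqrt_nonneg _)]
  have hsq : (‖u‖ / √(N : ℝ)) ^ 2 = ‖u‖ ^ 2 / N := by rw [div_pow, sq_sqrt hN_pos.le]
  have hlog : Real.log (‖u‖ / √(N : ℝ)) = Real.log (‖u‖ ^ 2) / 2 - Real.log N / 2 := by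
    rw [Real.log_div hu_pos.ne' (by positivity), Real.log_sqrt hN_pos.le, Real.log_pow]
    push_cast
    ring
  rw [collisionAsymptotic, twoChargeAsymptotic, det_limitKernel_eq_lueMaxCDF hγ (by positivity),
    barnesG_one_add_natCast, Finset.prod_range, norm_zero, sub_zero, hnorm, hsq, hlog,
    mul_div_cancel₀ _ hN_pos.ne', rpow_def_of_pos hN_pos,
    rpow_def_of_pos (pow_pos hu_pos 2), exp_collision_exponents γ k hN_pos.ne']
  simp only [div_eq_mul_inv, mul_inv]
  ring

theorem tendsto_twoChargeCorrelator_div (hγ : (k : ℝ) < γ + 1) (u : ℂ) :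
    Tendsto (fun p : ℕ × ℂ => twoChargeCorrelator p.1 γ k 0 (p.2 / (√(p.1 : ℝ) : ℂ)) /
      collisionAsymptotic γ k p.1 p.2) (atTop ×ˢ 𝓝 u) (𝓝 1) := by
  have hγ_gt : -1 < γ := by linarith [k.cast_nonneg (α := ℝ)]
  have hnorm : Tendsto (fun v : ℂ => ‖v‖ ^ 2) (𝓝 u) (𝓝 (‖u‖ ^ 2)) :=
    (continuous_norm.pow 2).tendsto u
  have hnumerator := (tendsto_det_chargeKernel hγ (‖u‖ ^ 2)).comp
    (tendsto_fst.prodMk (hnorm.comp tendsto_snd) :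
      Tendsto (fun p : ℕ × ℂ => (p.1, ‖p.2‖ ^ 2)) (atTop ×ˢ 𝓝 u) (atTop ×ˢ 𝓝 (‖u‖ ^ 2)))
  have hdenominator : Tendsto (fun p : ℕ × ℂ => (limitKernel γ k (‖p.2‖ ^ 2)).det)
      (atTop ×ˢ 𝓝 u) (𝓝 (limitKernel γ k (‖u‖ ^ 2)).det) :=
    (((continuous_det_limitKernel hγ).tendsto _).comp hnorm).comp tendsto_snd
  have hdet_pos := det_limitKernel_pos hγ (‖u‖ ^ 2)
  have hlim := ((tendsto_correlatorConst_div hγ_gt k).comp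
    (tendsto_fst (f := atTop (α := ℕ)) (g := 𝓝 u))).mul (hnumerator.div hdenominator hdet_pos.ne')
  rw [div_self hdet_pos.ne', one_mul] at hlim
  refine hlim.congr' ?_
  filter_upwards [tendsto_fst.eventually (eventually_ge_atTop 1)] with p hp
  rw [twoChargeCorrelator_eq hγ_gt k hp, det_dualKernel hγ, Complex.ofReal_re,
    collisionAsymptotic, Function.comp_apply, Pi.div_apply, Function.comp_apply, div_mul_div_comm]
  ring

end Asymptotics

theorem mainTheorem7_general (k₂ : ℕ) (γ : ℝ) (hγ : (k₂ : ℝ) < γ + 1) :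
    (∀ N : ℕ, 1 ≤ N → ∀ u₂ : ℂ,
      Integrable (charPolyProduct γ k₂ 0 (u₂ / (√(N : ℝ) : ℂ))) (ginibre N)) ∧
    ∃ A : ℕ → ℂ → ℝ,
      (∀ N : ℕ, 1 ≤ N → Continuous (A N)) ∧
      (∀ N : ℕ, 1 ≤ N → ∀ u₂ : ℂ, u₂ ≠ 0 →
        A N u₂ = twoChargeAsymptotic N γ k₂ 0 (u₂ / (√(N : ℝ) : ℂ))) ∧
      ∀ K : Set ℂ, IsCompact K →
        TendstoUniformlyOn
          (fun (N : ℕ) (u₂ : ℂ) =>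
            twoChargeCorrelator N γ k₂ 0 (u₂ / (√(N : ℝ) : ℂ)) / A N u₂)
          (fun _ => 1) atTop K := by
  have hγ_gt : -1 < γ := by linarith [k₂.cast_nonneg (α := ℝ)]
  refine ⟨fun N hN u₂ => integrable_charPolyProduct_ginibre hγ_gt k₂ hN u₂,
    collisionAsymptotic γ k₂, fun N _ => continuous_collisionAsymptotic hγ N,
    fun N hN u₂ hu => collisionAsymptotic_eq hγ hN hu, fun K hK => ?_⟩
  rw [← tendstoLocallyUniformlyOn_iff_tendstoUniformlyOn_of_compact hK,
    tendstoLocallyUniformlyOn_iff_forall_tendsto]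
  intro u _
  have hlim := (tendsto_twoChargeCorrelator_div hγ u).mono_left
    (prod_mono le_rfl (nhdsWithin_le_nhds (s := K)))
  exact (tendsto_const_nhds.prodMk_nhds hlim).mono_right (nhds_le_uniformity (1 : ℝ))

theorem mainTheorem7 (k₂ : ℕ) (γ : ℝ) (hγ : (k₂ : ℝ) ≤ γ) :
    (∀ N : ℕ, 1 ≤ N → ∀ u₂ : ℂ,
      Integrable (charPolyProduct γ k₂ 0 (u₂ / (√(N : ℝ) : ℂ))) (ginibre N)) ∧
    -- `A N` is the continuous extension of the asymptotic expression to the collision `u₂ = 0`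
    ∃ A : ℕ → ℂ → ℝ,
      (∀ N : ℕ, 1 ≤ N → Continuous (A N)) ∧
      (∀ N : ℕ, 1 ≤ N → ∀ u₂ : ℂ, u₂ ≠ 0 →
        A N u₂ = twoChargeAsymptotic N γ k₂ 0 (u₂ / (√(N : ℝ) : ℂ))) ∧
      ∀ K : Set ℂ, IsCompact K →
        TendstoUniformlyOn
          (fun (N : ℕ) (u₂ : ℂ) =>
            twoChargeCorrelator N γ k₂ 0 (u₂ / (√(N : ℝ) : ℂ)) / A N u₂)
          (fun _ => 1) atTop K := by
  exact mainTheorem7_general k₂ γ (by linarith)
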